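/- Consider a $K$-armed bandit over $T$ rounds, where $T\ge \max\{K,2\}$. In each round $t=1,\dots,T$ the environment chooses, in an arbitrary and possibly randomized way that may depend on the past, a loss vector $\ell^t\in[0,1]^K$. Simultaneously the learner draws an arm $i^t$ from a distribution $p^t$ that is determined by the past, and then observes $\ell^t_{i^t}$. That is, given the history before round $t$ and $\ell^t$, the arm $i^t$ has law $p^t$. Let $i^\star\in\arg\min_i \mathbb E[\sum_{t\le T}\ell^t_i]$ and $\mathrm{Reg}^T=\mathbb E\big[\sum_{t\le T}\ell^t_{i^t}-\sum_{t\le T}\ell^t_{i^\star}\big]$. Let $\mathbb E^t$ denote the conditional expectation given the history before round $t$; this history contains at least the learner's past arms and past observed losses, and may contain more (past loss vectors, internal randomness of the environment). The learner uses follow-the-regularized-leader with Shannon entropy and an extra log-barrier, with $C_{\log}=162\log K$, $\alpha=1$, $\theta=\sqrt{1/\log T}$. With $\Omega_K$ the probability simplex, $$p^t=\arg\min_{p\in\Omega_K}\Big\{\Big\langle p,\sum_{\tau<t}\hat\ell^\tau\Big\rangle - C_{\log}\sum_{i=1}^K\log p_i+\sum_{i=1}^K\gamma^t_i\,p_i\log(p_i/e)\Big\},$$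 $$\hat\ell^\tau_i=\frac{\mathbf 1\{i^\tau=i\}\,\ell^\tau_i}{p^\tau_i},\qquad \gamma^t_i=\theta\sqrt{1+\sum_{\tau<t}\big(\max\{p^\tau_i,1/T\}\big)^{1-2\alpha}} .$$ Then there is an absolute constant $\kappa>0$ (independent of $K$, $T$, the environment and all other parameters) such that the following hold simultaneously. (i) Always, $\mathrm{Reg}^T\le \kappa\,\sqrt{KT}\,\log T$. (ii) Suppose that for some $\Delta\in[0,1]^K$ and $C\ge0$, $$\mathrm{Reg}^T\ \ge\ \mathbb E\Big[\sum_{t\le T}\sum_{i=1}^K p^t_i\Delta_i\Big]-C .$$ Put $U=\{i:\Delta_i=0\}$, $V=[K]\setminus U$, $\Delta_{\min}=\min_{i\in V}\Delta_i$ and $\mathbb G=\frac{|U|}{\Delta_{\min}}+\sum_{i\in V}\frac1{\Delta_i}$ (with $\mathbb G=0$ if $V=\emptyset$); no uniqueness of the zero-gap arm is assumed. Let $D$ be any real number with $\mathbb E\big[\sum_{t\le T}\max_{i\in U}\mathbb E^t[\ell^t_i-\ell^t_{i^\star}]\big]\le D$ (a maximum over the empty set counts as $0$). Then $$\mathrm{Reg}^T\le\kappa\Big(\mathbb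 G(\log T)^2+\sqrt{C\,\mathbb G(\log T)^2}+K^2(\log T)^{3/2}+D\Big).$$ -/

import Mathlib

open MeasureTheory Finset

noncomputable section

/-! Rounds are indexed by `t = 0, …, T - 1`, arms by `Fin K`. -/

/-- Probability vectors over `K` arms all of whose entries are positive, i.e. the part of the
simplex on which an objective containing `-∑ i, log (x i)` is finite. -/
def posSimplex (K : ℕ) : Set (Fin K → ℝ) :=
  {x | (∀ i, 0 < x i) ∧ ∑ i, x i = 1}

/-- Importance-weighted loss estimator: the arm `a` was drawn from the distribution `q`, and
`l` is the loss vector, of which only the entry `l a` is used. -/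
def lossEstimator {K : ℕ} (q : Fin K → ℝ) (a : Fin K) (l : Fin K → ℝ) (i : Fin K) : ℝ :=
  (if a = i then l i else 0) / q i

/-- Arm-dependent learning rate of round `t`, given the distributions `p` of the rounds
before `t`. -/
def learningRate {K : ℕ} (θ α : ℝ) (T : ℕ) (p : ℕ → Fin K → ℝ) (t : ℕ) (i : Fin K) : ℝ :=
  θ * √(1 + ∑ τ ∈ range t, (max (p τ i) (1 / (T : ℝ))) ^ (1 - 2 * α))

/-- Shifted Shannon entropy with arm-dependent learning rates `γ`, plus a log-barrier with
coefficient `Clog`. -/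
def shannonRegularizer {K : ℕ} (Clog : ℝ) (γ : Fin K → ℝ) (x : Fin K → ℝ) : ℝ :=
  -Clog * ∑ i, Real.log (x i) + ∑ i, γ i * (x i * Real.log (x i / Real.exp 1))

/-- The objective of follow-the-regularized-leader in round `t`, along a sequence of
distributions `p`, arms `a` and loss vectors `l`. -/
def ftrlObjective {K : ℕ} (Clog α θ : ℝ) (T : ℕ) (p : ℕ → Fin K → ℝ) (a : ℕ → Fin K)
    (l : ℕ → Fin K → ℝ) (t : ℕ) (x : Fin K → ℝ) : ℝ :=
  ∑ i, x i * ∑ τ ∈ range t, lossEstimator (p τ) (a τ) (l τ) i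
    + shannonRegularizer Clog (learningRate θ α T p t) x

/-- In each of the `T` rounds, `p t` is the minimizer over the simplex of the round's objective
(for `Clog > 0` the objective is `+∞` at points of the simplex with a zero entry). -/
def IsShannonFTRL {K : ℕ} (Clog α θ : ℝ) (T : ℕ) (p : ℕ → Fin K → ℝ) (a : ℕ → Fin K)
    (l : ℕ → Fin K → ℝ) : Prop :=
  ∀ t < T, p t ∈ posSimplex K ∧ IsMinOn (ftrlObjective Clog α θ T p a l t) (posSimplex K) (p t)

/-- `T` rounds of the bandit protocol. `F t` is the history before round `t`: it contains at least
what the learner has seen before round `t`, and possibly more (past loss vectors,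
the internal randomness of the environment). In round `t` the environment picks `loss t`, in any
way, and simultaneously the learner draws `arm t` from `p t`; so, given the history and `loss t`,
the conditional law of `arm t` is `p t`. -/
structure IsBanditInteraction {Ω : Type*} [mΩ : MeasurableSpace Ω] (P : Measure Ω)
    (F : Filtration ℕ mΩ) {K : ℕ} (T : ℕ) (loss : ℕ → Ω → Fin K → ℝ) (arm : ℕ → Ω → Fin K)
    (p : ℕ → Ω → Fin K → ℝ) : Prop where
  measurable_loss : ∀ t < T, Measurable (loss t)
  measurable_arm : ∀ t < T, Measurable (arm t)
  loss_mem : ∀ t < T, ∀ ω i, loss t ω i ∈ Set.Icc (0 : ℝ) 1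
  arm_past : ∀ t < T, ∀ s < t, Measurable[F t] (arm s)
  observed_past : ∀ t < T, ∀ s < t, Measurable[F t] (fun ω => loss s ω (arm s ω))
  predictable : ∀ t < T, Measurable[F t] (p t)
  sampling : ∀ t < T, ∀ i,
    P[(arm t ⁻¹' {i}).indicator (fun _ => (1 : ℝ)) |
      F t ⊔ MeasurableSpace.comap (loss t) inferInstance] =ᵐ[P] fun ω => p t ω i

/-- `i` is a best arm in hindsight: it minimizes the expected cumulative loss. -/
def IsBestArm {Ω : Type*} [MeasurableSpace Ω] (P : Measure Ω) {K : ℕ} (T : ℕ)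
    (loss : ℕ → Ω → Fin K → ℝ) (i : Fin K) : Prop :=
  ∀ j, ∫ ω, ∑ t ∈ range T, loss t ω i ∂P ≤ ∫ ω, ∑ t ∈ range T, loss t ω j ∂P

/-- Pseudo-regret over `T` rounds against the arm `iStar`. -/
def regret {Ω : Type*} [MeasurableSpace Ω] (P : Measure Ω) {K : ℕ} (T : ℕ)
    (loss : ℕ → Ω → Fin K → ℝ) (arm : ℕ → Ω → Fin K) (iStar : Fin K) : ℝ :=
  ∫ ω, (∑ t ∈ range T, loss t ω (arm t ω) - ∑ t ∈ range T, loss t ω iStar) ∂P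

/-- The self-bounding condition with gap vector `Δ` and constant `C`. -/
def SelfBounding {Ω : Type*} [MeasurableSpace Ω] (P : Measure Ω) {K : ℕ} (T : ℕ)
    (loss : ℕ → Ω → Fin K → ℝ) (arm : ℕ → Ω → Fin K) (p : ℕ → Ω → Fin K → ℝ) (iStar : Fin K)
    (Δ : Fin K → ℝ) (C : ℝ) : Prop :=
  (∀ i, Δ i ∈ Set.Icc (0 : ℝ) 1) ∧ 0 ≤ C ∧
    ∫ ω, ∑ t ∈ range T, ∑ i, p t ω i * Δ i ∂P - C ≤ regret P T loss arm iStar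

/-- The set `U` of arms with zero gap. -/
def zeroGapArms {K : ℕ} (Δ : Fin K → ℝ) : Finset (Fin K) :=
  univ.filter fun i => Δ i = 0

/-- The set `V` of the remaining arms. -/
def posGapArms {K : ℕ} (Δ : Fin K → ℝ) : Finset (Fin K) :=
  univ.filter fun i => Δ i ≠ 0

/-- The instance complexity `|U| / Δ_min + ∑_{i ∈ V} 1 / Δ_i`, where `Δ_min` is the minimum of `Δ`
over `V`; if `V` is empty, then `Δ_min = +∞` and the complexity is `0`. -/
def instanceComplexity {K : ℕ} (Δ : Fin K → ℝ) : ℝ :=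
  if h : (posGapArms Δ).Nonempty then
    (#(zeroGapArms Δ) : ℝ) / (posGapArms Δ).inf' h Δ + ∑ i ∈ posGapArms Δ, 1 / Δ i
  else 0

/-- `E[∑_t max_{i ∈ U} E[ℓ_t(i) - ℓ_t(iStar) | history before round t]]`, where a maximum over an
empty set of arms counts as `0`. -/
def benchmarkDrift {Ω : Type*} [mΩ : MeasurableSpace Ω] (P : Measure Ω) (F : Filtration ℕ mΩ)
    {K : ℕ} (T : ℕ) (loss : ℕ → Ω → Fin K → ℝ) (iStar : Fin K) (U : Finset (Fin K)) : ℝ :=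
  ∫ ω, ∑ t ∈ range T,
    (if h : U.Nonempty then
      U.sup' h fun i => (P[fun ω' => loss t ω' i - loss t ω' iStar | F t]) ω
    else 0) ∂P

end

noncomputable section

/-! The regularizer is separable, so the minimizer over the arms of a set `S` is explicit up to one
multiplier `lam`: its `i`-th entry is `barrierInv C (γ i) (lam - L i)`. Since `barrierDeriv` is
increasing and concave, `barrierInv` is increasing and convex, with slope `barrierWeight`.

The played distribution `p` is compared round by round with the moving `comparator` `q`: the
minimizer for the same estimated losses and the same learning rates when only the arms of `S` are
allowed. The potential is `valueGap`, the optimal value over all arms minus that over `S`. By the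
envelope principle, charging a loss `y` to arm `a` changes it by the average of `y (p_a - q_a)`
along the way. Hence the estimated regret of a round is the increase of the potential plus the
amount by which `p_a` drops faster than `q_a`. `ftrlSolution_change_sub_change_le` bounds this
excess by the share of `a` in the curvature weight of `S` times the mass that leaves `S`, so arms of
`S` cost almost nothing while `S` dominates. An increase of the rates is charged to `Sᶜ` alone,
because `p ≤ q` on `S` and `shiftedEntropy` decreases on `(0, 1]` (`valueGap_sub_add_rate_le`). The
log-barrier keeps probabilities within constant factors during a round.

Under the rates `θ √(rateSum)`, Cauchy–Schwarz and a logarithmic telescoping sum turn stability and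
rate costs into `30 log T · regretScale S`, that is, `log T` times `∑_{Sᶜ} √(1 + P_i) + √(|S| (1 +
P(Sᶜ)))`, where `P_i` is the sum over rounds of the probabilities of arm `i`. The value `θ = √(1 /
log T)` balances the two kinds of cost. Importance weighting is unbiased, and `q` is predictable and
supported on `S`, so replacing `q` by `iStar` costs at most `benchmarkDrift`. The result is
`regret_le_regretScale`.

For (i), `S = {iStar}` has no drift and a scale of order `√(K T)`. For (ii), `S` is the set of
zero-gap arms, or `{iStar}` if there are none. Weighting by `Δ` in Cauchy–Schwarz gives `regretScale
≤ K + 2 √(G ∑ P_i Δ_i)` with `G = instanceComplexity Δ`; Jensen and the self-bounding condition then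
leave a quadratic inequality for the regret. -/

/-- Derivative of the potential `γ x log (x / e) - C log x`. -/
def barrierDeriv (C γ x : ℝ) : ℝ := γ * Real.log x - C / x

/-- Inverse of the second derivative of the potential `γ x log (x / e) - C log x`. -/
def barrierWeight (C γ x : ℝ) : ℝ := x ^ 2 / (γ * x + C)

/-- Inverse function of `barrierDeriv` on the positive reals. -/
def barrierInv (C γ z : ℝ) : ℝ := Function.invFunOn (barrierDeriv C γ) (Set.Ioi 0) z

/-- Shannon entropy (with the sign of a convex function), shifted so that its derivative is
`log`. -/
def shiftedEntropy (x : ℝ) : ℝ := x * Real.log (x / Real.exp 1)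

/-! ### One-dimensional calculus of the potential and of its inverse derivative -/

section Scalar

variable {C γ x y : ℝ}

lemma barrierWeight_pos (hC : 0 < C) (hγ : 0 < γ) (hx : 0 < x) : 0 < barrierWeight C γ x := by
  unfold barrierWeight; positivity

lemma barrierWeight_mono (hC : 0 < C) (hγ : 0 < γ) (hx : 0 < x) (hxy : x ≤ y) :
    barrierWeight C γ x ≤ barrierWeight C γ y := by
  have hy : 0 < y := hx.trans_le hxy
  unfold barrierWeight
  rw [div_le_div_iff₀ (by positivity) (by positivity)]
  have h1 : x * y * γ * (y - x) ≥ 0 := mul_nonneg (by positivity) (by linarith)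
  have h2 : C * ((y - x) * (y + x)) ≥ 0 :=
    mul_nonneg hC.le (mul_nonneg (by linarith) (by linarith))
  nlinarith

lemma barrierWeight_two_mul_le (hC : 0 < C) (hγ : 0 < γ) (hx : 0 < x) :
    barrierWeight C γ (2 * x) ≤ 4 * barrierWeight C γ x := by
  unfold barrierWeight
  rw [mul_pow, ← mul_div_assoc]
  norm_num
  gcongr
  linarith

lemma barrierWeight_le_sq_div (hC : 0 < C) (hγ : 0 < γ) (hx : 0 < x) :
    barrierWeight C γ x ≤ x ^ 2 / C := by
  unfold barrierWeight
  gcongr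
  nlinarith [mul_pos hγ hx]

/-- Tangent inequality for the concave function `barrierDeriv`. -/
lemma barrierWeight_mul_sub_le (hC : 0 < C) (hγ : 0 < γ) (hx : 0 < x) (hy : 0 < y) :
    barrierWeight C γ x * (barrierDeriv C γ y - barrierDeriv C γ x) ≤ y - x := by
  have h1 : Real.log y - Real.log x ≤ (y - x) / x := by
    rw [← Real.log_div hy.ne' hx.ne', sub_div, div_self hx.ne']
    exact Real.log_le_sub_one_of_pos (div_pos hy hx)
  have h2 : C / x - C / y ≤ C * (y - x) / x ^ 2 := by
    have : C * (y - x) / x ^ 2 - (C / x - C / y) = C * (y - x) ^ 2 / (x ^ 2 * y) := by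
      field_simp
    have : 0 ≤ C * (y - x) ^ 2 / (x ^ 2 * y) := by positivity
    linarith
  have h3 : barrierDeriv C γ y - barrierDeriv C γ x ≤ (γ * x + C) / x ^ 2 * (y - x) := by
    have e : (γ * x + C) / x ^ 2 * (y - x) = γ * ((y - x) / x) + C * (y - x) / x ^ 2 := by
      field_simp
    rw [e]
    unfold barrierDeriv
    nlinarith [mul_le_mul_of_nonneg_left h1 hγ.le]
  have hw := barrierWeight_pos hC hγ hx
  have h4 := mul_le_mul_of_nonneg_left h3 hw.le
  have e : barrierWeight C γ x * ((γ * x + C) / x ^ 2 * (y - x)) = y - x := by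
    have : γ * x + C ≠ 0 := by positivity
    unfold barrierWeight
    field_simp
  linarith

lemma barrierDeriv_strictMonoOn (hC : 0 < C) (hγ : 0 < γ) :
    StrictMonoOn (barrierDeriv C γ) (Set.Ioi 0) := by
  intro x hx y hy hxy
  have hx' : 0 < x := hx
  unfold barrierDeriv
  have h1 := Real.log_lt_log hx' hxy
  have h2 : C / y < C / x := by gcongr
  nlinarith [mul_lt_mul_of_pos_left h1 hγ]

lemma barrierDeriv_surjOn (hC : 0 < C) (hγ : 0 < γ) (z : ℝ) :
    ∃ x, 0 < x ∧ barrierDeriv C γ x = z := by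
  -- As `a ≤ 1 ≤ b`, the barrier term only helps at `a`, and at `b` it costs at most `C`, which the
  -- exponent of `b` compensates.
  set b : ℝ := Real.exp ((|z| + C) / γ) with hb
  set a : ℝ := Real.exp (-(|z| / γ)) with ha
  have hbpos : 0 < b := Real.exp_pos _
  have hapos : 0 < a := Real.exp_pos _
  have hb1 : 1 ≤ b := Real.one_le_exp (by positivity)
  have hab : a ≤ b := by
    have : (0 : ℝ) ≤ |z| / γ := by positivity
    have h2 : (0 : ℝ) ≤ (|z| + C) / γ := by positivity
    exact Real.exp_le_exp.2 (by linarith)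
  have hcont : ContinuousOn (barrierDeriv C γ) (Set.Icc a b) := by
    unfold barrierDeriv
    refine ContinuousOn.sub (continuousOn_const.mul ?_) (continuousOn_const.div continuousOn_id ?_)
    · exact Real.continuousOn_log.mono fun x hx => (hapos.trans_le hx.1).ne'
    · exact fun x hx => (hapos.trans_le hx.1).ne'
  have hfa : barrierDeriv C γ a ≤ z := by
    have e : γ * Real.log a = -|z| := by rw [ha, Real.log_exp]; field_simp
    have : 0 < C / a := by positivity
    unfold barrierDeriv
    rw [e]
    linarith [neg_abs_le z]
  have hfb : z ≤ barrierDeriv C γ b := by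
    have e : γ * Real.log b = |z| + C := by rw [hb, Real.log_exp]; field_simp
    have : C / b ≤ C := div_le_self hC.le hb1
    unfold barrierDeriv
    rw [e]
    linarith [le_abs_self z]
  obtain ⟨x, hx, hxz⟩ := intermediate_value_Icc hab hcont ⟨hfa, hfb⟩
  exact ⟨x, hapos.trans_le hx.1, hxz⟩

lemma barrierInv_pos (hC : 0 < C) (hγ : 0 < γ) (z : ℝ) : 0 < barrierInv C γ z := by
  obtain ⟨x, hx, h⟩ := barrierDeriv_surjOn hC hγ z
  exact Function.invFunOn_mem (s := Set.Ioi 0) (f := barrierDeriv C γ) ⟨x, hx, h⟩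

lemma barrierDeriv_barrierInv (hC : 0 < C) (hγ : 0 < γ) (z : ℝ) :
    barrierDeriv C γ (barrierInv C γ z) = z := by
  obtain ⟨x, hx, h⟩ := barrierDeriv_surjOn hC hγ z
  exact Function.invFunOn_eq (s := Set.Ioi 0) (f := barrierDeriv C γ) ⟨x, hx, h⟩

/-- Describes sublevel sets of the implicit inverse by the explicit function `barrierDeriv`;
measurability rests on this. -/
lemma barrierInv_lt_iff (hC : 0 < C) (hγ : 0 < γ) (hx : 0 < x) (z : ℝ) :
    barrierInv C γ z < x ↔ z < barrierDeriv C γ x := by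
  have := (barrierDeriv_strictMonoOn hC hγ).lt_iff_lt (barrierInv_pos hC hγ z) hx
  rw [barrierDeriv_barrierInv hC hγ] at this
  exact this.symm

lemma barrierInv_le_iff (hC : 0 < C) (hγ : 0 < γ) (hx : 0 < x) (z : ℝ) :
    barrierInv C γ z ≤ x ↔ z ≤ barrierDeriv C γ x := by
  have := (barrierDeriv_strictMonoOn hC hγ).le_iff_le (barrierInv_pos hC hγ z) hx
  rw [barrierDeriv_barrierInv hC hγ] at this
  exact this.symm

lemma barrierInv_strictMono (hC : 0 < C) (hγ : 0 < γ) : StrictMono (barrierInv C γ) := by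
  intro z z' h
  rw [barrierInv_lt_iff hC hγ (barrierInv_pos hC hγ _), barrierDeriv_barrierInv hC hγ]
  exact h

lemma barrierInv_barrierDeriv (hC : 0 < C) (hγ : 0 < γ) (hx : 0 < x) :
    barrierInv C γ (barrierDeriv C γ x) = x :=
  (barrierDeriv_strictMonoOn hC hγ).injOn (barrierInv_pos hC hγ _) hx
    (barrierDeriv_barrierInv hC hγ _)

/-- Tangent inequality for the convex function `barrierInv`. -/
lemma le_barrierInv_sub (hC : 0 < C) (hγ : 0 < γ) (z z' : ℝ) :
    barrierWeight C γ (barrierInv C γ z) * (z' - z) ≤ barrierInv C γ z' - barrierInv C γ z := by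
  have := barrierWeight_mul_sub_le hC hγ (barrierInv_pos hC hγ z) (barrierInv_pos hC hγ z')
  rwa [barrierDeriv_barrierInv hC hγ, barrierDeriv_barrierInv hC hγ] at this

lemma barrierInv_continuous (hC : 0 < C) (hγ : 0 < γ) : Continuous (barrierInv C γ) := by
  rw [continuous_iff_continuousAt]
  intro z
  refine ((barrierInv_strictMono hC hγ).strictMonoOn Set.univ).continuousAt_of_image_mem_nhds
    Filter.univ_mem (Filter.mem_of_superset (Ioi_mem_nhds (barrierInv_pos hC hγ z)) ?_)
  exact fun x hx => ⟨barrierDeriv C γ x, Set.mem_univ _, barrierInv_barrierDeriv hC hγ hx⟩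

/-- Increments of the convex function `barrierInv` are monotone. -/
lemma barrierInv_increment_mono (hC : 0 < C) (hγ : 0 < γ) {z z' d : ℝ} (hz : z ≤ z')
    (hd : 0 ≤ d) :
    barrierInv C γ (z + d) - barrierInv C γ z ≤ barrierInv C γ (z' + d) - barrierInv C γ z' := by
  set x := barrierInv C γ z with hx
  set y := barrierInv C γ z' with hy
  set e := barrierInv C γ (z + d) - x with he
  have hx0 : 0 < x := barrierInv_pos hC hγ _
  have hmono := (barrierInv_strictMono hC hγ).monotone
  have hxy : x ≤ y := hmono hz
  have hy0 : 0 < y := hx0.trans_le hxy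
  have he0 : 0 ≤ e := sub_nonneg.2 (hmono (by linarith))
  have h1 : barrierDeriv C γ (x + e) = z + d := by
    rw [he, add_sub_cancel, barrierDeriv_barrierInv hC hγ]
  have hkx : barrierDeriv C γ x = z := barrierDeriv_barrierInv hC hγ _
  have hky : barrierDeriv C γ y = z' := barrierDeriv_barrierInv hC hγ _
  -- Concavity of `barrierDeriv`: the same step `e` in probability uses up less of the dual
  -- increment `d` at the larger point `y`.
  have h2 : barrierDeriv C γ (y + e) - barrierDeriv C γ y
      ≤ barrierDeriv C γ (x + e) - barrierDeriv C γ x := by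
    have l : Real.log (y + e) - Real.log y ≤ Real.log (x + e) - Real.log x := by
      rw [← Real.log_div (by positivity) (by positivity),
        ← Real.log_div (by positivity) (by positivity)]
      apply Real.log_le_log (by positivity)
      rw [div_le_div_iff₀ hy0 hx0]
      nlinarith
    have l2 : C / y - C / (y + e) ≤ C / x - C / (x + e) := by
      have e1 : C / y - C / (y + e) = C * e / (y * (y + e)) := by
        have : y + e ≠ 0 := by positivity
        field_simp; ring
      have e2 : C / x - C / (x + e) = C * e / (x * (x + e)) := by
        have : x + e ≠ 0 := by positivity
        field_simp; ring
      rw [e1, e2]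
      gcongr
    unfold barrierDeriv
    nlinarith [mul_le_mul_of_nonneg_left l hγ.le]
  have h3 : barrierDeriv C γ (y + e) ≤ z' + d := by linarith
  have h4 : y + e ≤ barrierInv C γ (z' + d) := by
    by_contra! hcon
    rw [barrierInv_lt_iff hC hγ (by positivity)] at hcon
    linarith
  linarith

lemma shiftedEntropy_eq (hx : 0 < x) : shiftedEntropy x = x * (Real.log x - 1) := by
  unfold shiftedEntropy
  rw [Real.log_div hx.ne' (Real.exp_ne_zero _), Real.log_exp]

lemma le_shiftedEntropy_sub (hx : 0 < x) (hy : 0 < y) :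
    Real.log x * (y - x) ≤ shiftedEntropy y - shiftedEntropy x := by
  rw [shiftedEntropy_eq hx, shiftedEntropy_eq hy]
  have h := Real.log_le_sub_one_of_pos (div_pos hx hy)
  rw [Real.log_div hx.ne' hy.ne'] at h
  have := mul_le_mul_of_nonneg_left h hy.le
  rw [mul_sub, mul_sub, mul_div_cancel₀ _ hy.ne'] at this
  nlinarith

/-- The derivative is `log`, which is nonpositive up to `1`. The shift by `e` in the entropy serves
exactly this monotonicity, which lets the arms of `S` drop out of the rate cost. -/
lemma shiftedEntropy_anti (hx : 0 < x) (hxy : x ≤ y) (hy : y ≤ 1) :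
    shiftedEntropy y ≤ shiftedEntropy x := by
  have h := le_shiftedEntropy_sub (hx.trans_le hxy) hx
  have h2 := Real.log_nonpos (hx.trans_le hxy).le hy
  nlinarith

lemma neg_one_le_shiftedEntropy (hx : 0 < x) : -1 ≤ shiftedEntropy x := by
  have h := le_shiftedEntropy_sub one_pos hx
  rw [Real.log_one, zero_mul] at h
  have : shiftedEntropy 1 = -1 := by rw [shiftedEntropy_eq one_pos]; simp
  linarith

lemma shiftedEntropy_nonpos (hx : 0 < x) (hx1 : x ≤ 1) : shiftedEntropy x ≤ 0 := by
  rw [shiftedEntropy_eq hx]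
  have := Real.log_nonpos hx.le hx1
  nlinarith

/-- Tangent inequality for the strictly convex potential. -/
lemma barrierDeriv_mul_sub_le (hC : 0 < C) (hγ : 0 < γ) (hx : 0 < x) (hy : 0 < y) :
    barrierDeriv C γ x * (y - x) ≤
      (-C * Real.log y + γ * shiftedEntropy y) - (-C * Real.log x + γ * shiftedEntropy x) := by
  have h1 := le_shiftedEntropy_sub hx hy
  have h2 := Real.log_le_sub_one_of_pos (div_pos hy hx)
  rw [Real.log_div hy.ne' hx.ne'] at h2
  have e : y / x - 1 = (y - x) / x := by field_simp
  rw [e] at h2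
  unfold barrierDeriv
  have e2 : (γ * Real.log x - C / x) * (y - x)
    = γ * (Real.log x * (y - x)) - C * ((y - x) / x) := by ring
  rw [e2]
  nlinarith [mul_le_mul_of_nonneg_left h1 hγ.le, mul_le_mul_of_nonneg_left h2 hC.le]

lemma barrierDeriv_mul_sub_lt (hC : 0 < C) (hγ : 0 < γ) (hx : 0 < x) (hy : 0 < y) (hne : y ≠ x) :
    barrierDeriv C γ x * (y - x) <
      (-C * Real.log y + γ * shiftedEntropy y) - (-C * Real.log x + γ * shiftedEntropy x) := by
  have h1 := le_shiftedEntropy_sub hx hy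
  have h2 := Real.log_lt_sub_one_of_pos (div_pos hy hx) (by rwa [ne_eq, div_eq_one_iff_eq hx.ne'])
  rw [Real.log_div hy.ne' hx.ne'] at h2
  have e : y / x - 1 = (y - x) / x := by field_simp
  rw [e] at h2
  unfold barrierDeriv
  have e2 : (γ * Real.log x - C / x) * (y - x)
    = γ * (Real.log x * (y - x)) - C * ((y - x) / x) := by ring
  rw [e2]
  nlinarith [mul_le_mul_of_nonneg_left h1 hγ.le, mul_lt_mul_of_pos_left h2 hC]

end Scalar

/-! ### Restricted minimizers, their multipliers and their response to a single loss -/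

section KKT

variable {ι : Type*}

/-- Lagrange multiplier of the regularized linear minimization problem over probability vectors
supported on `S`. -/
def kktMultiplier (S : Finset ι) (C : ℝ) (γ L : ι → ℝ) : ℝ :=
  Classical.epsilon fun lam => ∑ i ∈ S, barrierInv C (γ i) (lam - L i) = 1

/-- Minimizer of the regularized linear functional `L` over probability vectors supported
on `S`. -/
def ftrlSolution [DecidableEq ι] (S : Finset ι) (C : ℝ) (γ L : ι → ℝ) (i : ι) : ℝ :=
  if i ∈ S then barrierInv C (γ i) (kktMultiplier S C γ L - L i) else 0

/-- The regularized linear functional on vectors supported on `S`. -/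
def restrictedObjective (S : Finset ι) (C : ℝ) (γ L x : ι → ℝ) : ℝ :=
  ∑ i ∈ S, (x i * L i + (-C * Real.log (x i) + γ i * shiftedEntropy (x i)))

/-- The minimal value of the regularized linear functional. -/
def restrictedMin [DecidableEq ι] (S : Finset ι) (C : ℝ) (γ L : ι → ℝ) : ℝ :=
  restrictedObjective S C γ L (ftrlSolution S C γ L)

variable {S S' : Finset ι} {C : ℝ} {γ L : ι → ℝ}

/-- Intermediate value theorem: the two test multipliers force every entry to be at most,
respectively at least, `1 / #S`. -/
lemma exists_kktMultiplier (hS : S.Nonempty) (hC : 0 < C) (hγ : ∀ i, 0 < γ i) :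
    ∃ lam, ∑ i ∈ S, barrierInv C (γ i) (lam - L i) = 1 := by
  set c : ℝ := (#S : ℝ)⁻¹ with hc
  have hcard : (0 : ℝ) < #S := by exact_mod_cast hS.card_pos
  have hc0 : 0 < c := inv_pos.2 hcard
  have hsum : ∑ _i ∈ S, c = 1 := by
    rw [sum_const, nsmul_eq_mul, hc, mul_inv_cancel₀ hcard.ne']
  set f : ι → ℝ := fun i => L i + barrierDeriv C (γ i) c with hf
  have hcont : Continuous fun lam => ∑ i ∈ S, barrierInv C (γ i) (lam - L i) :=
    continuous_finsetSum _ fun i _ =>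
      (barrierInv_continuous hC (hγ i)).comp (continuous_id.sub continuous_const)
  have hlow : ∑ i ∈ S, barrierInv C (γ i) (S.inf' hS f - L i) ≤ 1 := by
    rw [← hsum]
    refine sum_le_sum fun i hi => ?_
    rw [barrierInv_le_iff hC (hγ i) hc0]
    have : S.inf' hS f ≤ f i := inf'_le f hi
    simp only [hf] at this
    linarith
  have hhigh : 1 ≤ ∑ i ∈ S, barrierInv C (γ i) (S.sup' hS f - L i) := by
    rw [← hsum]
    refine sum_le_sum fun i hi => ?_
    by_contra! hcon
    rw [barrierInv_lt_iff hC (hγ i) hc0] at hcon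
    have : f i ≤ S.sup' hS f := le_sup' f hi
    simp only [hf] at this
    linarith
  obtain ⟨lam, h⟩ := mem_range_of_exists_le_of_exists_ge hcont ⟨_, hlow⟩ ⟨_, hhigh⟩
  exact ⟨lam, h⟩

lemma sum_kktMultiplier (hS : S.Nonempty) (hC : 0 < C) (hγ : ∀ i, 0 < γ i) :
    ∑ i ∈ S, barrierInv C (γ i) (kktMultiplier S C γ L - L i) = 1 :=
  Classical.epsilon_spec (exists_kktMultiplier hS hC hγ)

lemma strictMono_sum_barrierInv (hS : S.Nonempty) (hC : 0 < C) (hγ : ∀ i, 0 < γ i) :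
    StrictMono fun lam => ∑ i ∈ S, barrierInv C (γ i) (lam - L i) := fun _ _ h =>
  sum_lt_sum_of_nonempty hS fun i _ => barrierInv_strictMono hC (hγ i) (by linarith)

lemma kktMultiplier_lt_iff (hS : S.Nonempty) (hC : 0 < C) (hγ : ∀ i, 0 < γ i) (c : ℝ) :
    kktMultiplier S C γ L < c ↔ 1 < ∑ i ∈ S, barrierInv C (γ i) (c - L i) := by
  rw [← (strictMono_sum_barrierInv (L := L) hS hC hγ).lt_iff_lt, sum_kktMultiplier hS hC hγ]

lemma kktMultiplier_le_iff (hS : S.Nonempty) (hC : 0 < C) (hγ : ∀ i, 0 < γ i) (c : ℝ) :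
    kktMultiplier S C γ L ≤ c ↔ 1 ≤ ∑ i ∈ S, barrierInv C (γ i) (c - L i) := by
  rw [← (strictMono_sum_barrierInv (L := L) hS hC hγ).le_iff_le, sum_kktMultiplier hS hC hγ]

lemma le_kktMultiplier_iff (hS : S.Nonempty) (hC : 0 < C) (hγ : ∀ i, 0 < γ i) (c : ℝ) :
    c ≤ kktMultiplier S C γ L ↔ ∑ i ∈ S, barrierInv C (γ i) (c - L i) ≤ 1 := by
  rw [← (strictMono_sum_barrierInv (L := L) hS hC hγ).le_iff_le, sum_kktMultiplier hS hC hγ]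

/-- At a given multiplier more arms carry more mass, so the multiplier must fall. Hence the
restricted minimizer dominates the full one on `S`. -/
lemma kktMultiplier_anti (hS : S.Nonempty) (hSS : S ⊆ S') (hC : 0 < C) (hγ : ∀ i, 0 < γ i) :
    kktMultiplier S' C γ L ≤ kktMultiplier S C γ L := by
  rw [le_kktMultiplier_iff hS hC hγ, ← sum_kktMultiplier (L := L) (hS.mono hSS) hC hγ]
  exact sum_le_sum_of_subset_of_nonneg hSS fun i _ _ => (barrierInv_pos hC (hγ i) _).le

lemma kktMultiplier_congr {γ' L' : ι → ℝ} (hγ : ∀ i ∈ S, γ i = γ' i) (hL : ∀ i ∈ S, L i = L' i) :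
    kktMultiplier S C γ L = kktMultiplier S C γ' L' := by
  unfold kktMultiplier
  congr 1
  funext lam
  rw [sum_congr rfl fun i hi => by rw [hγ i hi, hL i hi]]

variable [DecidableEq ι]

lemma ftrlSolution_of_mem {i : ι} (hi : i ∈ S) :
    ftrlSolution S C γ L i = barrierInv C (γ i) (kktMultiplier S C γ L - L i) := if_pos hi

lemma ftrlSolution_of_notMem {i : ι} (hi : i ∉ S) : ftrlSolution S C γ L i = 0 := if_neg hi

lemma sum_ftrlSolution (hS : S.Nonempty) (hC : 0 < C) (hγ : ∀ i, 0 < γ i) :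
    ∑ i ∈ S, ftrlSolution S C γ L i = 1 := by
  rw [← sum_kktMultiplier (L := L) hS hC hγ]
  exact sum_congr rfl fun i hi => ftrlSolution_of_mem hi

lemma ftrlSolution_pos (hC : 0 < C) (hγ : ∀ i, 0 < γ i) {i : ι} (hi : i ∈ S) :
    0 < ftrlSolution S C γ L i := by
  rw [ftrlSolution_of_mem hi]; exact barrierInv_pos hC (hγ i) _

lemma ftrlSolution_nonneg (hC : 0 < C) (hγ : ∀ i, 0 < γ i) (i : ι) :
    0 ≤ ftrlSolution S C γ L i := by
  by_cases hi : i ∈ S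
  · exact (ftrlSolution_pos hC hγ hi).le
  · exact (ftrlSolution_of_notMem hi).ge

lemma ftrlSolution_le_one (hC : 0 < C) (hγ : ∀ i, 0 < γ i) (i : ι) :
    ftrlSolution S C γ L i ≤ 1 := by
  by_cases hi : i ∈ S
  · rw [← sum_ftrlSolution (L := L) ⟨i, hi⟩ hC hγ]
    exact single_le_sum (f := ftrlSolution S C γ L) (fun j _ => ftrlSolution_nonneg hC hγ j) hi
  · rw [ftrlSolution_of_notMem hi]; exact zero_le_one

lemma barrierDeriv_ftrlSolution (hC : 0 < C) (hγ : ∀ i, 0 < γ i) {i : ι} (hi : i ∈ S) :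
    barrierDeriv C (γ i) (ftrlSolution S C γ L i) = kktMultiplier S C γ L - L i := by
  rw [ftrlSolution_of_mem hi, barrierDeriv_barrierInv hC (hγ i)]

lemma ftrlSolution_anti (hSS : S ⊆ S') (hC : 0 < C) (hγ : ∀ i, 0 < γ i) {i : ι} (hi : i ∈ S) :
    ftrlSolution S' C γ L i ≤ ftrlSolution S C γ L i := by
  rw [ftrlSolution_of_mem hi, ftrlSolution_of_mem (hSS hi)]
  apply (barrierInv_strictMono hC (hγ i)).monotone
  linarith [kktMultiplier_anti (L := L) ⟨i, hi⟩ hSS hC hγ]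

/-- First-order optimality: the gradient is the constant multiplier on `S`, and differences of
probability vectors are orthogonal to constants. -/
lemma sum_multiplier_mul_sub (hS : S.Nonempty) (hC : 0 < C) (hγ : ∀ i, 0 < γ i) {x : ι → ℝ}
    (hx1 : ∑ i ∈ S, x i = 1) :
    ∑ i ∈ S, ((x i - ftrlSolution S C γ L i) * L i
      + barrierDeriv C (γ i) (ftrlSolution S C γ L i) * (x i - ftrlSolution S C γ L i)) = 0 := by
  have : ∑ i ∈ S, ((x i - ftrlSolution S C γ L i) * L i
      + barrierDeriv C (γ i) (ftrlSolution S C γ L i) * (x i - ftrlSolution S C γ L i))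
      = ∑ i ∈ S, kktMultiplier S C γ L * (x i - ftrlSolution S C γ L i) := by
    refine sum_congr rfl fun i hi => ?_
    rw [barrierDeriv_ftrlSolution hC hγ hi]; ring
  rw [this, ← mul_sum, sum_sub_distrib, hx1, sum_ftrlSolution hS hC hγ, sub_self, mul_zero]

lemma restrictedMin_le (hS : S.Nonempty) (hC : 0 < C) (hγ : ∀ i, 0 < γ i) {x : ι → ℝ}
    (hx : ∀ i ∈ S, 0 < x i) (hx1 : ∑ i ∈ S, x i = 1) :
    restrictedMin S C γ L ≤ restrictedObjective S C γ L x := by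
  have h := sum_multiplier_mul_sub (L := L) hS hC hγ hx1
  rw [← sub_nonneg, ← h]
  unfold restrictedMin restrictedObjective
  rw [← sum_sub_distrib]
  refine sum_le_sum fun i hi => ?_
  have := barrierDeriv_mul_sub_le hC (hγ i) (ftrlSolution_pos (L := L) hC hγ hi) (hx i hi)
  linarith

lemma eq_ftrlSolution (hS : S.Nonempty) (hC : 0 < C) (hγ : ∀ i, 0 < γ i) {x : ι → ℝ}
    (hx : ∀ i ∈ S, 0 < x i) (hx1 : ∑ i ∈ S, x i = 1)
    (hmin : restrictedObjective S C γ L x ≤ restrictedMin S C γ L) {i : ι} (hi : i ∈ S) :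
    x i = ftrlSolution S C γ L i := by
  by_contra hne
  have h := sum_multiplier_mul_sub (L := L) hS hC hγ hx1
  have hlt : restrictedMin S C γ L < restrictedObjective S C γ L x := by
    rw [← sub_pos, ← h]
    unfold restrictedMin restrictedObjective
    rw [← sum_sub_distrib]
    refine sum_lt_sum (fun j hj => ?_) ⟨i, hi, ?_⟩
    · have := barrierDeriv_mul_sub_le hC (hγ j) (ftrlSolution_pos (L := L) hC hγ hj) (hx j hj)
      linarith
    · have := barrierDeriv_mul_sub_lt hC (hγ i) (ftrlSolution_pos (L := L) hC hγ hi) (hx i hi) hne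
      linarith
  linarith

/-- Adding the loss `σ` to one arm raises the multiplier by at most `σ`. -/
lemma kktMultiplier_add_single {a : ι} (ha : a ∈ S) (hC : 0 < C) (hγ : ∀ i, 0 < γ i) {σ : ℝ}
    (hσ : 0 ≤ σ) :
    kktMultiplier S C γ L ≤ kktMultiplier S C γ (L + Pi.single a σ) ∧
      kktMultiplier S C γ (L + Pi.single a σ) ≤ kktMultiplier S C γ L + σ := by
  have hS : S.Nonempty := ⟨a, ha⟩
  have h0 : ∀ i, 0 ≤ (Pi.single a σ : ι → ℝ) i := fun i => by
    by_cases h : i = a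
    · subst h; simpa using hσ
    · simp [h]
  have h1 : ∀ i, (Pi.single a σ : ι → ℝ) i ≤ σ := fun i => by
    by_cases h : i = a
    · subst h; simp
    · simpa [h] using hσ
  constructor
  · rw [le_kktMultiplier_iff hS hC hγ, ← sum_kktMultiplier (L := L) hS hC hγ]
    refine sum_le_sum fun i _ => (barrierInv_strictMono hC (hγ i)).monotone ?_
    simp only [Pi.add_apply]; linarith [h0 i]
  · rw [kktMultiplier_le_iff hS hC hγ, ← sum_kktMultiplier (L := L) hS hC hγ]
    refine sum_le_sum fun i _ => (barrierInv_strictMono hC (hγ i)).monotone ?_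
    simp only [Pi.add_apply]; linarith [h1 i]

lemma ftrlSolution_le_add_single {a j : ι} (ha : a ∈ S) (hC : 0 < C) (hγ : ∀ i, 0 < γ i) {σ : ℝ}
    (hσ : 0 ≤ σ) (hj : j ≠ a) :
    ftrlSolution S C γ L j ≤ ftrlSolution S C γ (L + Pi.single a σ) j := by
  by_cases hjS : j ∈ S
  · rw [ftrlSolution_of_mem hjS, ftrlSolution_of_mem hjS]
    apply (barrierInv_strictMono hC (hγ j)).monotone
    simp [hj, (kktMultiplier_add_single (L := L) ha hC hγ hσ).1]
  · rw [ftrlSolution_of_notMem hjS, ftrlSolution_of_notMem hjS]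

lemma ftrlSolution_sub_add_single_nonneg {a : ι} (ha : a ∈ S) (hC : 0 < C) (hγ : ∀ i, 0 < γ i)
    {σ : ℝ} (hσ : 0 ≤ σ) :
    0 ≤ ftrlSolution S C γ L a - ftrlSolution S C γ (L + Pi.single a σ) a := by
  rw [ftrlSolution_of_mem ha, ftrlSolution_of_mem ha, sub_nonneg]
  apply (barrierInv_strictMono hC (hγ a)).monotone
  simp only [Pi.add_apply, Pi.single_eq_same]
  linarith [(kktMultiplier_add_single (L := L) ha hC hγ hσ).2]

/-- The multiplier only rises, so the dual coordinate of `a` falls by at most `σ`; the tangent of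
the convex `barrierInv` bounds the resulting drop. -/
lemma ftrlSolution_sub_add_single_le {a : ι} (ha : a ∈ S) (hC : 0 < C) (hγ : ∀ i, 0 < γ i)
    {σ : ℝ} (hσ : 0 ≤ σ) :
    ftrlSolution S C γ L a - ftrlSolution S C γ (L + Pi.single a σ) a
      ≤ barrierWeight C (γ a) (ftrlSolution S C γ L a) * σ := by
  have hw := (barrierWeight_pos hC (hγ a) (ftrlSolution_pos (L := L) hC hγ ha)).le
  rw [ftrlSolution_of_mem ha] at hw
  rw [ftrlSolution_of_mem ha, ftrlSolution_of_mem ha]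
  have h := le_barrierInv_sub hC (hγ a) (kktMultiplier S C γ L - L a)
    (kktMultiplier S C γ (L + Pi.single a σ) - (L + Pi.single a σ : ι → ℝ) a)
  have h1 := (kktMultiplier_add_single (L := L) ha hC hγ hσ).1
  simp only [Pi.add_apply, Pi.single_eq_same] at h ⊢
  nlinarith [mul_nonneg hw (sub_nonneg.2 h1)]

lemma sum_add_single_sub {a : ι} (ha : a ∈ S) (hC : 0 < C) (hγ : ∀ i, 0 < γ i) (σ : ℝ) :
    ∑ j ∈ S.erase a, (ftrlSolution S C γ (L + Pi.single a σ) j - ftrlSolution S C γ L j)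
      = ftrlSolution S C γ L a - ftrlSolution S C γ (L + Pi.single a σ) a := by
  have hS : S.Nonempty := ⟨a, ha⟩
  have h1 := sum_ftrlSolution (L := L) hS hC hγ
  have h2 := sum_ftrlSolution (L := L + Pi.single a σ) hS hC hγ
  rw [← add_sum_erase _ _ ha] at h1 h2
  rw [sum_sub_distrib]
  linarith

lemma single_add_single_sub_le {a j : ι} (ha : a ∈ S) (hj : j ∈ S) (hja : j ≠ a) (hC : 0 < C)
    (hγ : ∀ i, 0 < γ i) {σ : ℝ} (hσ : 0 ≤ σ) :
    ftrlSolution S C γ (L + Pi.single a σ) j - ftrlSolution S C γ L j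
      ≤ ftrlSolution S C γ L a - ftrlSolution S C γ (L + Pi.single a σ) a := by
  have h : ∀ i ∈ S.erase a, 0 ≤ ftrlSolution S C γ (L + Pi.single a σ) i - ftrlSolution S C γ L i :=
    fun i hi => sub_nonneg.2 (ftrlSolution_le_add_single ha hC hγ hσ (ne_of_mem_erase hi))
  have h2 := single_le_sum h (mem_erase.2 ⟨hja, hj⟩)
  rwa [sum_add_single_sub ha hC hγ σ] at h2

/-- Multiplicative stability: charging an arm an importance-weighted loss at most doubles the
probabilities of the other arms. -/
lemma ftrlSolution_add_single_le_two_mul {a j : ι} (ha : a ∈ S) (hj : j ∈ S) (hja : j ≠ a)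
    (hC : 4 ≤ C) (hγ : ∀ i, 0 < γ i) {σ : ℝ} (hσ : 0 ≤ σ)
    (hσ' : σ ≤ 1 / ftrlSolution S C γ L a) :
    ftrlSolution S C γ (L + Pi.single a σ) j ≤ 2 * ftrlSolution S C γ L j := by
  have hC0 : 0 < C := by linarith
  have hpa := ftrlSolution_pos (L := L) hC0 hγ ha
  have hpj := ftrlSolution_pos (L := L) hC0 hγ hj
  -- If `a` is the less likely arm, everything it loses is at most its own probability, hence at
  -- most that of `j`.
  rcases le_or_gt (ftrlSolution S C γ L a) (ftrlSolution S C γ L j) with h | h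
  · have h1 := single_add_single_sub_le (L := L) ha hj hja hC0 hγ hσ
    have h2 := ftrlSolution_sub_add_single_le (L := L) ha hC0 hγ hσ
    have h3 := barrierWeight_le_sq_div hC0 (hγ a) hpa
    have h4 : barrierWeight C (γ a) (ftrlSolution S C γ L a) * σ
        ≤ ftrlSolution S C γ L a ^ 2 / C * (1 / ftrlSolution S C γ L a) := by gcongr
    have h5 : ftrlSolution S C γ L a ^ 2 / C * (1 / ftrlSolution S C γ L a)
        = ftrlSolution S C γ L a / C := by field_simp
    have h6 : ftrlSolution S C γ L a / C ≤ ftrlSolution S C γ L a :=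
      div_le_self hpa.le (by linarith)
    linarith
  -- Otherwise the multiplier rises by at most `1 / x`, with `x` the probability of `j`, whereas
  -- doubling `x` would raise the barrier part alone by `C / (2 x) ≥ 2 / x`.
  · by_contra! hcon
    set x := ftrlSolution S C γ L j with hx
    set y := ftrlSolution S C γ (L + Pi.single a σ) j with hy
    have k1 : barrierDeriv C (γ j) y - barrierDeriv C (γ j) x ≤ 1 / x := by
      rw [hx, hy, barrierDeriv_ftrlSolution hC0 hγ hj, barrierDeriv_ftrlSolution hC0 hγ hj]
      have := (kktMultiplier_add_single (L := L) ha hC0 hγ hσ).2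
      have h7 : 1 / ftrlSolution S C γ L a ≤ 1 / ftrlSolution S C γ L j := by gcongr
      simp only [Pi.add_apply, Pi.single_eq_of_ne hja]
      linarith
    have hlog : Real.log x ≤ Real.log y := Real.log_le_log hpj (by linarith)
    have h8 : C / y ≤ C / (2 * x) := by gcongr
    have h9 : C / x - C / (2 * x) = C / 2 * (1 / x) := by field_simp; ring
    have h10 : 0 < 1 / x := by positivity
    unfold barrierDeriv at k1
    nlinarith [mul_le_mul_of_nonneg_left hlog (hγ j).le]

lemma ftrlSolution_congr {γ' L' : ι → ℝ} (hγ : ∀ i ∈ S, γ i = γ' i) (hL : ∀ i ∈ S, L i = L' i) :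
    ftrlSolution S C γ L = ftrlSolution S C γ' L' := by
  funext i
  unfold ftrlSolution
  split_ifs with hi
  · rw [kktMultiplier_congr hγ hL, hγ i hi, hL i hi]
  · rfl

end KKT

/-! ### Reactions of the full and of the restricted minimizer -/

section Comparison

variable {ι : Type*} [DecidableEq ι] [Fintype ι] {S : Finset ι} {C : ℝ} {γ L : ι → ℝ}

/-- The change of the probability of an arm `a ∈ S`, compared with its change when only arms in
`S` are allowed, is controlled by the mass that moves out of `S`. -/
lemma ftrlSolution_change_sub_change_le {a : ι} (ha : a ∈ S) (hC : 0 < C) (hγ : ∀ i, 0 < γ i)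
    {σ : ℝ} (hσ : 0 ≤ σ) :
    (ftrlSolution univ C γ L a - ftrlSolution univ C γ (L + Pi.single a σ) a)
      - (ftrlSolution S C γ L a - ftrlSolution S C γ (L + Pi.single a σ) a)
      ≤ barrierWeight C (γ a) (ftrlSolution univ C γ L a)
        / (∑ j ∈ S, barrierWeight C (γ j) (ftrlSolution univ C γ L j))
        * ∑ j ∈ Sᶜ, (ftrlSolution univ C γ (L + Pi.single a σ) j - ftrlSolution univ C γ L j) := by
  have hau : a ∈ (univ : Finset ι) := mem_univ a
  set p := ftrlSolution univ C γ L with hp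
  set p' := ftrlSolution univ C γ (L + Pi.single a σ) with hp'
  set q := ftrlSolution S C γ L with hq
  set q' := ftrlSolution S C γ (L + Pi.single a σ) with hq'
  set b := ∑ j ∈ Sᶜ, (p' j - p j) with hb
  have hb0 : 0 ≤ b := sum_nonneg fun j hj => by
    have : j ≠ a := fun h => (mem_compl.1 hj) (h ▸ ha)
    exact sub_nonneg.2 (ftrlSolution_le_add_single hau hC hγ hσ this)
  have hwpos : ∀ j, 0 < barrierWeight C (γ j) (p j) := fun j =>
    barrierWeight_pos hC (hγ j) (ftrlSolution_pos hC hγ (mem_univ j))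
  have hW : 0 < ∑ j ∈ S, barrierWeight C (γ j) (p j) := sum_pos (fun j _ => hwpos j) ⟨a, ha⟩
  set lp := kktMultiplier univ C γ L with hlp
  set lp' := kktMultiplier univ C γ (L + Pi.single a σ) with hlp'
  set lq := kktMultiplier S C γ L with hlq
  set lq' := kktMultiplier S C γ (L + Pi.single a σ) with hlq'
  have hpe : ∀ j, p j = barrierInv C (γ j) (lp - L j) := fun j => ftrlSolution_of_mem (mem_univ j)
  have hpe' : ∀ j, j ≠ a → p' j = barrierInv C (γ j) (lp' - L j) := fun j hj => by
    rw [hp', ftrlSolution_of_mem (mem_univ j)]; simp [hj, hlp']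
  have hpa' : p' a = barrierInv C (γ a) (lp' - L a - σ) := by
    rw [hp', ftrlSolution_of_mem hau]; simp [hlp', sub_sub]
  have hqe : ∀ j ∈ S, q j = barrierInv C (γ j) (lq - L j) := fun j hj => ftrlSolution_of_mem hj
  have hqe' : ∀ j ∈ S, j ≠ a → q' j = barrierInv C (γ j) (lq' - L j) := fun j hj hja => by
    rw [hq', ftrlSolution_of_mem hj]; simp [hja, hlq']
  have hqa' : q' a = barrierInv C (γ a) (lq' - L a - σ) := by
    rw [hq', ftrlSolution_of_mem ha]; simp [hlq', sub_sub]
  have hν : lp ≤ lq := kktMultiplier_anti ⟨a, ha⟩ (subset_univ S) hC hγ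
  obtain ⟨hm0, hm1⟩ := kktMultiplier_add_single (L := L) hau hC hγ hσ
  obtain ⟨hn0, hn1⟩ := kktMultiplier_add_single (L := L) ha hC hγ hσ
  rw [← hlp, ← hlp'] at hm0 hm1
  rw [← hlq, ← hlq'] at hn0 hn1
  set m := lp' - lp with hm
  set n := lq' - lq with hn
  -- the decrease of the restricted problem dominates a shifted decrease of the full one
  have hdq : barrierInv C (γ a) (lp - L a) - barrierInv C (γ a) (lp - L a + n - σ) ≤ q a - q' a := by
    have h := barrierInv_increment_mono hC (hγ a) (z := lp - L a + n - σ)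
      (z' := lq - L a + n - σ) (d := σ - n) (by linarith) (by linarith)
    rw [hqe a ha, hqa']
    have e1 : lp - L a + n - σ + (σ - n) = lp - L a := by ring
    have e2 : lq - L a + n - σ + (σ - n) = lq - L a := by ring
    have e3 : lq - L a + n - σ = lq' - L a - σ := by rw [hn]; ring
    rw [e1, e2, e3] at h
    exact h
  have hpa2 : p' a = barrierInv C (γ a) (lp - L a + m - σ) := by
    rw [hpa', hm]; congr 1; ring
  -- If the full multiplier rises at least as much as the restricted one, convexity makes the drop
  -- of `p a` no larger than that of `q a`, and nothing is owed. Otherwise both bounds below are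
  -- linear in `n - m > 0`, with opposite signs.
  rcases le_or_gt n m with hnm | hnm
  · have h1 : barrierInv C (γ a) (lp - L a + n - σ) ≤ p' a := by
      rw [hpa2]
      exact (barrierInv_strictMono hC (hγ a)).monotone (by linarith)
    have h2 : 0 ≤ barrierWeight C (γ a) (p a) / (∑ j ∈ S, barrierWeight C (γ j) (p j)) * b := by
      have := (hwpos a).le
      positivity
    have := hpe a
    linarith
  · have h1 : (p a - p' a) - (q a - q' a) ≤ barrierWeight C (γ a) (p a) * (n - m) := by
      set u := barrierInv C (γ a) (lp - L a + n - σ) with hu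
      have hs := le_barrierInv_sub hC (hγ a) (lp - L a + n - σ) (lp - L a + m - σ)
      rw [← hu, ← hpa2] at hs
      have hup : u ≤ p a := by
        rw [hpe a, hu]
        exact (barrierInv_strictMono hC (hγ a)).monotone (by linarith)
      have hwu := barrierWeight_mono hC (hγ a) (barrierInv_pos hC (hγ a) _) hup
      have h3 := mul_le_mul_of_nonneg_right hwu (sub_nonneg.2 hnm.le)
      have := hpe a
      linarith
    -- Conservation of mass: what `a` loses is gained by the other arms, and on `S` the restricted
    -- gains exceed the full ones by at least the weight times `n - m`.
    have h2 : (p a - p' a) - (q a - q' a)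
        ≤ b - (∑ j ∈ S.erase a, barrierWeight C (γ j) (p j)) * (n - m) := by
      have e1 : p a - p' a = ∑ j ∈ S.erase a, (p' j - p j) + b := by
        rw [← sum_add_single_sub (L := L) hau hC hγ σ, hb, ← hp, ← hp']
        have hdis : Disjoint (S.erase a) Sᶜ :=
          (disjoint_compl_right).mono_left (erase_subset a S)
        rw [← sum_union hdis]
        congr 1
        ext j
        simp only [mem_erase, mem_univ, and_true, mem_union, mem_compl]
        constructor
        · intro h; by_cases hj : j ∈ S
          · exact Or.inl ⟨h, hj⟩
          · exact Or.inr hj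
        · rintro (h | h)
          · exact h.1
          · exact fun h' => h (h' ▸ ha)
      have e2 : q a - q' a = ∑ j ∈ S.erase a, (q' j - q j) :=
        (sum_add_single_sub (L := L) ha hC hγ σ).symm
      rw [e1, e2, sum_mul, add_sub_right_comm, ← sum_sub_distrib, add_comm, sub_eq_add_neg,
        ← sum_neg_distrib]
      refine add_le_add_right (sum_le_sum fun j hj => ?_) b
      have hja := ne_of_mem_erase hj
      have hjS := mem_of_mem_erase hj
      have i1 := barrierInv_increment_mono hC (hγ j) (z := lp - L j)
        (z' := lq - L j) (d := n) (by linarith) (by linarith)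
      have i2 := le_barrierInv_sub hC (hγ j) (lp - L j + m) (lp - L j + n)
      have ej : p' j = barrierInv C (γ j) (lp - L j + m) := by
        rw [hpe' j hja, hm]; congr 1; ring
      have ejq : q' j = barrierInv C (γ j) (lq - L j + n) := by
        rw [hqe' j hjS hja, hn]; congr 1; ring
      rw [← ej] at i2
      rw [← ejq, ← hpe j, ← hqe j hjS] at i1
      have hle : p j ≤ p' j := ftrlSolution_le_add_single hau hC hγ hσ hja
      have hwu := barrierWeight_mono hC (hγ j)
        (ftrlSolution_pos (L := L) hC hγ (mem_univ j)) hle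
      have h3 := mul_le_mul_of_nonneg_right hwu (sub_nonneg.2 hnm.le)
      linarith
    -- The combination of `h1` and `h2` weighted by the curvature of `S.erase a` and of `a`
    -- eliminates `n - m`.
    rw [div_mul_eq_mul_div, le_div_iff₀ hW, ← add_sum_erase _ _ ha]
    have hA : 0 ≤ ∑ j ∈ S.erase a, barrierWeight C (γ j) (p j) :=
      sum_nonneg fun j _ => (hwpos j).le
    nlinarith [mul_le_mul_of_nonneg_left h1 hA, mul_le_mul_of_nonneg_left h2 (hwpos a).le]

end Comparison

/-- Comparison of the total changes of two functions along a path, from one-sided bounds of their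
increments. -/
lemma sub_sub_sub_le_of_increments {Φ Ψ G H : ℝ → ℝ} {M : ℝ}
    (hΦ : ∀ s s', 0 ≤ s → s ≤ s' → s' ≤ 1 → (s' - s) * G s' ≤ Φ s' - Φ s)
    (hΨ : ∀ s s', 0 ≤ s → s ≤ s' → s' ≤ 1 → Ψ s' - Ψ s ≤ (s' - s) * H s)
    (hM : ∀ s, 0 ≤ s → s ≤ 1 → H s - G s ≤ M) :
    (Ψ 1 - Ψ 0) - (Φ 1 - Φ 0) ≤ M := by
  by_contra! hcon
  -- A mesh fine enough that the discretization error `(H 0 - H 1) / N` stays below the assumed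
  -- violation.
  obtain ⟨N, hN⟩ := exists_nat_gt (|H 0 - H 1| / ((Ψ 1 - Ψ 0) - (Φ 1 - Φ 0) - M))
  have hd : 0 < (Ψ 1 - Ψ 0) - (Φ 1 - Φ 0) - M := sub_pos.2 hcon
  have hN0 : (0 : ℝ) < N := lt_of_le_of_lt (by positivity) hN
  -- Each cell contributes `H s - G s' ≤ M + (H s - H s')`, and the errors `H s - H s'` telescope;
  -- neither continuity nor differentiability is needed.
  have key : ∀ k : ℕ, k ≤ N → (Ψ (k / N) - Ψ 0) - (Φ (k / N) - Φ 0)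
      ≤ k / N * M + 1 / N * (H 0 - H (k / N)) := by
    intro k
    induction k with
    | zero => intro _; simp
    | succ k ih =>
      intro hk
      have ih := ih (by omega)
      have e : ((k + 1 : ℕ) : ℝ) / N - (k : ℝ) / N = 1 / N := by push_cast; ring
      have h0 : (0 : ℝ) ≤ k / N := by positivity
      have h1 : (k : ℝ) / N ≤ ((k + 1 : ℕ) : ℝ) / N := by gcongr; omega
      have h2 : ((k + 1 : ℕ) : ℝ) / N ≤ 1 := by
        rw [div_le_one hN0]; exact_mod_cast hk
      have a1 := hΦ _ _ h0 h1 h2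
      have a2 := hΨ _ _ h0 h1 h2
      have a3 := mul_le_mul_of_nonneg_left (hM _ (h0.trans h1) h2)
        (show (0 : ℝ) ≤ 1 / N by positivity)
      rw [e] at a1 a2
      have e2 : ((k + 1 : ℕ) : ℝ) / N * M = (k : ℝ) / N * M + 1 / N * M := by
        push_cast; ring
      rw [e2]
      linarith
  have h := key N le_rfl
  rw [div_self hN0.ne', one_mul] at h
  rw [div_lt_iff₀ hd] at hN
  have h2 : 1 / (N : ℝ) * (H 0 - H 1) ≤ 1 / N * |H 0 - H 1| := by gcongr; exact le_abs_self _
  have h3 : 1 / (N : ℝ) * |H 0 - H 1| < (Ψ 1 - Ψ 0) - (Φ 1 - Φ 0) - M := by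
    rw [one_div_mul_eq_div, div_lt_iff₀ hN0]; linarith
  linarith

/-! ### Envelope inequalities and stability under changing rates -/

section Step

variable {ι : Type*} {S : Finset ι} {C : ℝ} {γ L : ι → ℝ}

lemma restrictedObjective_add_rate (δ : ι → ℝ) (x : ι → ℝ) :
    restrictedObjective S C (γ + δ) L x
      = restrictedObjective S C γ L x + ∑ i ∈ S, δ i * shiftedEntropy (x i) := by
  unfold restrictedObjective
  rw [← sum_add_distrib]
  refine sum_congr rfl fun i _ => ?_
  simp only [Pi.add_apply]
  ring

variable [DecidableEq ι]

lemma restrictedObjective_add_single {a : ι} (ha : a ∈ S) (u : ℝ) (x : ι → ℝ) :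
    restrictedObjective S C γ (L + Pi.single a u) x = restrictedObjective S C γ L x + u * x a := by
  unfold restrictedObjective
  rw [← add_sum_erase _ _ ha, ← add_sum_erase S (fun i => x i * L i + _) ha]
  have : ∀ i ∈ S.erase a, x i * (L + Pi.single a u : ι → ℝ) i +
      (-C * Real.log (x i) + γ i * shiftedEntropy (x i))
      = x i * L i + (-C * Real.log (x i) + γ i * shiftedEntropy (x i)) := fun i hi => by
    simp [ne_of_mem_erase hi]
  rw [sum_congr rfl this]
  simp only [Pi.add_apply, Pi.single_eq_same]
  ring

/-- Envelope inequality: the minimizer for `v` competes in the problem for `u`. With `u` and `v`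
exchanged it bounds increments from both sides, replacing a derivative of the optimal value. -/
lemma restrictedMin_add_single_sub_le {a : ι} (ha : a ∈ S) (hC : 0 < C) (hγ : ∀ i, 0 < γ i)
    (u v : ℝ) :
    restrictedMin S C γ (L + Pi.single a u) - restrictedMin S C γ (L + Pi.single a v)
      ≤ (u - v) * ftrlSolution S C γ (L + Pi.single a v) a := by
  have hS : S.Nonempty := ⟨a, ha⟩
  have h := restrictedMin_le (L := L + Pi.single a u) (x := ftrlSolution S C γ (L + Pi.single a v)) hS hC hγ
    (fun i hi => ftrlSolution_pos hC hγ hi) (sum_ftrlSolution hS hC hγ)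
  rw [restrictedObjective_add_single ha] at h
  have e : restrictedMin S C γ (L + Pi.single a v)
    = restrictedObjective S C γ L (ftrlSolution S C γ (L + Pi.single a v))
      + v * ftrlSolution S C γ (L + Pi.single a v) a := by
    rw [restrictedMin, restrictedObjective_add_single ha]
  have e2 : (u - v) * ftrlSolution S C γ (L + Pi.single a v) a
    = u * ftrlSolution S C γ (L + Pi.single a v) a
      - v * ftrlSolution S C γ (L + Pi.single a v) a := sub_mul _ _ _
  rw [e, e2]
  linarith only [h]

lemma restrictedMin_add_rate_sub_le (hS : S.Nonempty) (hC : 0 < C) {δ : ι → ℝ} {u v : ℝ}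
    (hu : ∀ i, 0 < (γ + u • δ) i) (hv : ∀ i, 0 < (γ + v • δ) i) :
    restrictedMin S C (γ + u • δ) L - restrictedMin S C (γ + v • δ) L
      ≤ (u - v) * ∑ i ∈ S, δ i * shiftedEntropy (ftrlSolution S C (γ + v • δ) L i) := by
  have h := restrictedMin_le (L := L) (x := ftrlSolution S C (γ + v • δ) L) hS hC hu
    (fun i hi => ftrlSolution_pos hC hv hi) (sum_ftrlSolution hS hC hv)
  have e : restrictedMin S C (γ + v • δ) L = restrictedObjective S C γ L _ + _ :=
    restrictedObjective_add_rate (v • δ) (ftrlSolution S C (γ + v • δ) L)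
  rw [restrictedObjective_add_rate] at h
  simp only [Pi.smul_apply, smul_eq_mul, mul_assoc, ← mul_sum] at h e
  rw [e]
  linarith

/-- The logarithm is nonpositive on probabilities, so larger rates lower `barrierDeriv` there; at
the old multiplier the total mass is then at least `1`. -/
lemma kktMultiplier_add_rate_le (hS : S.Nonempty) (hC : 0 < C) (hγ : ∀ i, 0 < γ i) {δ : ι → ℝ}
    (hδ : ∀ i, 0 ≤ δ i) : kktMultiplier S C (γ + δ) L ≤ kktMultiplier S C γ L := by
  have hγδ : ∀ i, 0 < (γ + δ) i := fun i => add_pos_of_pos_of_nonneg (hγ i) (hδ i)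
  rw [kktMultiplier_le_iff hS hC hγδ, ← sum_ftrlSolution (L := L) hS hC hγ]
  refine sum_le_sum fun i hi => ?_
  have hp := ftrlSolution_pos (L := L) hC hγ hi
  by_contra! hcon
  rw [barrierInv_lt_iff hC (hγδ i) hp, ← barrierDeriv_ftrlSolution hC hγ hi] at hcon
  have := Real.log_nonpos hp.le (ftrlSolution_le_one (L := L) hC hγ i)
  unfold barrierDeriv at hcon
  simp only [Pi.add_apply] at hcon
  nlinarith [hδ i]

/-- Multiplicative stability with respect to an increase of the learning rates. -/
lemma ftrlSolution_add_rate_le_four_mul (hC : 16 < C) (hγ : ∀ i, 0 < γ i) {δ : ι → ℝ}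
    (hδ : ∀ i, 0 ≤ δ i) {i : ι} (hi : i ∈ S) {r : ℝ} (hr : 0 < r)
    (hbase : ftrlSolution S C γ L i ≤ 2 * r) (hδr : δ i * √r ≤ 2) :
    ftrlSolution S C (γ + δ) L i ≤ 4 * r := by
  have hC0 : 0 < C := by linarith
  have hγδ : ∀ i, 0 < (γ + δ) i := fun i => add_pos_of_pos_of_nonneg (hγ i) (hδ i)
  by_contra! hcon
  have hmul := kktMultiplier_add_rate_le (L := L) ⟨i, hi⟩ hC0 hγ hδ
  have e1 := barrierDeriv_ftrlSolution (L := L) hC0 hγ hi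
  have e2 := barrierDeriv_ftrlSolution (L := L) hC0 hγδ hi
  have hx := ftrlSolution_pos (L := L) hC0 hγ hi
  have hx' := ftrlSolution_le_one (S := S) (L := L) hC0 hγδ i
  set x := ftrlSolution S C γ L i
  set x' := ftrlSolution S C (γ + δ) L i
  have hlog : Real.log x ≤ Real.log x' := Real.log_le_log hx (by linarith)
  have hlogr : Real.log r ≤ Real.log x' := Real.log_le_log hr (by linarith)
  unfold barrierDeriv at e1 e2
  simp only [Pi.add_apply] at e2
  -- The multiplier does not rise and the old-rate entropy term does not fall, so only the new part
  -- of the rate can pay for the change of the barrier.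
  have h1 : C / x - C / x' ≤ δ i * (-Real.log r) := by
    nlinarith [mul_le_mul_of_nonneg_left hlog (hγ i).le, mul_le_mul_of_nonneg_left hlogr (hδ i)]
  have h2 : C / (2 * r) ≤ C / x := by gcongr
  have h3 : C / x' ≤ C / (4 * r) := by gcongr
  have h4 : C / (2 * r) - C / (4 * r) = C / (4 * r) := by field_simp; ring
  have hs : 0 < √r := Real.sqrt_pos.2 hr
  -- The rate can pay at most `(2 / √r)² = 16 / (4 r)`, while passing from `2 r` to `4 r` costs `C /
  -- (4 r)`; hence the threshold `16 < C`.
  have h5 : -Real.log r ≤ 2 / √r := by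
    have h := Real.log_le_sub_one_of_pos (inv_pos.2 hs)
    rw [Real.log_inv, Real.log_sqrt hr.le] at h
    have : 2 / √r = 2 * (√r)⁻¹ := by ring
    rw [this]; linarith
  have h6 : δ i * (-Real.log r) ≤ 2 / √r * (2 / √r) := by
    have : δ i ≤ 2 / √r := by rwa [le_div_iff₀ hs]
    calc δ i * (-Real.log r) ≤ δ i * (2 / √r) := mul_le_mul_of_nonneg_left h5 (hδ i)
      _ ≤ _ := by gcongr
  have h7 : 2 / √r * (2 / √r) = 16 / (4 * r) := by
    rw [div_mul_div_comm, Real.mul_self_sqrt hr.le]; field_simp; norm_num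
  have h8 : 16 / (4 * r) < C / (4 * r) := by gcongr
  linarith

end Step

/-! ### The regret inequality of a single round -/

section Round

variable {ι : Type*} [DecidableEq ι] [Fintype ι] {S : Finset ι} {C : ℝ} {γ L : ι → ℝ}

/-- Bound for the stability of follow-the-regularized-leader over all arms, relative to its
stability over the arms in `S`, when arm `a` is drawn and `p` is played. -/
def stabilityTerm (S : Finset ι) (C : ℝ) (γ p : ι → ℝ) (a : ι) : ℝ :=
  if a ∈ S then
    barrierWeight C (γ a) (p a) / (∑ j ∈ S, barrierWeight C (γ j) (p j))
      * (if p a ≤ ∑ j ∈ Sᶜ, p j then barrierWeight C (γ a) (p a)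
        else 4 * ∑ j ∈ Sᶜ, barrierWeight C (γ j) (p j)) / p a ^ 2
  else barrierWeight C (γ a) (p a) / p a ^ 2

/-- The gap between the optimal values over all arms and over the arms in `S`. -/
def valueGap (S : Finset ι) (C : ℝ) (γ L : ι → ℝ) : ℝ :=
  restrictedMin univ C γ L - restrictedMin S C γ L

/-- The value gap moves at speed `y (p_a - q_a)` while the loss is phased in. Its deviation from the
initial speed is the excess reaction of `p_a`, bounded by share times escaping mass. -/
lemma loss_mul_sub_le_of_mem {a : ι} (ha : a ∈ S) (hC : 4 ≤ C) (hγ : ∀ i, 0 < γ i) {y : ℝ}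
    (hy : 0 ≤ y) (hy' : y ≤ 1 / ftrlSolution univ C γ L a) :
    y * (ftrlSolution univ C γ L a - ftrlSolution S C γ L a)
      ≤ valueGap S C γ (L + Pi.single a y) - valueGap S C γ L
        + stabilityTerm S C γ (ftrlSolution univ C γ L) a := by
  have hC0 : 0 < C := by linarith
  have hau : a ∈ (univ : Finset ι) := mem_univ a
  set p := ftrlSolution univ C γ L with hp
  set q := ftrlSolution S C γ L with hq
  have hpa : 0 < p a := ftrlSolution_pos hC0 hγ hau
  have hwpos : ∀ j, 0 < barrierWeight C (γ j) (p j) := fun j =>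
    barrierWeight_pos hC0 (hγ j) (ftrlSolution_pos hC0 hγ (mem_univ j))
  have hW : 0 < ∑ j ∈ S, barrierWeight C (γ j) (p j) := sum_pos (fun j _ => hwpos j) ⟨a, ha⟩
  set B : ℝ := if p a ≤ ∑ j ∈ Sᶜ, p j then barrierWeight C (γ a) (p a)
        else 4 * ∑ j ∈ Sᶜ, barrierWeight C (γ j) (p j) with hB
  have hB0 : 0 ≤ B := by
    rw [hB]; split_ifs
    · exact (hwpos a).le
    · exact mul_nonneg (by norm_num) (sum_nonneg fun j _ => (hwpos j).le)
  -- mass leaving `S`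
  have hmass : ∀ σ, 0 ≤ σ → σ ≤ y →
      ∑ j ∈ Sᶜ, (ftrlSolution univ C γ (L + Pi.single a σ) j - p j) ≤ B / p a := by
    intro σ hσ hσy
    have hσp : σ ≤ 1 / p a := hσy.trans hy'
    have hja : ∀ j ∈ Sᶜ, j ≠ a := fun j hj h => (mem_compl.1 hj) (h ▸ ha)
    rw [hB]
    split_ifs
    -- If `a` is no likelier than `Sᶜ`, all the mass that it releases is counted as escaping.
    · have h1 : ∑ j ∈ Sᶜ, (ftrlSolution univ C γ (L + Pi.single a σ) j - p j)
          ≤ p a - ftrlSolution univ C γ (L + Pi.single a σ) a := by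
        rw [hp, ← sum_add_single_sub hau hC0 hγ σ]
        refine sum_le_sum_of_subset_of_nonneg
          (fun j hj => mem_erase.2 ⟨hja j hj, mem_univ j⟩) fun j hj _ => ?_
        exact sub_nonneg.2 (ftrlSolution_le_add_single hau hC0 hγ hσ (ne_of_mem_erase hj))
      have h2 := ftrlSolution_sub_add_single_le (L := L) hau hC0 hγ hσ
      rw [← hp] at h2
      have h3 := mul_le_mul_of_nonneg_left hσp (hwpos a).le
      rw [mul_one_div] at h3
      linarith
    -- Otherwise each outside arm gains at most its weight times the rise of the multiplier, which
    -- is at most `1 / p a`. The weight is taken after the move, where the probability has at most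
    -- doubled; this gives the factor `4`.
    · rw [mul_sum, sum_div]
      refine sum_le_sum fun j hj => ?_
      have hju := mem_univ j
      have h1 := le_barrierInv_sub hC0 (hγ j)
        (kktMultiplier univ C γ (L + Pi.single a σ) - (L + Pi.single a σ : ι → ℝ) j)
        (kktMultiplier univ C γ L - L j)
      rw [← ftrlSolution_of_mem hju, ← ftrlSolution_of_mem hju, ← hp] at h1
      simp only [Pi.add_apply, Pi.single_eq_of_ne (hja j hj), add_zero] at h1
      have hle : p j ≤ ftrlSolution univ C γ (L + Pi.single a σ) j :=
        ftrlSolution_le_add_single hau hC0 hγ hσ (hja j hj)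
      have h2 := ftrlSolution_add_single_le_two_mul (L := L) hau hju (hja j hj) hC hγ hσ hσp
      rw [← hp] at h2
      have hpj : 0 < p j := ftrlSolution_pos hC0 hγ hju
      have h3 := (barrierWeight_mono hC0 (hγ j) (hpj.trans_le hle) h2).trans
        (barrierWeight_two_mul_le hC0 (hγ j) hpj)
      have hm := (kktMultiplier_add_single (L := L) hau hC0 hγ hσ).2
      have hm0 := (kktMultiplier_add_single (L := L) hau hC0 hγ hσ).1
      have hw0 := (barrierWeight_pos hC0 (hγ j) (hpj.trans_le hle)).le
      set w' := barrierWeight C (γ j) (ftrlSolution univ C γ (L + Pi.single a σ) j)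
      set μ := kktMultiplier univ C γ (L + Pi.single a σ) - kktMultiplier univ C γ L with hμ
      have h4 : ftrlSolution univ C γ (L + Pi.single a σ) j - p j ≤ w' * μ := by
        rw [hμ]; linarith
      have h5 : w' * μ ≤ 4 * barrierWeight C (γ j) (p j) * (1 / p a) := by
        apply mul_le_mul h3 (by linarith) (by linarith)
        have := hwpos j
        positivity
      rw [mul_one_div] at h5
      linarith
  have key := sub_sub_sub_le_of_increments
    (Φ := fun s => restrictedMin univ C γ (L + Pi.single a (s * y)))
    (Ψ := fun s => restrictedMin S C γ (L + Pi.single a (s * y)))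
    (G := fun s => y * ftrlSolution univ C γ (L + Pi.single a (s * y)) a)
    (H := fun s => y * ftrlSolution S C γ (L + Pi.single a (s * y)) a)
    (M := y * (q a - p a) + stabilityTerm S C γ p a) ?_ ?_ ?_
  · simp only [one_mul, zero_mul, Pi.single_zero, add_zero] at key
    unfold valueGap
    linarith
  · intro s s' _ _ _
    have := restrictedMin_add_single_sub_le (L := L) hau hC0 hγ (s * y) (s' * y)
    linarith
  · intro s s' _ _ _
    have := restrictedMin_add_single_sub_le (L := L) ha hC0 hγ (s' * y) (s * y)
    linarith
  · intro s hs0 hs1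
    have hσ : 0 ≤ s * y := by positivity
    have hσy : s * y ≤ y := by nlinarith
    have h1 := ftrlSolution_change_sub_change_le (S := S) (L := L) ha hC0 hγ hσ
    rw [← hp, ← hq] at h1
    have h2 : barrierWeight C (γ a) (p a) / (∑ j ∈ S, barrierWeight C (γ j) (p j))
        * ∑ j ∈ Sᶜ, (ftrlSolution univ C γ (L + Pi.single a (s * y)) j - p j)
        ≤ barrierWeight C (γ a) (p a) / (∑ j ∈ S, barrierWeight C (γ j) (p j)) * (B / p a) :=
      mul_le_mul_of_nonneg_left (hmass _ hσ hσy) (div_nonneg (hwpos a).le hW.le)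
    have hst : stabilityTerm S C γ p a
        = 1 / p a * (barrierWeight C (γ a) (p a) / (∑ j ∈ S, barrierWeight C (γ j) (p j))
          * (B / p a)) := by
      unfold stabilityTerm
      rw [if_pos ha, ← hB]
      field_simp
    have hnn : 0 ≤ barrierWeight C (γ a) (p a) / (∑ j ∈ S, barrierWeight C (γ j) (p j))
          * (B / p a) :=
      mul_nonneg (div_nonneg (hwpos a).le hW.le) (div_nonneg hB0 hpa.le)
    have h3 := mul_le_mul_of_nonneg_left (h1.trans h2) hy
    have h4 := mul_le_mul_of_nonneg_right hy' hnn
    rw [hst]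
    linarith

/-- The restricted problem does not see the loss, so this is the usual one-arm stability estimate
with `q_a = 0`. -/
lemma loss_mul_sub_le_of_notMem {a : ι} (ha : a ∉ S) (hC : 0 < C) (hγ : ∀ i, 0 < γ i) {y : ℝ}
    (hy : 0 ≤ y) (hy' : y ≤ 1 / ftrlSolution univ C γ L a) :
    y * (ftrlSolution univ C γ L a - ftrlSolution S C γ L a)
      ≤ valueGap S C γ (L + Pi.single a y) - valueGap S C γ L
        + stabilityTerm S C γ (ftrlSolution univ C γ L) a := by
  have hau : a ∈ (univ : Finset ι) := mem_univ a
  have hLS : ∀ i ∈ S, (L + Pi.single a y : ι → ℝ) i = L i := fun i hi => by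
    have : i ≠ a := fun h => ha (h ▸ hi)
    simp [this]
  have hS : restrictedMin S C γ (L + Pi.single a y) = restrictedMin S C γ L := by
    unfold restrictedMin
    rw [ftrlSolution_congr (fun i _ => rfl) hLS]
    exact sum_congr rfl fun i hi => by rw [hLS i hi]
  have h1 := restrictedMin_add_single_sub_le (L := L) hau hC hγ 0 y
  have h2 := ftrlSolution_sub_add_single_le (L := L) hau hC hγ hy
  have hpa := ftrlSolution_pos (L := L) hC hγ hau
  have hw := (barrierWeight_pos hC (hγ a) hpa).le
  simp only [Pi.single_zero, add_zero] at h1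
  unfold valueGap stabilityTerm
  rw [if_neg ha, hS, ftrlSolution_of_notMem ha]
  have h3 := mul_le_mul_of_nonneg_left h2 hy
  have h4 : y * (barrierWeight C (γ a) (ftrlSolution univ C γ L a) * y)
      ≤ 1 / ftrlSolution univ C γ L a * (barrierWeight C (γ a) (ftrlSolution univ C γ L a)
        * (1 / ftrlSolution univ C γ L a)) := by gcongr
  have h5 : 1 / ftrlSolution univ C γ L a * (barrierWeight C (γ a) (ftrlSolution univ C γ L a)
        * (1 / ftrlSolution univ C γ L a))
      = barrierWeight C (γ a) (ftrlSolution univ C γ L a) / ftrlSolution univ C γ L a ^ 2 := by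
    field_simp
  linarith

/-- An increase of the learning rates is only paid for by the arms outside `S`. -/
lemma valueGap_sub_add_rate_le (hS : S.Nonempty) (hC : 0 < C) (hγ : ∀ i, 0 < γ i) {δ : ι → ℝ}
    (hδ : ∀ i, 0 ≤ δ i) {B : ι → ℝ}
    (hB : ∀ s : ℝ, 0 ≤ s → s ≤ 1 → ∀ i ∈ Sᶜ,
      -shiftedEntropy (ftrlSolution univ C (γ + s • δ) L i) ≤ B i) :
    valueGap S C γ L - valueGap S C (γ + δ) L ≤ ∑ i ∈ Sᶜ, δ i * B i := by
  have hpos : ∀ s : ℝ, 0 ≤ s → ∀ i, 0 < (γ + s • δ) i := fun s hs i =>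
    add_pos_of_pos_of_nonneg (hγ i) (mul_nonneg hs (hδ i))
  have hne : (univ : Finset ι).Nonempty := hS.mono (subset_univ S)
  have key := sub_sub_sub_le_of_increments
    (Φ := fun s => restrictedMin univ C (γ + s • δ) L)
    (Ψ := fun s => restrictedMin S C (γ + s • δ) L)
    (G := fun s => ∑ i, δ i * shiftedEntropy (ftrlSolution univ C (γ + s • δ) L i))
    (H := fun s => ∑ i ∈ S, δ i * shiftedEntropy (ftrlSolution S C (γ + s • δ) L i))
    (M := ∑ i ∈ Sᶜ, δ i * B i) ?_ ?_ ?_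
  · simp only [one_smul, zero_smul, add_zero] at key
    unfold valueGap
    linarith
  · intro s s' h0 h1 _
    have := restrictedMin_add_rate_sub_le (L := L) hne hC (hpos s h0) (hpos s' (h0.trans h1))
    linarith
  · intro s s' h0 h1 _
    exact restrictedMin_add_rate_sub_le (L := L) hS hC (hpos s' (h0.trans h1)) (hpos s h0)
  · intro s h0 h1
    rw [← sum_add_sum_compl S fun i => δ i * shiftedEntropy (ftrlSolution univ C (γ + s • δ) L i)]
    -- On `S` the restricted probabilities are the larger ones, so their entropy terms are the
    -- smaller ones.
    have e1 : ∑ i ∈ S, δ i * shiftedEntropy (ftrlSolution S C (γ + s • δ) L i)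
        ≤ ∑ i ∈ S, δ i * shiftedEntropy (ftrlSolution univ C (γ + s • δ) L i) := by
      refine sum_le_sum fun i hi => mul_le_mul_of_nonneg_left ?_ (hδ i)
      exact shiftedEntropy_anti (ftrlSolution_pos hC (hpos s h0) (mem_univ i))
        (ftrlSolution_anti (subset_univ S) hC (hpos s h0) hi)
        (ftrlSolution_le_one hC (hpos s h0) i)
    have e2 : -∑ i ∈ Sᶜ, δ i * shiftedEntropy (ftrlSolution univ C (γ + s • δ) L i)
        ≤ ∑ i ∈ Sᶜ, δ i * B i := by
      rw [← sum_neg_distrib]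
      refine sum_le_sum fun i hi => ?_
      rw [← mul_neg]
      exact mul_le_mul_of_nonneg_left (hB s h0 h1 i hi) (hδ i)
    linarith

/-- `-shiftedEntropy` increases up to `1`, so it can be evaluated at `4 r`; if `4 r > 1`, its
maximum `1` already suffices. -/
lemma neg_shiftedEntropy_le {x r : ℝ} (hx : 0 < x) (hr : 0 < r) (hr1 : r ≤ 1)
    (hxr : x ≤ 4 * r) : -shiftedEntropy x ≤ 4 * r * (1 - Real.log r) := by
  have hlr := Real.log_nonpos hr.le hr1
  rcases le_or_gt (4 * r) 1 with h | h
  · have h1 := shiftedEntropy_anti hx hxr h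
    rw [shiftedEntropy_eq (by positivity)] at h1
    have h2 : Real.log r ≤ Real.log (4 * r) := Real.log_le_log hr (by linarith)
    nlinarith [mul_le_mul_of_nonneg_left h2 (show 0 ≤ 4 * r by positivity)]
  · have := neg_one_le_shiftedEntropy hx
    nlinarith

/-- Per-round inequality: the importance-weighted regret of the distribution over all arms against
the distribution over the arms in `S`. -/
lemma loss_mul_sub_le (hS : S.Nonempty) (hC : 16 < C) (hγ : ∀ i, 0 < γ i) {δ : ι → ℝ}
    (hδ : ∀ i, 0 ≤ δ i) (a : ι) {y : ℝ} (hy : 0 ≤ y) (hy' : y ≤ 1 / ftrlSolution univ C γ L a)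
    (hδp : ∀ i, δ i * √(ftrlSolution univ C γ L i) ≤ 2) :
    y * (ftrlSolution univ C γ L a - ftrlSolution S C γ L a)
      ≤ valueGap S C (γ + δ) (L + Pi.single a y) - valueGap S C γ L
        + stabilityTerm S C γ (ftrlSolution univ C γ L) a
        + ∑ i ∈ Sᶜ, δ i * (4 * ftrlSolution univ C γ L i
          * (1 - Real.log (ftrlSolution univ C γ L i))) := by
  have hC0 : 0 < C := by linarith
  have hau : a ∈ (univ : Finset ι) := mem_univ a
  have h1 : y * (ftrlSolution univ C γ L a - ftrlSolution S C γ L a)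
      ≤ valueGap S C γ (L + Pi.single a y) - valueGap S C γ L
        + stabilityTerm S C γ (ftrlSolution univ C γ L) a := by
    by_cases ha : a ∈ S
    · exact loss_mul_sub_le_of_mem ha (by linarith) hγ hy hy'
    · exact loss_mul_sub_le_of_notMem ha hC0 hγ hy hy'
  have h2 := valueGap_sub_add_rate_le (L := L + Pi.single a y) hS hC0 hγ hδ
    (B := fun i => 4 * ftrlSolution univ C γ L i * (1 - Real.log (ftrlSolution univ C γ L i))) ?_
  · linarith
  · intro s hs0 hs1 i _
    have hiu := mem_univ i
    have hsδ : ∀ i, 0 ≤ (s • δ) i := fun i => mul_nonneg hs0 (hδ i)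
    have hγs : ∀ i, 0 < (γ + s • δ) i := fun i => add_pos_of_pos_of_nonneg (hγ i) (hsδ i)
    have hp := ftrlSolution_pos (L := L) hC0 hγ hiu
    refine neg_shiftedEntropy_le (ftrlSolution_pos hC0 hγs hiu) hp (ftrlSolution_le_one hC0 hγ i) ?_
    refine ftrlSolution_add_rate_le_four_mul hC hγ hsδ hiu hp ?_ ?_
    · by_cases hia : i = a
      · subst hia
        have := ftrlSolution_sub_add_single_nonneg (L := L) hau hC0 hγ hy
        linarith
      · exact ftrlSolution_add_single_le_two_mul hau hiu hia (by linarith) hγ hy hy'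
    · refine le_trans ?_ (hδp i)
      refine mul_le_mul_of_nonneg_right ?_ (Real.sqrt_nonneg _)
      simp only [Pi.smul_apply, smul_eq_mul]
      nlinarith [hδ i]

end Round

/-! ### The value gap at the beginning and at the end -/

section Boundary

variable {ι : Type*} [DecidableEq ι] [Fintype ι] {S : Finset ι} {C : ℝ} {γ L : ι → ℝ}

/-- Convexity, together with `shiftedEntropy u ≤ 0` and `shiftedEntropy q ≥ -1`. -/
lemma shiftedEntropy_mix_le {q u ε : ℝ} (hq : 0 < q) (hu : 0 < u) (hu1 : u ≤ 1)
    (hε : 0 < ε) (hε1 : ε < 1) :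
    shiftedEntropy ((1 - ε) * q + ε * u) ≤ shiftedEntropy q + ε := by
  have h1 : 0 < 1 - ε := by linarith
  have hx : 0 < (1 - ε) * q + ε * u := by positivity
  have a1 := mul_le_mul_of_nonneg_left (le_shiftedEntropy_sub hx hq) h1.le
  have a2 := mul_le_mul_of_nonneg_left (le_shiftedEntropy_sub hx hu) hε.le
  have a3 := neg_one_le_shiftedEntropy hq
  have a4 := shiftedEntropy_nonpos hu hu1
  have e : (1 - ε) * (Real.log ((1 - ε) * q + ε * u) * (q - ((1 - ε) * q + ε * u)))
    + ε * (Real.log ((1 - ε) * q + ε * u) * (u - ((1 - ε) * q + ε * u))) = 0 := by ring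
  nlinarith

/-- Mixing the restricted minimizer with the uniform distribution bounds the value gap. -/
lemma valueGap_le (hS : S.Nonempty) (hC : 0 < C) (hγ : ∀ i, 0 < γ i) (hL : ∀ i, 0 ≤ L i) {ε : ℝ}
    (hε : 0 < ε) (hε2 : ε ≤ 1 / 2) :
    valueGap S C γ L ≤ ∑ i, (ε / Fintype.card ι * L i + C * Real.log (Fintype.card ι / ε)
      + ε * γ i) := by
  obtain ⟨i₀, hi₀⟩ := hS
  have hS : S.Nonempty := ⟨i₀, hi₀⟩
  have hcard : 0 < Fintype.card ι := Fintype.card_pos_iff.2 ⟨i₀⟩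
  set k : ℝ := (Fintype.card ι : ℝ) with hk
  have hk1 : 1 ≤ k := by rw [hk]; exact_mod_cast hcard
  have hk0 : 0 < k := by linarith
  set q := ftrlSolution S C γ L with hq
  set x : ι → ℝ := fun i => (1 - ε) * q i + ε * (1 / k) with hx
  have hq0 : ∀ i, 0 ≤ q i := fun i => ftrlSolution_nonneg hC hγ i
  have hqsum : ∑ i, q i = 1 := by
    rw [← sum_ftrlSolution (L := L) hS hC hγ]
    refine (sum_subset (subset_univ S) fun i _ hi => ftrlSolution_of_notMem hi).symm
  have hx0 : ∀ i, 0 < x i := fun i => by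
    have h1 : 0 ≤ (1 - ε) * q i := mul_nonneg (by linarith) (hq0 i)
    have : 0 < ε * (1 / k) := by positivity
    simp only [hx]; linarith
  have hxsum : ∑ i, x i = 1 := by
    simp only [hx]
    rw [sum_add_distrib, ← mul_sum, hqsum, sum_const, card_univ, nsmul_eq_mul, ← hk]
    field_simp; ring
  have hmin := restrictedMin_le (L := L) (x := x) (hS.mono (subset_univ S)) hC hγ
    (fun i _ => hx0 i) hxsum
  refine (sub_le_sub_right hmin _).trans ?_
  unfold restrictedMin restrictedObjective
  rw [← sum_add_sum_compl S, ← sum_add_sum_compl S (fun i => ε / k * L i + _ + _),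
    add_sub_right_comm, ← sum_sub_distrib, ← hq]
  have hlogk : Real.log (k / ε) = Real.log k - Real.log ε := Real.log_div hk0.ne' hε.ne'
  have hle : ε * (1 / k) ≤ ε := by
    have : 1 / k ≤ 1 := by rw [div_le_one hk0]; exact hk1
    nlinarith
  refine add_le_add (sum_le_sum fun i hi => ?_) (sum_le_sum fun i hi => ?_)
  · have hqi : 0 < q i := ftrlSolution_pos hC hγ hi
    have h1 : shiftedEntropy (x i) ≤ shiftedEntropy (q i) + ε :=
      shiftedEntropy_mix_le hqi (by positivity)
        (by rw [div_le_one hk0]; exact hk1) hε (by linarith)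
    have h2 : Real.log (q i) - Real.log (k / ε) ≤ Real.log (x i) := by
      rw [← Real.log_div hqi.ne' (by positivity)]
      apply Real.log_le_log (by positivity)
      have : q i / (k / ε) ≤ (1 - ε) * q i := by
        rw [div_div_eq_mul_div, div_le_iff₀ hk0]
        nlinarith [mul_nonneg (mul_nonneg (show 0 ≤ 1 - ε by linarith) hqi.le)
          (sub_nonneg.2 hk1)]
      have h3 : 0 < ε * (1 / k) := by positivity
      simp only [hx]; linarith
    have h3 : x i * L i - q i * L i ≤ ε / k * L i := by
      have : x i * L i - q i * L i = ε / k * L i - ε * (q i * L i) := by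
        simp only [hx]; ring
      have := mul_nonneg hε.le (mul_nonneg hqi.le (hL i))
      linarith
    nlinarith [mul_le_mul_of_nonneg_left h1 (hγ i).le, mul_le_mul_of_nonneg_left h2 hC.le]
  · have hqi : q i = 0 := ftrlSolution_of_notMem (mem_compl.1 hi)
    have hxi : x i = ε * (1 / k) := by simp [hx, hqi]
    have h1 := shiftedEntropy_nonpos (hx0 i) (by rw [hxi]; linarith)
    have h2 : Real.log (x i) = -Real.log (k / ε) := by
      rw [hxi, ← Real.log_inv]; congr 1; field_simp
    have h3 : x i * L i = ε / k * L i := by rw [hxi]; ring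
    rw [h2, h3]
    nlinarith [mul_nonneg hε.le (hγ i).le, mul_nonpos_of_nonneg_of_nonpos (hγ i).le h1]

/-- The uniform distribution on `S` bounds the restricted value from above; `shiftedEntropy ≥ -1`
and the sign of the barrier bound the full value from below. -/
lemma neg_valueGap_zero_le (hS : S.Nonempty) (hC : 0 < C) (hγ : ∀ i, 0 < γ i) :
    -valueGap S C γ 0 ≤ ∑ i, (C * Real.log (Fintype.card ι) + γ i) := by
  have hne : (univ : Finset ι).Nonempty := hS.mono (subset_univ S)
  have hcard : (0 : ℝ) < #S := by exact_mod_cast hS.card_pos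
  have hcard1 : (1 : ℝ) ≤ #S := by exact_mod_cast hS.card_pos
  have hcardle : (#S : ℝ) ≤ Fintype.card ι := by exact_mod_cast card_le_univ S
  have hlogK : 0 ≤ Real.log (Fintype.card ι) := Real.log_nonneg (hcard1.trans hcardle)
  have h1 := restrictedMin_le (L := 0) (x := fun _ => (1 / #S : ℝ)) hS hC hγ
    (fun i _ => by positivity) (by rw [sum_const, nsmul_eq_mul]; field_simp)
  have h2 : restrictedObjective S C γ 0 (fun _ => (1 / #S : ℝ))
      ≤ ∑ _i : ι, C * Real.log (Fintype.card ι) := by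
    unfold restrictedObjective
    calc _ ≤ ∑ i ∈ S, C * Real.log (Fintype.card ι) := by
          refine sum_le_sum fun i _ => ?_
          have a1 := shiftedEntropy_nonpos (x := (1 / #S : ℝ)) (by positivity)
            (by rw [div_le_one hcard]; exact hcard1)
          have a2 : Real.log (1 / #S : ℝ) = -Real.log #S := by rw [one_div, Real.log_inv]
          have a3 := Real.log_le_log hcard hcardle
          simp only [Pi.zero_apply, mul_zero, zero_add, a2]
          nlinarith [mul_nonpos_of_nonneg_of_nonpos (hγ i).le a1, mul_le_mul_of_nonneg_left a3 hC.le]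
      _ ≤ _ := sum_le_sum_of_subset_of_nonneg (subset_univ S) fun i _ _ => by positivity
  have h3 : -∑ i, γ i ≤ restrictedMin univ C γ 0 := by
    unfold restrictedMin restrictedObjective
    rw [← sum_neg_distrib]
    refine sum_le_sum fun i hi => ?_
    have hp := ftrlSolution_pos (L := 0) hC hγ hi
    have a1 := neg_one_le_shiftedEntropy hp
    have a2 := Real.log_nonpos hp.le (ftrlSolution_le_one hC hγ i)
    simp only [Pi.zero_apply, mul_zero, zero_add]
    nlinarith [mul_le_mul_of_nonneg_left a1 (hγ i).le, mul_nonpos_of_nonneg_of_nonpos hC.le a2]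
  unfold valueGap
  rw [sum_add_distrib]
  linarith

end Boundary

/-! ### Learning rates and telescoping along one trajectory -/

section Trajectory

variable {K T : ℕ} {C θ : ℝ} {p : ℕ → Fin K → ℝ} {a : ℕ → Fin K} {l : ℕ → Fin K → ℝ}

/-- Cumulative estimated losses before round `t`. -/
def cumulativeEstimate (p : ℕ → Fin K → ℝ) (a : ℕ → Fin K) (l : ℕ → Fin K → ℝ) (t : ℕ)
    (i : Fin K) : ℝ :=
  ∑ τ ∈ range t, lossEstimator (p τ) (a τ) (l τ) i

/-- Sum of the truncated inverse probabilities under the square root of the learning rate. -/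
def rateSum (T : ℕ) (p : ℕ → Fin K → ℝ) (t : ℕ) (i : Fin K) : ℝ :=
  1 + ∑ τ ∈ range t, (max (p τ i) (1 / (T : ℝ)))⁻¹

lemma learningRate_eq (t : ℕ) (i : Fin K) :
    learningRate θ 1 T p t i = θ * √(rateSum T p t i) := by
  have e : (1 : ℝ) - 2 * 1 = -1 := by norm_num
  simp only [learningRate, rateSum, e, Real.rpow_neg_one]

lemma truncated_pos (hT : 0 < T) (r : ℝ) : 0 < max r (1 / (T : ℝ)) :=
  lt_max_of_lt_right (by positivity)

lemma one_le_rateSum (hT : 0 < T) (t : ℕ) (i : Fin K) : 1 ≤ rateSum T p t i :=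
  le_add_of_nonneg_right (sum_nonneg fun _ _ => (inv_pos.2 (truncated_pos hT _)).le)

lemma rateSum_pos (hT : 0 < T) (t : ℕ) (i : Fin K) : 0 < rateSum T p t i :=
  zero_lt_one.trans_le (one_le_rateSum hT t i)

lemma rateSum_succ (t : ℕ) (i : Fin K) :
    rateSum T p (t + 1) i = rateSum T p t i + (max (p t i) (1 / (T : ℝ)))⁻¹ := by
  simp only [rateSum, sum_range_succ, add_assoc]

lemma rateSum_le (hT : 0 < T) (i : Fin K) : rateSum T p T i ≤ 1 + (T : ℝ) ^ 2 := by
  unfold rateSum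
  have : ∑ τ ∈ range T, (max (p τ i) (1 / (T : ℝ)))⁻¹ ≤ ∑ _τ ∈ range T, (T : ℝ) := by
    refine sum_le_sum fun τ _ => ?_
    have hT' : (0 : ℝ) < 1 / T := by positivity
    calc (max (p τ i) (1 / (T : ℝ)))⁻¹ ≤ (1 / (T : ℝ))⁻¹ := inv_anti₀ hT' (le_max_right _ _)
      _ = T := by simp
  rw [sum_const, card_range, nsmul_eq_mul] at this
  linarith [sq (T : ℝ)]

lemma learningRate_pos (hT : 0 < T) (hθ : 0 < θ) (t : ℕ) (i : Fin K) :
    0 < learningRate θ 1 T p t i := by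
  rw [learningRate_eq]
  have := rateSum_pos (p := p) hT t i
  positivity

lemma cumulativeEstimate_succ (t : ℕ) :
    cumulativeEstimate p a l (t + 1)
      = cumulativeEstimate p a l t + Pi.single (a t) (l t (a t) / p t (a t)) := by
  funext i
  simp only [cumulativeEstimate, sum_range_succ, Pi.add_apply, lossEstimator]
  congr 1
  by_cases h : a t = i
  · subst h; simp
  · rw [if_neg h, zero_div, Pi.single_eq_of_ne (Ne.symm h)]

lemma ftrlObjective_eq (t : ℕ) (x : Fin K → ℝ) :
    ftrlObjective C 1 θ T p a l t x
      = restrictedObjective univ C (learningRate θ 1 T p t) (cumulativeEstimate p a l t) x := by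
  simp only [ftrlObjective, shannonRegularizer, restrictedObjective, cumulativeEstimate,
    shiftedEntropy, sum_add_distrib, mul_sum]

lemma IsShannonFTRL.eq_ftrlSolution (h : IsShannonFTRL C 1 θ T p a l) (hK : 0 < K) (hT : 0 < T)
    (hC : 0 < C) (hθ : 0 < θ) {t : ℕ} (ht : t < T) :
    p t = ftrlSolution univ C (learningRate θ 1 T p t) (cumulativeEstimate p a l t) := by
  have : Nonempty (Fin K) := ⟨⟨0, hK⟩⟩
  have hγ := learningRate_pos (p := p) hT hθ t
  obtain ⟨⟨hpos, hsum⟩, hmin⟩ := h t ht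
  funext i
  refine _root_.eq_ftrlSolution univ_nonempty hC hγ (fun i _ => hpos i) hsum ?_ (mem_univ i)
  have := hmin (show ftrlSolution univ C (learningRate θ 1 T p t) (cumulativeEstimate p a l t)
    ∈ posSimplex K from ⟨fun i => ftrlSolution_pos hC hγ (mem_univ i),
      sum_ftrlSolution univ_nonempty hC hγ⟩)
  simp only [Set.mem_ofPred_eq, ftrlObjective_eq] at this
  exact this

/-- `√A' - √A ≤ (A' - A) / √A'`, with the new sum `A'` in the denominator so that the later sum
telescopes logarithmically. -/
lemma learningRate_succ_sub_le (hT : 0 < T) (hθ : 0 < θ) (t : ℕ) (i : Fin K) :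
    learningRate θ 1 T p (t + 1) i - learningRate θ 1 T p t i
      ≤ θ * ((max (p t i) (1 / (T : ℝ)))⁻¹ / √(rateSum T p (t + 1) i)) := by
  rw [learningRate_eq, learningRate_eq, ← mul_sub]
  refine mul_le_mul_of_nonneg_left ?_ hθ.le
  have h1 := rateSum_pos (p := p) hT t i
  have h2 := rateSum_pos (p := p) hT (t + 1) i
  have h3 := inv_pos.2 (truncated_pos hT (p t i))
  have h4 := rateSum_succ (T := T) (p := p) t i
  rw [le_div_iff₀ (Real.sqrt_pos.2 h2), sub_mul, Real.mul_self_sqrt h2.le]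
  have : rateSum T p t i ≤ √(rateSum T p t i) * √(rateSum T p (t + 1) i) := by
    rw [← Real.sqrt_mul h1.le]
    apply Real.le_sqrt_of_sq_le
    nlinarith
  linarith

lemma learningRate_succ_sub_nonneg (hT : 0 < T) (hθ : 0 < θ) (t : ℕ) (i : Fin K) :
    0 ≤ learningRate θ 1 T p (t + 1) i - learningRate θ 1 T p t i := by
  rw [learningRate_eq, learningRate_eq, ← mul_sub]
  have h3 := inv_pos.2 (truncated_pos hT (p t i))
  refine mul_nonneg hθ.le (sub_nonneg.2 (Real.sqrt_le_sqrt ?_))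
  rw [rateSum_succ]; linarith

/-- The new `rateSum` contains the summand `1 / max (p t i) (1 / T)`, so the increment is at most `θ
/ √(max (p t i) (1 / T))`. This is the smallness needed for stability under rate changes. -/
lemma learningRate_succ_sub_mul_sqrt_le (hT : 0 < T) (hθ : 0 < θ) (t : ℕ) (i : Fin K) :
    (learningRate θ 1 T p (t + 1) i - learningRate θ 1 T p t i) * √(p t i) ≤ θ := by
  have h1 := learningRate_succ_sub_le (p := p) hT hθ t i
  have hm := truncated_pos hT (p t i)
  set m := max (p t i) (1 / (T : ℝ)) with hmdef
  have h2 : √(p t i) ≤ √m := Real.sqrt_le_sqrt (le_max_left _ _)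
  have h3 : √(m⁻¹) ≤ √(rateSum T p (t + 1) i) := by
    apply Real.sqrt_le_sqrt
    rw [rateSum_succ]
    linarith [rateSum_pos (p := p) hT t i]
  have hs : 0 < √(m⁻¹) := Real.sqrt_pos.2 (inv_pos.2 hm)
  calc _ ≤ θ * (m⁻¹ / √(m⁻¹)) * √m := by
        refine mul_le_mul (h1.trans ?_) h2 (Real.sqrt_nonneg _) (by positivity)
        gcongr
    _ = θ := by
      rw [Real.div_sqrt, mul_assoc, ← Real.sqrt_mul (inv_pos.2 hm).le, inv_mul_cancel₀ hm.ne',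
        Real.sqrt_one, mul_one]

/-- The comparator of round `t`: the distribution that the algorithm would play if only the arms
in `S` were allowed. -/
def comparator (S : Finset (Fin K)) (C θ : ℝ) (T : ℕ) (p : ℕ → Fin K → ℝ) (a : ℕ → Fin K)
    (l : ℕ → Fin K → ℝ) (t : ℕ) : Fin K → ℝ :=
  ftrlSolution S C (learningRate θ 1 T p t) (cumulativeEstimate p a l t)

/-- Cost of the increase of the learning rates in round `t`. -/
def rateCost (S : Finset (Fin K)) (θ : ℝ) (T : ℕ) (p : ℕ → Fin K → ℝ) (t : ℕ) : ℝ :=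
  ∑ i ∈ Sᶜ, (learningRate θ 1 T p (t + 1) i - learningRate θ 1 T p t i)
    * (4 * p t i * (1 - Real.log (p t i)))

lemma sum_estimated_regret_le_valueGap {S : Finset (Fin K)} (hS : S.Nonempty)
    (h : IsShannonFTRL C 1 θ T p a l)
    (hK : 0 < K) (hT : 0 < T) (hC : 16 < C) (hθ : 0 < θ) (hθ2 : θ ≤ 2)
    (hl : ∀ t < T, ∀ i, l t i ∈ Set.Icc (0 : ℝ) 1) :
    ∑ t ∈ range T, l t (a t) / p t (a t) * (p t (a t) - comparator S C θ T p a l t (a t))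
      ≤ valueGap S C (learningRate θ 1 T p T) (cumulativeEstimate p a l T)
        - valueGap S C (learningRate θ 1 T p 0) 0
        + ∑ t ∈ range T, stabilityTerm S C (learningRate θ 1 T p t) (p t) (a t)
        + ∑ t ∈ range T, rateCost S θ T p t := by
  have h0 : cumulativeEstimate p a l 0 = 0 := by funext i; simp [cumulativeEstimate]
  rw [← h0, ← sum_range_sub (fun t => valueGap S C (learningRate θ 1 T p t)
    (cumulativeEstimate p a l t)) T, ← sum_add_distrib, ← sum_add_distrib]
  refine sum_le_sum fun t ht => ?_
  have ht := mem_range.1 ht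
  have hp := h.eq_ftrlSolution hK hT (by linarith) hθ ht
  have hpos := (h t ht).1.1 (a t)
  have hlt := hl t ht (a t)
  have key := loss_mul_sub_le (L := cumulativeEstimate p a l t) hS hC
    (learningRate_pos (p := p) hT hθ t)
    (δ := fun i => learningRate θ 1 T p (t + 1) i - learningRate θ 1 T p t i)
    (learningRate_succ_sub_nonneg hT hθ t) (a t) (y := l t (a t) / p t (a t))
    (div_nonneg hlt.1 hpos.le) (by rw [← hp]; gcongr; exact hlt.2)
    (fun i => by rw [← hp]; exact (learningRate_succ_sub_mul_sqrt_le hT hθ t i).trans hθ2)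
  have e : (learningRate θ 1 T p t + fun i => learningRate θ 1 T p (t + 1) i
      - learningRate θ 1 T p t i) = learningRate θ 1 T p (t + 1) := by
    funext i; simp
  rw [← hp, e, ← cumulativeEstimate_succ] at key
  exact key

lemma cumulativeEstimate_nonneg (h : IsShannonFTRL C 1 θ T p a l)
    (hl : ∀ t < T, ∀ i, l t i ∈ Set.Icc (0 : ℝ) 1) (i : Fin K) :
    0 ≤ cumulativeEstimate p a l T i := by
  refine sum_nonneg fun t ht => ?_
  have ht := mem_range.1 ht
  unfold lossEstimator
  refine div_nonneg ?_ ((h t ht).1.1 i).le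
  split_ifs
  exacts [(hl t ht i).1, le_rfl]

/-- Importance-weighted regret bound against the comparators. -/
lemma sum_estimated_regret_le {S : Finset (Fin K)} (hS : S.Nonempty)
    (h : IsShannonFTRL C 1 θ T p a l)
    (hK : 0 < K) (hT : 2 ≤ T) (hKT : K ≤ T) (hC : 16 < C) (hθ : 0 < θ) (hθ2 : θ ≤ 2)
    (hl : ∀ t < T, ∀ i, l t i ∈ Set.Icc (0 : ℝ) 1) :
    ∑ t ∈ range T, l t (a t) / p t (a t) * (p t (a t) - comparator S C θ T p a l t (a t))
      ≤ (T * K : ℝ)⁻¹ * ∑ i, cumulativeEstimate p a l T i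
        + 3 * K * (C * Real.log T + θ)
        + ∑ t ∈ range T, stabilityTerm S C (learningRate θ 1 T p t) (p t) (a t)
        + ∑ t ∈ range T, rateCost S θ T p t := by
  have hT0 : 0 < T := by omega
  have hC0 : 0 < C := by linarith
  have hTr : (2 : ℝ) ≤ T := by exact_mod_cast hT
  have hKr : (1 : ℝ) ≤ K := by exact_mod_cast hK
  have hKTr : (K : ℝ) ≤ T := by exact_mod_cast hKT
  have h1 := sum_estimated_regret_le_valueGap hS h hK hT0 hC hθ hθ2 hl
  -- With `ε = 1 / T` the linear term has expectation at most `1`, the barrier costs `log (K T) ≤ 2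
  -- log T` per arm, and the final rate, of order `θ T`, contributes `O(θ)`.
  have h2 := valueGap_le (L := cumulativeEstimate p a l T) hS hC0
    (learningRate_pos (p := p) hT0 hθ T) (cumulativeEstimate_nonneg h hl) (ε := 1 / T)
    (by positivity) (by gcongr)
  have h3 := neg_valueGap_zero_le (γ := learningRate θ 1 T p 0) hS hC0
    (learningRate_pos (p := p) hT0 hθ 0)
  have hlogK : Real.log K ≤ Real.log T := Real.log_le_log (by linarith) hKTr
  rw [Fintype.card_fin] at h2 h3
  have b2 : ∑ i, (1 / (T : ℝ) / K * cumulativeEstimate p a l T i + C * Real.log (K / (1 / T))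
      + 1 / T * learningRate θ 1 T p T i)
      ≤ ∑ i, ((T * K : ℝ)⁻¹ * cumulativeEstimate p a l T i + 2 * (C * Real.log T) + 2 * θ) := by
    refine sum_le_sum fun i _ => ?_
    have e1 : 1 / (T : ℝ) / K = (T * K : ℝ)⁻¹ := by field_simp
    have e2 : Real.log (K / (1 / T : ℝ)) ≤ 2 * Real.log T := by
      rw [div_div_eq_mul_div, div_one, Real.log_mul (by positivity) (by positivity)]
      linarith
    have e3 : 1 / (T : ℝ) * learningRate θ 1 T p T i ≤ 2 * θ := by
      rw [learningRate_eq, one_div_mul_eq_div, div_le_iff₀ (by positivity)]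
      have : √(rateSum T p T i) ≤ 2 * T := by
        apply Real.sqrt_le_iff.2 ⟨by positivity, (rateSum_le hT0 i).trans ?_⟩
        nlinarith
      nlinarith
    rw [e1]
    nlinarith [mul_le_mul_of_nonneg_left e2 hC0.le]
  have b3 : ∑ i : Fin K, (C * Real.log K + learningRate θ 1 T p 0 i)
      ≤ ∑ _i : Fin K, (C * Real.log T + θ) := by
    refine sum_le_sum fun i _ => ?_
    have : learningRate θ 1 T p 0 i = θ := by simp [learningRate]
    rw [this]
    nlinarith [mul_le_mul_of_nonneg_left hlogK hC0.le]
  simp only [sum_add_distrib, sum_const, card_univ, Fintype.card_fin, nsmul_eq_mul, ← mul_sum]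
    at b2 b3 h2 h3
  linarith

end Trajectory

/-! ### Stability averaged over the drawn arm -/

section ExpectedStability

variable {ι : Type*} [DecidableEq ι] [Fintype ι] {S : Finset ι} {C : ℝ} {γ p : ι → ℝ}

/-- Share of arm `i ∈ S` in the total curvature weight of `S`, if the arm is at most as likely as
all arms outside `S` together, and `0` otherwise. -/
def minorityShare (S : Finset ι) (C : ℝ) (γ p : ι → ℝ) (i : ι) : ℝ :=
  if p i ≤ ∑ j ∈ Sᶜ, p j then
    barrierWeight C (γ i) (p i) / ∑ j ∈ S, barrierWeight C (γ j) (p j)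
  else 0

lemma minorityShare_nonneg (hC : 0 < C) (hγ : ∀ i, 0 < γ i) (hp : ∀ i, 0 < p i) (i : ι) :
    0 ≤ minorityShare S C γ p i := by
  unfold minorityShare
  have : ∀ j, 0 ≤ barrierWeight C (γ j) (p j) := fun j => (barrierWeight_pos hC (hγ j) (hp j)).le
  split_ifs
  · exact div_nonneg (this i) (sum_nonneg fun j _ => this j)
  · exact le_rfl

lemma sum_minorityShare_le_one (hC : 0 < C) (hγ : ∀ i, 0 < γ i) (hp : ∀ i, 0 < p i) :
    ∑ i ∈ S, minorityShare S C γ p i ≤ 1 := by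
  have h0 : ∀ j, 0 ≤ barrierWeight C (γ j) (p j) := fun j =>
    (barrierWeight_pos hC (hγ j) (hp j)).le
  have : ∑ i ∈ S, minorityShare S C γ p i
      ≤ ∑ i ∈ S, barrierWeight C (γ i) (p i) / ∑ j ∈ S, barrierWeight C (γ j) (p j) := by
    refine sum_le_sum fun i _ => ?_
    unfold minorityShare
    split_ifs
    · exact le_rfl
    · exact div_nonneg (h0 i) (sum_nonneg fun j _ => h0 j)
  rw [← sum_div] at this
  exact this.trans (div_self_le_one _)

/-- Expectation of the stability term when the arm is drawn from `p`. -/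
lemma sum_mul_stabilityTerm_le (hC : 0 < C) (hγ : ∀ i, 0 < γ i) (hp : ∀ i, 0 < p i) :
    ∑ i, p i * stabilityTerm S C γ p i
      ≤ 5 * ∑ i ∈ Sᶜ, barrierWeight C (γ i) (p i) / p i
        + ∑ i ∈ S, minorityShare S C γ p i * (barrierWeight C (γ i) (p i) / p i) := by
  have h0 : ∀ j, 0 < barrierWeight C (γ j) (p j) := fun j => barrierWeight_pos hC (hγ j) (hp j)
  set X := ∑ i ∈ Sᶜ, barrierWeight C (γ i) (p i) / p i with hX
  have hX0 : 0 ≤ X := sum_nonneg fun i _ => div_nonneg (h0 i).le (hp i).le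
  set W := ∑ j ∈ S, barrierWeight C (γ j) (p j) with hW
  have hW0 : 0 ≤ W := sum_nonneg fun i _ => (h0 i).le
  rw [← sum_add_sum_compl S]
  have h1 : ∑ i ∈ Sᶜ, p i * stabilityTerm S C γ p i = X := by
    refine sum_congr rfl fun i hi => ?_
    rw [stabilityTerm, if_neg (mem_compl.1 hi)]
    have := (hp i).ne'
    field_simp
  have h2 : ∑ i ∈ S, p i * stabilityTerm S C γ p i
      ≤ ∑ i ∈ S, (minorityShare S C γ p i * (barrierWeight C (γ i) (p i) / p i)
        + barrierWeight C (γ i) (p i) / W * (4 * X)) := by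
    refine sum_le_sum fun i hi => ?_
    have hpi := hp i
    have hwW : 0 ≤ barrierWeight C (γ i) (p i) / W := div_nonneg (h0 i).le hW0
    rw [stabilityTerm, if_pos hi, ← hW, minorityShare, ← hW]
    split_ifs with hif
    · have e : p i * (barrierWeight C (γ i) (p i) / W * barrierWeight C (γ i) (p i) / p i ^ 2)
        = barrierWeight C (γ i) (p i) / W * (barrierWeight C (γ i) (p i) / p i) := by
        field_simp
      rw [e]
      linarith [mul_nonneg hwW (mul_nonneg (by norm_num : (0 : ℝ) ≤ 4) hX0)]
    · have e : p i * (barrierWeight C (γ i) (p i) / W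
          * (4 * ∑ j ∈ Sᶜ, barrierWeight C (γ j) (p j)) / p i ^ 2)
        = barrierWeight C (γ i) (p i) / W
          * (4 * ∑ j ∈ Sᶜ, barrierWeight C (γ j) (p j) / p i) := by
        rw [← sum_div]
        field_simp
      rw [e, zero_mul, zero_add]
      refine mul_le_mul_of_nonneg_left (mul_le_mul_of_nonneg_left ?_ (by norm_num)) hwW
      -- Here `p i` exceeds the whole outside mass, so `p j ≤ p i` and each quotient may be divided
      -- by `p j` instead. The total is `4 X` over `S`, and the outside arms themselves add one more
      -- `X`.
      refine sum_le_sum fun j hj => ?_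
      have hji : p j ≤ p i := by
        have := single_le_sum (f := p) (fun k _ => (hp k).le) hj
        linarith
      exact div_le_div_of_nonneg_left (h0 j).le (hp j) hji
  rw [sum_add_distrib, ← sum_mul, ← sum_div, ← hW] at h2
  have h3 : W / W * (4 * X) ≤ 4 * X :=
    mul_le_of_le_one_left (by positivity) (div_self_le_one W)
  linarith

end ExpectedStability

/-! ### Summing stability and rate costs over the rounds -/

section Summation

variable {K T : ℕ} {C θ : ℝ} {p : ℕ → Fin K → ℝ}

/-- `√A' ≤ √A + √(1 / p)` for consecutive rate sums, and `θ √(1 / p) p ≤ θ ≤ C`: the barrier pays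
for replacing the current rate sum by the next. -/
lemma barrierWeight_div_le (hT : 0 < T) (hθ : 0 < θ) (hθC : θ ≤ C) {t : ℕ} {i : Fin K}
    (hp : 0 < p t i) (hp1 : p t i ≤ 1) :
    barrierWeight C (learningRate θ 1 T p t i) (p t i) / p t i
      ≤ 1 / θ * (1 / √(rateSum T p (t + 1) i)) := by
  have hA := rateSum_pos (p := p) hT t i
  have hA' := rateSum_pos (p := p) hT (t + 1) i
  have hm := truncated_pos hT (p t i)
  have hs : √(rateSum T p (t + 1) i) ≤ √(rateSum T p t i) + √(1 / p t i) := by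
    refine Real.sqrt_le_iff.2 ⟨by positivity, ?_⟩
    rw [add_sq, Real.sq_sqrt hA.le, Real.sq_sqrt (by positivity), rateSum_succ]
    have h1 : (max (p t i) (1 / (T : ℝ)))⁻¹ ≤ 1 / p t i := by
      rw [one_div (p t i)]; exact inv_anti₀ hp (le_max_left _ _)
    have : 0 ≤ 2 * √(rateSum T p t i) * √(1 / p t i) := by positivity
    linarith
  have hsp : √(1 / p t i) * p t i ≤ 1 := by
    rw [Real.sqrt_div zero_le_one, Real.sqrt_one, one_div_mul_eq_div, Real.div_sqrt]
    exact Real.sqrt_le_one.2 hp1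
  rw [learningRate_eq, one_div_mul_one_div]
  have hs' : 0 < √(rateSum T p (t + 1) i) := Real.sqrt_pos.2 hA'
  have hs0 : 0 ≤ √(rateSum T p t i) := Real.sqrt_nonneg _
  have hC : 0 < C := hθ.trans_le hθC
  have e : barrierWeight C (θ * √(rateSum T p t i)) (p t i) / p t i
      = p t i / (θ * √(rateSum T p t i) * p t i + C) := by
    unfold barrierWeight
    field_simp
  rw [e, div_le_div_iff₀ (by positivity) (by positivity)]
  have h2 := mul_le_mul_of_nonneg_right (mul_le_mul_of_nonneg_left hs hθ.le) hp.le
  have h3 := mul_le_mul_of_nonneg_left hsp hθ.le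
  nlinarith

/-- Each term is `(A' - A) / A' ≤ log A' - log A`, and the last rate sum is at most `1 + T² ≤ T³`.
-/
lemma sum_inv_div_rateSum_le (hT : 2 ≤ T) (i : Fin K) :
    ∑ t ∈ range T, (max (p t i) (1 / (T : ℝ)))⁻¹ / rateSum T p (t + 1) i ≤ 3 * Real.log T := by
  have hT0 : 0 < T := by omega
  have hTr : (2 : ℝ) ≤ T := by exact_mod_cast hT
  have h : ∀ t ∈ range T, (max (p t i) (1 / (T : ℝ)))⁻¹ / rateSum T p (t + 1) i
      ≤ Real.log (rateSum T p (t + 1) i) - Real.log (rateSum T p t i) := by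
    intro t _
    have h1 := rateSum_pos (p := p) hT0 t i
    have h2 := rateSum_pos (p := p) hT0 (t + 1) i
    have := Real.one_sub_inv_le_log_of_pos (div_pos h2 h1)
    rw [Real.log_div h2.ne' h1.ne', inv_div] at this
    refine le_trans (le_of_eq ?_) this
    have h3 : (max (p t i) (1 / (T : ℝ)))⁻¹ = rateSum T p (t + 1) i - rateSum T p t i := by
      rw [rateSum_succ]; ring
    rw [h3, sub_div, div_self h2.ne']
  refine (sum_le_sum h).trans ?_
  rw [sum_range_sub (fun t => Real.log (rateSum T p t i))]
  have h0 : Real.log (rateSum T p 0 i) = 0 := by simp [rateSum]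
  have h1 : Real.log (rateSum T p T i) ≤ Real.log ((T : ℝ) ^ 3) := by
    apply Real.log_le_log (rateSum_pos hT0 T i)
    refine (rateSum_le hT0 i).trans ?_
    nlinarith [mul_le_mul_of_nonneg_right hTr (sq_nonneg (T : ℝ)), sq_nonneg ((T : ℝ) - 2)]
  rw [Real.log_pow] at h1
  push_cast at h1
  linarith

lemma sum_div_sqrt_rateSum_le (hT : 2 ≤ T) (i : Fin K) (b : ℕ → ℝ) :
    ∑ t ∈ range T, b t * (1 / √(rateSum T p (t + 1) i))
      ≤ √(∑ t ∈ range T, b t ^ 2 * max (p t i) (1 / (T : ℝ))) * √(3 * Real.log T) := by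
  have hT0 : 0 < T := by omega
  have h := Real.sum_mul_le_sqrt_mul_sqrt (range T)
    (fun t => b t * √(max (p t i) (1 / (T : ℝ))))
    (fun t => 1 / (√(max (p t i) (1 / (T : ℝ))) * √(rateSum T p (t + 1) i)))
  have e1 : ∀ t ∈ range T, b t * √(max (p t i) (1 / (T : ℝ)))
      * (1 / (√(max (p t i) (1 / (T : ℝ))) * √(rateSum T p (t + 1) i)))
      = b t * (1 / √(rateSum T p (t + 1) i)) := fun t _ => by
    have h1 := Real.sqrt_pos.2 (truncated_pos hT0 (p t i))
    have h2 := Real.sqrt_pos.2 (rateSum_pos (p := p) hT0 (t + 1) i)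
    field_simp
  have e2 : ∀ t ∈ range T, (b t * √(max (p t i) (1 / (T : ℝ)))) ^ 2
      = b t ^ 2 * max (p t i) (1 / (T : ℝ)) := fun t _ => by
    rw [mul_pow, Real.sq_sqrt (truncated_pos hT0 _).le]
  have e3 : ∀ t ∈ range T,
      (1 / (√(max (p t i) (1 / (T : ℝ))) * √(rateSum T p (t + 1) i))) ^ 2
      = (max (p t i) (1 / (T : ℝ)))⁻¹ / rateSum T p (t + 1) i := fun t _ => by
    rw [div_pow, mul_pow, Real.sq_sqrt (truncated_pos hT0 _).le,
      Real.sq_sqrt (rateSum_pos hT0 _ _).le, one_pow, inv_eq_one_div, div_div]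
  rw [sum_congr rfl e1, sum_congr rfl e2, sum_congr rfl e3] at h
  refine h.trans ?_
  gcongr
  exact sum_inv_div_rateSum_le hT i

/-- Scale of the regret against the arms in `S`, in terms of the expected numbers of pulls of the
other arms. -/
def regretScale (S : Finset (Fin K)) (T : ℕ) (p : ℕ → Fin K → ℝ) : ℝ :=
  ∑ i ∈ Sᶜ, √(1 + ∑ t ∈ range T, p t i)
    + √(#S * (1 + ∑ i ∈ Sᶜ, ∑ t ∈ range T, p t i))

lemma max_le_add (hT : 0 < T) {r : ℝ} (hr : 0 ≤ r) : max r (1 / (T : ℝ)) ≤ r + 1 / T :=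
  max_le (le_add_of_nonneg_right (by positivity)) (le_add_of_nonneg_left hr)

/-- Truncating at `1 / T` adds at most `1` over `T` rounds, which is the `1` under the root. -/
lemma sum_one_div_sqrt_rateSum_le (hT : 2 ≤ T) {i : Fin K} (hp : ∀ t < T, 0 < p t i) :
    ∑ t ∈ range T, 1 / √(rateSum T p (t + 1) i)
      ≤ √(1 + ∑ t ∈ range T, p t i) * √(3 * Real.log T) := by
  have hT0 : 0 < T := by omega
  have h := sum_div_sqrt_rateSum_le (p := p) hT i (fun _ => 1)
  simp only [one_mul, one_pow] at h
  refine h.trans ?_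
  gcongr
  have : ∑ t ∈ range T, max (p t i) (1 / (T : ℝ)) ≤ ∑ t ∈ range T, (p t i + 1 / T) :=
    sum_le_sum fun t ht => max_le_add hT0 (hp t (mem_range.1 ht)).le
  refine this.trans (le_of_eq ?_)
  rw [sum_add_distrib, sum_const, card_range, nsmul_eq_mul, add_comm]
  congr 1
  field_simp

/-- A nonzero share forces `p t i ≤ p t (Sᶜ)`, so the truncated probability is at most `1 / T + p t
(Sᶜ)`. Shares are at most `1` and sum to at most `1`, so in each round all of `S` pays this once;
Cauchy–Schwarz over the arms gives the factor `#S`. -/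
lemma sum_minorityShare_div_sqrt_le (hT : 2 ≤ T) (hC : 0 < C) {γ : ℕ → Fin K → ℝ}
    (hγ : ∀ t i, 0 < γ t i) (S : Finset (Fin K)) (hp : ∀ t < T, ∀ i, 0 < p t i) :
    ∑ i ∈ S, ∑ t ∈ range T,
        minorityShare S C (γ t) (p t) i * (1 / √(rateSum T p (t + 1) i))
      ≤ √(#S * (1 + ∑ i ∈ Sᶜ, ∑ t ∈ range T, p t i)) * √(3 * Real.log T) := by
  have hT0 : 0 < T := by omega
  have hTinv : (0 : ℝ) < 1 / T := by positivity
  refine (sum_le_sum fun i _ => sum_div_sqrt_rateSum_le (p := p) hT i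
    (fun t => minorityShare S C (γ t) (p t) i)).trans ?_
  rw [← sum_mul]
  gcongr
  set Z : Fin K → ℝ := fun i => ∑ t ∈ range T, minorityShare S C (γ t) (p t) i ^ 2
    * max (p t i) (1 / (T : ℝ)) with hZ
  have hZ0 : ∀ i, 0 ≤ Z i := fun i => sum_nonneg fun t _ =>
    mul_nonneg (sq_nonneg _) (truncated_pos hT0 _).le
  have h1 := Real.sum_mul_le_sqrt_mul_sqrt S (fun _ => 1) (fun i => √(Z i))
  simp only [one_mul, one_pow, sum_const, nsmul_eq_mul, mul_one, Real.sq_sqrt (hZ0 _)] at h1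
  refine h1.trans ?_
  rw [Real.sqrt_mul (Nat.cast_nonneg _)]
  gcongr
  rw [hZ, sum_comm, sum_comm (s := Sᶜ)]
  have h2 : ∀ t ∈ range T, ∑ i ∈ S, minorityShare S C (γ t) (p t) i ^ 2
      * max (p t i) (1 / (T : ℝ)) ≤ 1 / T + ∑ j ∈ Sᶜ, p t j := by
    intro t ht
    have hpt := hp t (mem_range.1 ht)
    have hV : 0 ≤ ∑ j ∈ Sᶜ, p t j := sum_nonneg fun j _ => (hpt j).le
    have h3 : ∀ i ∈ S, minorityShare S C (γ t) (p t) i ^ 2 * max (p t i) (1 / (T : ℝ))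
        ≤ minorityShare S C (γ t) (p t) i * (1 / T + ∑ j ∈ Sᶜ, p t j) := by
      intro i hi
      have hs0 := minorityShare_nonneg (S := S) hC (hγ t) hpt i
      have hs1 : minorityShare S C (γ t) (p t) i ≤ 1 :=
        (single_le_sum (f := minorityShare S C (γ t) (p t))
          (fun j _ => minorityShare_nonneg hC (hγ t) hpt j) hi).trans
          (sum_minorityShare_le_one hC (hγ t) hpt)
      by_cases hle : p t i ≤ ∑ j ∈ Sᶜ, p t j
      · have hm := max_le_add hT0 (hpt i).le
        have hm0 := (truncated_pos hT0 (p t i)).le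
        calc _ ≤ minorityShare S C (γ t) (p t) i * max (p t i) (1 / (T : ℝ)) := by
              apply mul_le_mul_of_nonneg_right _ hm0
              nlinarith
          _ ≤ _ := mul_le_mul_of_nonneg_left (by linarith) hs0
      · have : minorityShare S C (γ t) (p t) i = 0 := by rw [minorityShare, if_neg hle]
        rw [this]; simp
    refine (sum_le_sum h3).trans ?_
    rw [← sum_mul]
    exact mul_le_of_le_one_left (by positivity) (sum_minorityShare_le_one hC (hγ t) hpt)
  refine (sum_le_sum h2).trans (le_of_eq ?_)
  rw [sum_add_distrib, sum_const, card_range, nsmul_eq_mul]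
  congr 1
  field_simp

/-- Above the truncation `-log r ≤ log T`. Below it, `u = r T < 1` satisfies `u (1 - log u) ≤ 1`,
and `log T` enters with the factor `u`. -/
lemma mul_inv_truncated_mul_le (hT : 2 ≤ T) {r : ℝ} (hr : 0 < r) :
    r * (max r (1 / (T : ℝ)))⁻¹ * (1 - Real.log r) ≤ 1 + Real.log T := by
  have hT0 : (0 : ℝ) < T := by positivity
  have hlT : 0 ≤ Real.log T := Real.log_nonneg (by exact_mod_cast (by omega : 1 ≤ T))
  rcases le_or_gt (1 / (T : ℝ)) r with h | h
  · rw [max_eq_left h, mul_inv_cancel₀ hr.ne', one_mul]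
    have := Real.log_le_log (by positivity) h
    rw [one_div, Real.log_inv] at this
    linarith
  · rw [max_eq_right h.le, one_div, inv_inv]
    have hu : r * T < 1 := by rwa [lt_div_iff₀ hT0] at h
    have hu0 : 0 < r * T := by positivity
    have h1 := neg_one_le_shiftedEntropy hu0
    rw [shiftedEntropy_eq hu0, Real.log_mul hr.ne' hT0.ne'] at h1
    nlinarith

/-- Bound for the expected stability terms and the costs of changing learning rates. -/
lemma sum_stability_add_rateCost_le (hT : 2 ≤ T) (hC : 2 ≤ C) (S : Finset (Fin K))
    (hp : ∀ t < T, p t ∈ posSimplex K) :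
    ∑ t ∈ range T, ∑ i, p t i * stabilityTerm S C (learningRate (√(1 / Real.log T)) 1 T p t) (p t) i
        + ∑ t ∈ range T, rateCost S (√(1 / Real.log T)) T p t
      ≤ 30 * Real.log T * regretScale S T p := by
  have hT0 : 0 < T := by omega
  have hTr : (2 : ℝ) ≤ T := by exact_mod_cast hT
  have hlog : 0.69 ≤ Real.log T := by
    have := Real.log_le_log (by norm_num) hTr
    linarith [Real.log_two_gt_d9]
  set ℓ := Real.log T with hℓ
  have hℓ0 : 0 < ℓ := by linarith
  set θ := √(1 / ℓ) with hθdef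
  have hθ : 0 < θ := Real.sqrt_pos.2 (by positivity)
  have hθ2 : θ ≤ 2 := by
    apply Real.sqrt_le_iff.2 ⟨by norm_num, ?_⟩
    rw [div_le_iff₀ hℓ0]; linarith
  have hC0 : 0 < C := by linarith
  have hp0 : ∀ t < T, ∀ i, 0 < p t i := fun t ht => (hp t ht).1
  have hp1 : ∀ t < T, ∀ i, p t i ≤ 1 := fun t ht i => by
    rw [← (hp t ht).2]
    exact single_le_sum (f := p t) (fun j _ => ((hp t ht).1 j).le) (mem_univ i)
  have hγ := fun t => learningRate_pos (p := p) hT0 hθ t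
  -- Stability carries `1 / θ` and the rate cost carries `θ (1 + ℓ)`; with `θ = √(1 / ℓ)` both
  -- become of order `ℓ`.
  have hs3 : √(3 * ℓ) * (1 / θ) ≤ 2 * ℓ := by
    rw [hθdef, Real.sqrt_div zero_le_one, Real.sqrt_one, one_div_one_div, ← Real.sqrt_mul (by positivity)]
    apply Real.sqrt_le_iff.2 ⟨by positivity, ?_⟩
    nlinarith
  have hs3' : √(3 * ℓ) * θ ≤ 2 := by
    rw [hθdef, ← Real.sqrt_mul (by positivity)]
    apply Real.sqrt_le_iff.2 ⟨by positivity, ?_⟩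
    have : 3 * ℓ * (1 / ℓ) = 3 := by field_simp
    rw [this]; norm_num
  set R : ℕ → Fin K → ℝ := fun t i => 1 / √(rateSum T p (t + 1) i) with hR
  have hR0 : ∀ t i, 0 ≤ R t i := fun t i => by positivity
  have hstab : ∀ t ∈ range T, ∑ i, p t i * stabilityTerm S C (learningRate θ 1 T p t) (p t) i
      ≤ 5 * (1 / θ) * ∑ i ∈ Sᶜ, R t i
        + 1 / θ * ∑ i ∈ S, minorityShare S C (learningRate θ 1 T p t) (p t) i * R t i := by
    intro t ht
    have ht := mem_range.1 ht
    refine (sum_mul_stabilityTerm_le hC0 (hγ t) (hp0 t ht)).trans ?_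
    rw [mul_assoc, mul_sum _ _ (1 / θ), mul_sum _ _ (1 / θ)]
    have hw : ∀ i, barrierWeight C (learningRate θ 1 T p t i) (p t i) / p t i ≤ 1 / θ * R t i :=
      fun i => barrierWeight_div_le hT0 hθ (by linarith) (hp0 t ht i) (hp1 t ht i)
    refine add_le_add (mul_le_mul_of_nonneg_left (sum_le_sum fun i _ => hw i) (by norm_num))
      (sum_le_sum fun i _ => ?_)
    have := mul_le_mul_of_nonneg_left (hw i)
      (minorityShare_nonneg (S := S) hC0 (hγ t) (hp0 t ht) i)
    linarith
  have hcost : ∀ t ∈ range T, rateCost S θ T p t ≤ 4 * θ * (1 + ℓ) * ∑ i ∈ Sᶜ, R t i := by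
    intro t ht
    have ht := mem_range.1 ht
    unfold rateCost
    rw [mul_sum]
    refine sum_le_sum fun i _ => ?_
    have h1 := learningRate_succ_sub_le (p := p) hT0 hθ t i
    have hpi := hp0 t ht i
    have hl : 0 ≤ 1 - Real.log (p t i) := by
      linarith [Real.log_nonpos hpi.le (hp1 t ht i)]
    have h2 := mul_inv_truncated_mul_le hT hpi
    have h3 := mul_le_mul_of_nonneg_right h1
      (show 0 ≤ 4 * p t i * (1 - Real.log (p t i)) by positivity)
    refine h3.trans ?_
    have e : θ * ((max (p t i) (1 / (T : ℝ)))⁻¹ / √(rateSum T p (t + 1) i))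
        * (4 * p t i * (1 - Real.log (p t i)))
        = 4 * θ * R t i * (p t i * (max (p t i) (1 / (T : ℝ)))⁻¹ * (1 - Real.log (p t i))) := by
      simp only [hR]; ring
    rw [e]
    have := mul_le_mul_of_nonneg_left h2 (show 0 ≤ 4 * θ * R t i from
      mul_nonneg (by positivity) (hR0 t i))
    linarith
  have hA : ∑ t ∈ range T, ∑ i ∈ Sᶜ, R t i
      ≤ (∑ i ∈ Sᶜ, √(1 + ∑ t ∈ range T, p t i)) * √(3 * ℓ) := by
    rw [sum_comm, sum_mul]
    exact sum_le_sum fun i _ => sum_one_div_sqrt_rateSum_le hT fun t ht => hp0 t ht i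
  have hB := sum_minorityShare_div_sqrt_le hT hC0 hγ S hp0
  rw [sum_comm] at hB
  have h1 := sum_le_sum hstab
  have h2 := sum_le_sum hcost
  rw [sum_add_distrib, ← mul_sum, ← mul_sum] at h1
  rw [← mul_sum] at h2
  unfold regretScale
  set V := ∑ i ∈ Sᶜ, √(1 + ∑ t ∈ range T, p t i) with hV
  set U := √(#S * (1 + ∑ i ∈ Sᶜ, ∑ t ∈ range T, p t i)) with hU
  have hV0 : 0 ≤ V := sum_nonneg fun i _ => Real.sqrt_nonneg _
  have hU0 : 0 ≤ U := Real.sqrt_nonneg _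
  have k1 : 5 * (1 / θ) * ∑ t ∈ range T, ∑ i ∈ Sᶜ, R t i ≤ 10 * ℓ * V := by
    have a1 := mul_le_mul_of_nonneg_left hA (show 0 ≤ 5 * (1 / θ) by positivity)
    have a2 := mul_le_mul_of_nonneg_left hs3 hV0
    linarith
  have k2 : 1 / θ * ∑ t ∈ range T, ∑ i ∈ S,
      minorityShare S C (learningRate θ 1 T p t) (p t) i * R t i ≤ 2 * ℓ * U := by
    have a1 := mul_le_mul_of_nonneg_left hB (show 0 ≤ 1 / θ by positivity)
    have a2 := mul_le_mul_of_nonneg_left hs3 hU0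
    linarith
  have k3 : 4 * θ * (1 + ℓ) * ∑ t ∈ range T, ∑ i ∈ Sᶜ, R t i ≤ 20 * ℓ * V := by
    have a1 := mul_le_mul_of_nonneg_left hA (show 0 ≤ 4 * θ * (1 + ℓ) by positivity)
    have a2 := mul_le_mul_of_nonneg_left hs3' (show 0 ≤ 4 * (1 + ℓ) * V by positivity)
    have a3 := mul_le_mul_of_nonneg_right (show 8 * (1 + ℓ) ≤ 20 * ℓ by linarith) hV0
    linarith
  have : 0 ≤ ℓ * U := by positivity
  linarith

end Summation

/-! ### Measurability of the implicitly defined minimizers -/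

section Measurability

variable {Ω : Type*} {m : MeasurableSpace Ω} {C : ℝ}

lemma measurable_barrierInv (hC : 0 < C) {γ z : Ω → ℝ} (hγ : Measurable γ) (hγ0 : ∀ ω, 0 < γ ω)
    (hz : Measurable z) : Measurable fun ω => barrierInv C (γ ω) (z ω) := by
  refine measurable_of_Iio fun x => ?_
  rcases le_or_gt x 0 with hx | hx
  · convert MeasurableSet.empty
    ext ω
    simp [hx.trans (barrierInv_pos hC (hγ0 ω) (z ω)).le]
  · have : (fun ω => barrierInv C (γ ω) (z ω)) ⁻¹' Set.Iio x
        = {ω | z ω < barrierDeriv C (γ ω) x} := by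
      ext ω
      exact barrierInv_lt_iff hC (hγ0 ω) hx _
    rw [this]
    exact measurableSet_lt hz ((hγ.mul_const _).sub_const _)

variable {ι : Type*} {S : Finset ι} {γ L : Ω → ι → ℝ}

lemma measurable_kktMultiplier (hS : S.Nonempty) (hC : 0 < C) (hγ : ∀ i, Measurable fun ω => γ ω i)
    (hγ0 : ∀ ω i, 0 < γ ω i) (hL : ∀ i, Measurable fun ω => L ω i) :
    Measurable fun ω => kktMultiplier S C (γ ω) (L ω) := by
  refine measurable_of_Iio fun c => ?_
  have : (fun ω => kktMultiplier S C (γ ω) (L ω)) ⁻¹' Set.Iio c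
      = {ω | 1 < ∑ i ∈ S, barrierInv C (γ ω i) (c - L ω i)} := by
    ext ω
    exact kktMultiplier_lt_iff hS hC (hγ0 ω) c
  rw [this]
  exact measurableSet_lt measurable_const (Finset.measurable_sum _ fun i _ =>
    measurable_barrierInv hC (hγ i) (fun ω => hγ0 ω i) ((hL i).const_sub c))

lemma measurable_ftrlSolution [DecidableEq ι] (hS : S.Nonempty) (hC : 0 < C)
    (hγ : ∀ i, Measurable fun ω => γ ω i) (hγ0 : ∀ ω i, 0 < γ ω i)
    (hL : ∀ i, Measurable fun ω => L ω i) (i : ι) :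
    Measurable fun ω => ftrlSolution S C (γ ω) (L ω) i := by
  unfold ftrlSolution
  split_ifs
  · exact measurable_barrierInv hC (hγ i) (fun ω => hγ0 ω i)
      ((measurable_kktMultiplier hS hC hγ hγ0 hL).sub (hL i))
  · exact measurable_const

lemma measurable_stabilityTerm [DecidableEq ι] [Fintype ι] {p : Ω → ι → ℝ}
    (hγ : ∀ i, Measurable fun ω => γ ω i) (hp : ∀ i, Measurable fun ω => p ω i) (i : ι) :
    Measurable fun ω => stabilityTerm S C (γ ω) (p ω) i := by
  have hw : ∀ j, Measurable fun ω => barrierWeight C (γ ω j) (p ω j) := fun j =>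
    ((hp j).pow_const 2).div (((hγ j).mul (hp j)).add_const C)
  unfold stabilityTerm
  split_ifs
  · refine Measurable.div (Measurable.mul ((hw i).div (Finset.measurable_sum _ fun j _ => hw j)) ?_)
      ((hp i).pow_const 2)
    exact Measurable.ite (measurableSet_le (hp i) (Finset.measurable_sum _ fun j _ => hp j)) (hw i)
      ((Finset.measurable_sum _ fun j _ => hw j).const_mul 4)
  · exact (hw i).div ((hp i).pow_const 2)

end Measurability

/-! ### Expectations over the drawn arm -/

section Sampling

variable {Ω : Type*} [mΩ : MeasurableSpace Ω] {P : Measure Ω}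
  {F : Filtration ℕ mΩ} {K T : ℕ} {loss : ℕ → Ω → Fin K → ℝ} {arm : ℕ → Ω → Fin K}
  {p : ℕ → Ω → Fin K → ℝ}

/-- What is known when the arm of round `t` is drawn: the history and the loss vector. -/
abbrev roundInfo (F : Filtration ℕ mΩ) (loss : ℕ → Ω → Fin K → ℝ) (t : ℕ) : MeasurableSpace Ω :=
  F t ⊔ MeasurableSpace.comap (loss t) inferInstance

lemma roundInfo_le (hB : IsBanditInteraction P F T loss arm p) {t : ℕ} (ht : t < T) :
    roundInfo F loss t ≤ mΩ :=
  sup_le (F.le t) (hB.measurable_loss t ht).comap_le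

lemma measurable_loss_roundInfo (t : ℕ) (i : Fin K) :
    Measurable[roundInfo F loss t] fun ω => loss t ω i :=
  ((measurable_pi_apply i).comp (comap_measurable (loss t))).mono le_sup_right le_rfl

lemma Measurable.roundInfo {t : ℕ} {f : Ω → ℝ} (hf : Measurable[F t] f) :
    Measurable[roundInfo F loss t] f :=
  hf.mono le_sup_left le_rfl

lemma measurable_prob (hB : IsBanditInteraction P F T loss arm p) {t : ℕ} (ht : t < T)
    (i : Fin K) : Measurable[F t] fun ω => p t ω i :=
  (measurable_pi_apply i).comp (hB.predictable t ht)

variable [IsProbabilityMeasure P]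

/-- By `sampling`, the restriction of `P` to `arm t = i` and the measure with density `p t i` agree
on the σ-algebra of history and loss. Lower integrals allow unbounded integrands such as `1 / p`. -/
lemma lintegral_arm_eq (hB : IsBanditInteraction P F T loss arm p)
    (hp : ∀ ω, ∀ t < T, p t ω ∈ posSimplex K) {t : ℕ} (ht : t < T) (i : Fin K) {f : Ω → ENNReal}
    (hf : Measurable[roundInfo F loss t] f) :
    ∫⁻ ω in arm t ⁻¹' {i}, f ω ∂P = ∫⁻ ω, ENNReal.ofReal (p t ω i) * f ω ∂P := by
  have hm := roundInfo_le hB ht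
  have hs : MeasurableSet (arm t ⁻¹' {i}) := hB.measurable_arm t ht (measurableSet_singleton i)
  have hpm : Measurable fun ω => p t ω i := (measurable_prob hB ht i).mono (F.le t) le_rfl
  have hp0 : ∀ ω, 0 ≤ p t ω i := fun ω => ((hp ω t ht).1 i).le
  have hp1 : ∀ ω, p t ω i ≤ 1 := fun ω => by
    rw [← (hp ω t ht).2]
    exact single_le_sum (f := p t ω) (fun j _ => ((hp ω t ht).1 j).le) (mem_univ i)
  have hpint : Integrable (fun ω => p t ω i) P :=
    Integrable.of_bound hpm.aestronglyMeasurable 1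
      (Filter.Eventually.of_forall fun ω => by rw [Real.norm_of_nonneg (hp0 ω)]; exact hp1 ω)
  have hmeas : (P.restrict (arm t ⁻¹' {i})).trim hm
      = (P.withDensity fun ω => ENNReal.ofReal (p t ω i)).trim hm := by
    refine @Measure.ext _ (roundInfo F loss t) _ _ fun A hA => ?_
    have hA' : MeasurableSet A := hm A hA
    rw [trim_measurableSet_eq hm hA, trim_measurableSet_eq hm hA, withDensity_apply _ hA',
      ← ofReal_integral_eq_lintegral_ofReal hpint.restrict (Filter.Eventually.of_forall hp0),
      Measure.restrict_apply hA']
    have h1 : ∫ ω in A, p t ω i ∂P = ∫ ω in A, (arm t ⁻¹' {i}).indicator (fun _ => (1 : ℝ)) ω ∂P := by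
      rw [← setIntegral_condExp hm ((integrable_const (1 : ℝ)).indicator hs) hA]
      refine setIntegral_congr_ae hA' ?_
      filter_upwards [hB.sampling t ht i] with ω hω _ using hω.symm
    rw [h1, setIntegral_indicator hs, setIntegral_const, smul_eq_mul, mul_one, Measure.real,
      ENNReal.ofReal_toReal (measure_ne_top _ _)]
  rw [← lintegral_trim hm hf, hmeas, lintegral_trim hm hf,
    lintegral_withDensity_eq_lintegral_mul _ hpm.ennreal_ofReal (hf.mono hm le_rfl)]
  rfl

/-- Expectation of a nonnegative function of the arm drawn in round `t`. -/
lemma integrable_and_integral_indicator_arm (hB : IsBanditInteraction P F T loss arm p)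
    (hp : ∀ ω, ∀ t < T, p t ω ∈ posSimplex K) {t : ℕ} (ht : t < T) (i : Fin K) {g : Ω → ℝ}
    (hg : Measurable[roundInfo F loss t] g) (hg0 : ∀ ω, 0 ≤ g ω) {M : ℝ}
    (hM : ∀ ω, p t ω i * g ω ≤ M) :
    Integrable ((arm t ⁻¹' {i}).indicator g) P ∧ Integrable (fun ω => p t ω i * g ω) P ∧
      ∫ ω, (arm t ⁻¹' {i}).indicator g ω ∂P = ∫ ω, p t ω i * g ω ∂P := by
  have hm := roundInfo_le hB ht
  have hs : MeasurableSet (arm t ⁻¹' {i}) := hB.measurable_arm t ht (measurableSet_singleton i)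
  have hpm : Measurable fun ω => p t ω i := (measurable_prob hB ht i).mono (F.le t) le_rfl
  have hgm : Measurable g := hg.mono hm le_rfl
  have hp0 : ∀ ω, 0 ≤ p t ω i := fun ω => ((hp ω t ht).1 i).le
  have hpg0 : ∀ ω, 0 ≤ p t ω i * g ω := fun ω => mul_nonneg (hp0 ω) (hg0 ω)
  have hpg : Integrable (fun ω => p t ω i * g ω) P :=
    Integrable.of_bound (hpm.mul hgm).aestronglyMeasurable M
      (Filter.Eventually.of_forall fun ω => by rw [Real.norm_of_nonneg (hpg0 ω)]; exact hM ω)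
  have key : ∫⁻ ω in arm t ⁻¹' {i}, ENNReal.ofReal (g ω) ∂P
      = ∫⁻ ω, ENNReal.ofReal (p t ω i * g ω) ∂P := by
    rw [lintegral_arm_eq hB hp ht i hg.ennreal_ofReal]
    exact lintegral_congr fun ω => (ENNReal.ofReal_mul (hp0 ω)).symm
  have hgi : Integrable g (P.restrict (arm t ⁻¹' {i})) := by
    refine ⟨hgm.aestronglyMeasurable, ?_⟩
    rw [hasFiniteIntegral_iff_ofReal (Filter.Eventually.of_forall hg0), key,
      ← hasFiniteIntegral_iff_ofReal (Filter.Eventually.of_forall hpg0)]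
    exact hpg.2
  refine ⟨(integrable_indicator_iff hs).2 hgi, hpg, ?_⟩
  rw [integral_indicator hs, integral_eq_lintegral_of_nonneg_ae (Filter.Eventually.of_forall hg0)
    hgm.aestronglyMeasurable, key, integral_eq_lintegral_of_nonneg_ae
    (Filter.Eventually.of_forall hpg0) hpg.1]

lemma integrable_and_integral_arm (hB : IsBanditInteraction P F T loss arm p)
    (hp : ∀ ω, ∀ t < T, p t ω ∈ posSimplex K) {t : ℕ} (ht : t < T) {g : Fin K → Ω → ℝ}
    (hg : ∀ i, Measurable[roundInfo F loss t] (g i)) (hg0 : ∀ i ω, 0 ≤ g i ω) {M : ℝ}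
    (hM : ∀ i ω, p t ω i * g i ω ≤ M) :
    Integrable (fun ω => g (arm t ω) ω) P ∧ Integrable (fun ω => ∑ i, p t ω i * g i ω) P ∧
      ∫ ω, g (arm t ω) ω ∂P = ∫ ω, ∑ i, p t ω i * g i ω ∂P := by
  have h := fun i => integrable_and_integral_indicator_arm hB hp ht i (hg i) (hg0 i) (hM i)
  have e : (fun ω => g (arm t ω) ω) = fun ω => ∑ i, (arm t ⁻¹' {i}).indicator (g i) ω := by
    funext ω
    rw [sum_eq_single (arm t ω)]
    · simp
    · intro i _ hi
      exact Set.indicator_of_notMem (by simpa using hi.symm) _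
    · simp
  rw [e]
  refine ⟨integrable_finsetSum _ fun i _ => (h i).1, integrable_finsetSum _ fun i _ => (h i).2.1, ?_⟩
  rw [integral_finsetSum _ fun i _ => (h i).1, integral_finsetSum _ fun i _ => (h i).2.1]
  exact sum_congr rfl fun i _ => (h i).2.2

end Sampling

/-! ### Expected regret against a set of arms -/

section Core

lemma stabilityTerm_nonneg {ι : Type*} [DecidableEq ι] [Fintype ι] {S : Finset ι} {C : ℝ}
    {γ p : ι → ℝ} (hC : 0 < C) (hγ : ∀ i, 0 < γ i) (hp : ∀ i, 0 < p i) (i : ι) :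
    0 ≤ stabilityTerm S C γ p i := by
  have h0 : ∀ j, 0 < barrierWeight C (γ j) (p j) := fun j => barrierWeight_pos hC (hγ j) (hp j)
  have hs : ∀ A : Finset ι, 0 ≤ ∑ j ∈ A, barrierWeight C (γ j) (p j) := fun A =>
    sum_nonneg fun j _ => (h0 j).le
  have := h0 i
  have := hs S
  have := hs Sᶜ
  unfold stabilityTerm
  split_ifs <;> positivity

/-- A crude bound that serves only integrability. -/
lemma mul_stabilityTerm_le {ι : Type*} [DecidableEq ι] [Fintype ι] {S : Finset ι} {C : ℝ}
    {γ p : ι → ℝ} (hC : 1 ≤ C) (hγ : ∀ i, 0 < γ i) (hp : ∀ i, 0 < p i) (hp1 : ∀ i, p i ≤ 1)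
    (i : ι) : p i * stabilityTerm S C γ p i ≤ 6 * Fintype.card ι := by
  have hC0 : 0 < C := by linarith
  have h1 := single_le_sum (f := fun i => p i * stabilityTerm S C γ p i)
    (fun j _ => mul_nonneg (hp j).le (stabilityTerm_nonneg (S := S) hC0 hγ hp j)) (mem_univ i)
  refine h1.trans ((sum_mul_stabilityTerm_le hC0 hγ hp).trans ?_)
  have hx : ∀ j, barrierWeight C (γ j) (p j) / p j ≤ 1 := fun j => by
    rw [div_le_one (hp j)]
    refine (barrierWeight_le_sq_div hC0 (hγ j) (hp j)).trans ?_
    rw [div_le_iff₀ hC0]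
    nlinarith [hp j, hp1 j]
  have hx0 : ∀ j, 0 ≤ barrierWeight C (γ j) (p j) / p j := fun j =>
    div_nonneg (barrierWeight_pos hC0 (hγ j) (hp j)).le (hp j).le
  have a1 : ∑ i ∈ Sᶜ, barrierWeight C (γ i) (p i) / p i ≤ Fintype.card ι := by
    calc _ ≤ ∑ i ∈ Sᶜ, (1 : ℝ) := sum_le_sum fun j _ => hx j
      _ = #Sᶜ := by simp
      _ ≤ _ := by exact_mod_cast card_le_univ _
  have hcard : (1 : ℝ) ≤ Fintype.card ι := by
    exact_mod_cast Fintype.card_pos_iff.2 ⟨i⟩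
  have a2 : ∑ i ∈ S, minorityShare S C γ p i * (barrierWeight C (γ i) (p i) / p i) ≤ 1 := by
    refine (sum_le_sum fun j _ => ?_).trans (sum_minorityShare_le_one (S := S) hC0 hγ hp)
    exact mul_le_of_le_one_right (minorityShare_nonneg hC0 hγ hp j) (hx j)
  linarith

variable {Ω : Type*} [mΩ : MeasurableSpace Ω] {P : Measure Ω}
  {F : Filtration ℕ mΩ} {K T : ℕ} {loss : ℕ → Ω → Fin K → ℝ} {arm : ℕ → Ω → Fin K}
  {p : ℕ → Ω → Fin K → ℝ} {C θ : ℝ} {iStar : Fin K} {S : Finset (Fin K)}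

lemma measurable_learningRate (hB : IsBanditInteraction P F T loss arm p) {t : ℕ} (ht : t < T)
    (i : Fin K) : Measurable[F t] fun ω => learningRate θ 1 T (fun s => p s ω) t i := by
  simp only [learningRate_eq, rateSum]
  refine Measurable.const_mul (Measurable.sqrt (Measurable.const_add
    (Finset.measurable_sum _ fun s hs => ?_) 1)) θ
  have hst := mem_range.1 hs
  exact Measurable.inv (Measurable.max
    ((measurable_prob hB (hst.trans ht) i).mono (F.mono hst.le) le_rfl) measurable_const)

lemma measurable_cumulativeEstimate (hB : IsBanditInteraction P F T loss arm p) {t : ℕ}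
    (ht : t < T) (i : Fin K) : Measurable[F t] fun ω =>
      cumulativeEstimate (fun s => p s ω) (fun s => arm s ω) (fun s => loss s ω) t i := by
  unfold cumulativeEstimate
  refine Finset.measurable_sum _ fun s hs => ?_
  have hst := mem_range.1 hs
  -- Only the observed entry of the loss vector is measurable with respect to the history, so the
  -- estimator is rewritten through it.
  have e : (fun ω => lossEstimator (p s ω) (arm s ω) (loss s ω) i)
      = fun ω => (if arm s ω = i then loss s ω (arm s ω) else 0) / p s ω i := by
    funext ω
    unfold lossEstimator
    congr 1
    split_ifs with h
    · rw [h]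
    · rfl
  rw [e]
  refine Measurable.div (Measurable.ite ?_ (hB.observed_past t ht s hst) measurable_const)
    ((measurable_prob hB (hst.trans ht) i).mono (F.mono hst.le) le_rfl)
  exact hB.arm_past t ht s hst (measurableSet_singleton i)

lemma measurable_comparator (hB : IsBanditInteraction P F T loss arm p) (hS : S.Nonempty)
    (hC : 0 < C) (hθ : 0 < θ) {t : ℕ} (ht : t < T) (i : Fin K) : Measurable[F t] fun ω =>
      comparator S C θ T (fun s => p s ω) (fun s => arm s ω) (fun s => loss s ω) t i :=
  measurable_ftrlSolution hS hC (fun i => measurable_learningRate hB ht i)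
    (fun _ => learningRate_pos (by omega) hθ t) (fun i => measurable_cumulativeEstimate hB ht i) i

lemma measurable_loss_apply (hB : IsBanditInteraction P F T loss arm p) {t : ℕ} (ht : t < T)
    (i : Fin K) : Measurable fun ω => loss t ω i :=
  (measurable_pi_apply i).comp (hB.measurable_loss t ht)

lemma integrable_sup'_condExp (hS : S.Nonempty) (t : ℕ) : Integrable (fun ω => S.sup' hS fun i =>
      (P[fun ω' => loss t ω' i - loss t ω' iStar | F t]) ω) P := by
  have := Finset.sup'_induction (p := fun f : Ω → ℝ => Integrable f P) hS
    (fun i => P[fun ω' => loss t ω' i - loss t ω' iStar | F t])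
    (fun _ h₁ _ h₂ => h₁.sup h₂) (fun i _ => integrable_condExp)
  refine this.congr (Filter.Eventually.of_forall fun ω => ?_)
  simp [Finset.sup'_apply]

variable [IsProbabilityMeasure P]

lemma integrable_loss (hB : IsBanditInteraction P F T loss arm p) {t : ℕ} (ht : t < T)
    (i : Fin K) : Integrable (fun ω => loss t ω i) P :=
  Integrable.of_bound (measurable_loss_apply hB ht i).aestronglyMeasurable 1
    (Filter.Eventually.of_forall fun ω => by
      have h := hB.loss_mem t ht ω i
      rw [Real.norm_of_nonneg h.1]; exact h.2)

/-- A predictable distribution on `S` is at most `benchmarkDrift` worse than `iStar`. -/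
lemma integral_comparator_sub_le (hB : IsBanditInteraction P F T loss arm p) (hS : S.Nonempty)
    {q : ℕ → Ω → Fin K → ℝ} (hq : ∀ t < T, ∀ i, Measurable[F t] fun ω => q t ω i)
    (hq0 : ∀ t < T, ∀ ω i, 0 ≤ q t ω i) (hqS : ∀ t < T, ∀ ω, ∑ i ∈ S, q t ω i = 1) :
    ∑ t ∈ range T, (∫ ω, ∑ i ∈ S, q t ω i * loss t ω i ∂P - ∫ ω, loss t ω iStar ∂P)
      ≤ benchmarkDrift P F T loss iStar S := by
  unfold benchmarkDrift
  simp only [dif_pos hS]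
  rw [integral_finsetSum _ fun t ht => integrable_sup'_condExp hS t]
  refine sum_le_sum fun t ht => ?_
  have ht := mem_range.1 ht
  have hq1 : ∀ ω, ∀ i ∈ S, q t ω i ≤ 1 := fun ω i hi => by
    rw [← hqS t ht ω]; exact single_le_sum (f := q t ω) (fun j _ => hq0 t ht ω j) hi
  have hdint : ∀ i, Integrable (fun ω => loss t ω i - loss t ω iStar) P := fun i =>
    (integrable_loss hB ht i).sub (integrable_loss hB ht iStar)
  have hbdd : ∀ i ∈ S, ∀ f : Ω → ℝ, Integrable f P → Integrable (fun ω => q t ω i * f ω) P := by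
    intro i hi f hf
    refine hf.bdd_mul (c := 1) ((hq t ht i).mono (F.le t) le_rfl).aestronglyMeasurable
      (Filter.Eventually.of_forall fun ω => ?_)
    rw [Real.norm_of_nonneg (hq0 t ht ω i)]; exact hq1 ω i hi
  -- Predictability of `q` lets it leave the conditional expectation; an average over `S` is then at
  -- most the maximum over `S`.
  have hpull : ∀ i ∈ S, ∫ ω, q t ω i * (loss t ω i - loss t ω iStar) ∂P
      = ∫ ω, q t ω i * (P[fun ω' => loss t ω' i - loss t ω' iStar | F t]) ω ∂P := by
    intro i hi
    rw [← integral_condExp (F.le t)]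
    refine integral_congr_ae ?_
    exact condExp_mul_of_stronglyMeasurable_left (hq t ht i).stronglyMeasurable
      (hbdd i hi _ (hdint i)) (hdint i)
  calc ∫ ω, ∑ i ∈ S, q t ω i * loss t ω i ∂P - ∫ ω, loss t ω iStar ∂P
      = ∫ ω, ∑ i ∈ S, q t ω i * (loss t ω i - loss t ω iStar) ∂P := by
        rw [← integral_sub (integrable_finsetSum _ fun i hi => hbdd i hi _ (integrable_loss hB ht i))
          (integrable_loss hB ht iStar)]
        congr 1
        funext ω
        simp only [mul_sub, sum_sub_distrib]
        rw [← sum_mul, hqS t ht ω, one_mul]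
    _ = ∫ ω, ∑ i ∈ S, q t ω i * (P[fun ω' => loss t ω' i - loss t ω' iStar | F t]) ω ∂P := by
        rw [integral_finsetSum _ fun i hi => hbdd i hi _ (hdint i),
          integral_finsetSum _ fun i hi => hbdd i hi _ integrable_condExp]
        exact sum_congr rfl hpull
    _ ≤ _ := by
        refine integral_mono (integrable_finsetSum _ fun i hi => hbdd i hi _ integrable_condExp)
          (integrable_sup'_condExp hS t) fun ω => ?_
        calc _ ≤ ∑ i ∈ S, q t ω i * S.sup' hS fun i =>
              (P[fun ω' => loss t ω' i - loss t ω' iStar | F t]) ω :=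
              sum_le_sum fun i hi => mul_le_mul_of_nonneg_left
                (le_sup' (fun i => (P[fun ω' => loss t ω' i - loss t ω' iStar | F t]) ω) hi)
                (hq0 t ht ω i)
          _ = _ := by rw [← sum_mul, hqS t ht ω, one_mul]

lemma integrable_regretScale (hB : IsBanditInteraction P F T loss arm p)
    (hp : ∀ ω, ∀ t < T, p t ω ∈ posSimplex K) (S : Finset (Fin K)) :
    Integrable (fun ω => regretScale S T fun t => p t ω) P := by
  have hP : ∀ i, Measurable fun ω => ∑ t ∈ range T, p t ω i := fun i =>
    Finset.measurable_sum _ fun t ht =>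
      (measurable_prob hB (mem_range.1 ht) i).mono (F.le t) le_rfl
  have hmeas : Measurable fun ω => regretScale S T fun t => p t ω := by
    unfold regretScale
    exact (Finset.measurable_sum _ fun i _ => ((hP i).const_add 1).sqrt).add
      (((Finset.measurable_sum _ fun i _ => hP i).const_add 1).const_mul _).sqrt
  have hP1 : ∀ ω i, ∑ t ∈ range T, p t ω i ≤ T := fun ω i => by
    calc _ ≤ ∑ t ∈ range T, (1 : ℝ) := sum_le_sum fun t ht => by
          have h := hp ω t (mem_range.1 ht)
          rw [← h.2]
          exact single_le_sum (f := p t ω) (fun j _ => (h.1 j).le) (mem_univ i)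
      _ = T := by simp
  refine Integrable.of_bound hmeas.aestronglyMeasurable
    (∑ i ∈ Sᶜ, √(1 + (T : ℝ)) + √(#S * (1 + ∑ i ∈ Sᶜ, (T : ℝ))))
    (Filter.Eventually.of_forall fun ω => ?_)
  unfold regretScale
  rw [Real.norm_of_nonneg (add_nonneg (sum_nonneg fun _ _ => Real.sqrt_nonneg _)
    (Real.sqrt_nonneg _))]
  gcongr with i hi i hi
  · exact hP1 ω i
  · exact hP1 ω i

/-- Regret bound relative to an arbitrary nonempty set `S` of arms. -/
lemma regret_le_regretScale (hB : IsBanditInteraction P F T loss arm p) (hS : S.Nonempty)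
    (hF : ∀ ω, IsShannonFTRL C 1 (√(1 / Real.log T)) T
      (fun t => p t ω) (fun t => arm t ω) (fun t => loss t ω))
    (hT : 2 ≤ T) (hKT : K ≤ T) (hC : 16 < C) :
    regret P T loss arm iStar ≤ 1 + 3 * K * (C * Real.log T + 2)
      + 30 * Real.log T * ∫ ω, regretScale S T (fun t => p t ω) ∂P
      + benchmarkDrift P F T loss iStar S := by
  have hK : 0 < K := hS.choose.pos
  have hT0 : 0 < T := by omega
  have hTr : (2 : ℝ) ≤ T := by exact_mod_cast hT
  have hC0 : 0 < C := by linarith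
  have hlog : 0.69 ≤ Real.log T := by
    have := Real.log_le_log (by norm_num) hTr
    linarith [Real.log_two_gt_d9]
  set θ := √(1 / Real.log T) with hθdef
  have hℓ0 : 0 < Real.log T := by linarith
  have hθ : 0 < θ := Real.sqrt_pos.2 (by positivity)
  have hθ2 : θ ≤ 2 := by
    apply Real.sqrt_le_iff.2 ⟨by norm_num, ?_⟩
    rw [div_le_iff₀ hℓ0]; linarith
  have hp : ∀ ω, ∀ t < T, p t ω ∈ posSimplex K := fun ω t ht => (hF ω t ht).1
  have hp0 : ∀ t < T, ∀ ω i, 0 < p t ω i := fun t ht ω => (hp ω t ht).1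
  have hp1 : ∀ t < T, ∀ ω i, p t ω i ≤ 1 := fun t ht ω i => by
    rw [← (hp ω t ht).2]
    exact single_le_sum (f := p t ω) (fun j _ => (hp0 t ht ω j).le) (mem_univ i)
  have hl := hB.loss_mem
  have hγ : ∀ ω t i, 0 < learningRate θ 1 T (fun s => p s ω) t i := fun ω t i =>
    learningRate_pos hT0 hθ t i
  set q : ℕ → Ω → Fin K → ℝ := fun t ω =>
    comparator S C θ T (fun s => p s ω) (fun s => arm s ω) (fun s => loss s ω) t with hqdef
  have hq0 : ∀ t ω i, 0 ≤ q t ω i := fun t ω i => ftrlSolution_nonneg hC0 (hγ ω t) i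
  have hq1 : ∀ t ω i, q t ω i ≤ 1 := fun t ω i => ftrlSolution_le_one hC0 (hγ ω t) i
  have hqS : ∀ t ω, ∑ i ∈ S, q t ω i = 1 := fun t ω => sum_ftrlSolution hS hC0 (hγ ω t)
  have hqm : ∀ t < T, ∀ i, Measurable[F t] fun ω => q t ω i := fun t ht i =>
    measurable_comparator hB hS hC0 hθ ht i
  set st : ℕ → Fin K → Ω → ℝ := fun t i ω =>
    stabilityTerm S C (learningRate θ 1 T (fun s => p s ω) t) (p t ω) i with hst
  -- expectations of the functions of the drawn arm
  have Iloss := fun t (ht : t < T) => integrable_and_integral_arm hB hp ht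
    (g := fun i ω => loss t ω i) (fun i => measurable_loss_roundInfo t i)
    (fun i ω => (hl t ht ω i).1) (M := 1)
    (fun i ω => mul_le_one₀ (hp1 t ht ω i) (hl t ht ω i).1 (hl t ht ω i).2)
  -- The estimated loss itself is unbounded, but its product with the probability of the arm is at
  -- most `1`.
  have Iinv := fun t (ht : t < T) => integrable_and_integral_arm hB hp ht
    (g := fun i ω => loss t ω i / p t ω i)
    (fun i => (measurable_loss_roundInfo t i).div (measurable_prob hB ht i).roundInfo)
    (fun i ω => div_nonneg (hl t ht ω i).1 (hp0 t ht ω i).le) (M := 1)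
    (fun i ω => by rw [mul_div_cancel₀ _ (hp0 t ht ω i).ne']; exact (hl t ht ω i).2)
  have Iq := fun t (ht : t < T) => integrable_and_integral_arm hB hp ht
    (g := fun i ω => loss t ω i / p t ω i * q t ω i)
    (fun i => ((measurable_loss_roundInfo t i).div (measurable_prob hB ht i).roundInfo).mul
      (hqm t ht i).roundInfo)
    (fun i ω => mul_nonneg (div_nonneg (hl t ht ω i).1 (hp0 t ht ω i).le) (hq0 t ω i)) (M := 1)
    (fun i ω => by
      rw [← mul_assoc, mul_div_cancel₀ _ (hp0 t ht ω i).ne']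
      exact mul_le_one₀ (hl t ht ω i).2 (hq0 t ω i) (hq1 t ω i))
  have Ist := fun t (ht : t < T) => integrable_and_integral_arm hB hp ht
    (g := st t)
    (fun i => (measurable_stabilityTerm (fun j => measurable_learningRate hB ht j)
      (fun j => measurable_prob hB ht j) i).roundInfo)
    (fun i ω => stabilityTerm_nonneg hC0 (hγ ω t) (hp0 t ht ω) i) (M := 6 * Fintype.card (Fin K))
    (fun i ω => mul_stabilityTerm_le (by linarith) (hγ ω t) (hp0 t ht ω) (hp1 t ht ω) i)
  have IZ := integrable_regretScale hB hp S
  -- pointwise inequality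
  have hpoint : ∀ ω, ∑ t ∈ range T, loss t ω (arm t ω)
      ≤ ∑ t ∈ range T, loss t ω (arm t ω) / p t ω (arm t ω) * q t ω (arm t ω)
        + (T * K : ℝ)⁻¹ * ∑ t ∈ range T, loss t ω (arm t ω) / p t ω (arm t ω)
        + 3 * K * (C * Real.log T + θ)
        + (∑ t ∈ range T, st t (arm t ω) ω - ∑ t ∈ range T, ∑ i, p t ω i * st t i ω)
        + 30 * Real.log T * regretScale S T (fun t => p t ω) := by
    intro ω
    have h1 := sum_estimated_regret_le hS (hF ω) hK hT hKT hC hθ hθ2 (fun t ht => hl t ht ω)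
    have h2 := sum_stability_add_rateCost_le (C := C) hT (by linarith) S (hp ω)
    have e1 : ∑ i, cumulativeEstimate (fun s => p s ω) (fun s => arm s ω) (fun s => loss s ω) T i
        = ∑ t ∈ range T, loss t ω (arm t ω) / p t ω (arm t ω) := by
      unfold cumulativeEstimate
      rw [sum_comm]
      refine sum_congr rfl fun t _ => ?_
      rw [sum_eq_single (arm t ω)]
      · simp [lossEstimator]
      · intro i _ hi
        simp [lossEstimator, hi.symm]
      · simp
    have e2 : ∑ t ∈ range T, loss t ω (arm t ω) / p t ω (arm t ω)
          * (p t ω (arm t ω) - q t ω (arm t ω))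
        = ∑ t ∈ range T, loss t ω (arm t ω)
          - ∑ t ∈ range T, loss t ω (arm t ω) / p t ω (arm t ω) * q t ω (arm t ω) := by
      rw [← sum_sub_distrib]
      refine sum_congr rfl fun t ht => ?_
      rw [mul_sub, div_mul_cancel₀ _ (hp0 t (mem_range.1 ht) ω _).ne']
    rw [e1] at h1
    simp only [hqdef] at e2 ⊢
    simp only [hst]
    linarith
  have J1 : Integrable (fun ω => ∑ t ∈ range T, loss t ω (arm t ω)) P :=
    integrable_finsetSum _ fun t ht => (Iloss t (mem_range.1 ht)).1
  have J2 : Integrable (fun ω => ∑ t ∈ range T,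
      loss t ω (arm t ω) / p t ω (arm t ω) * q t ω (arm t ω)) P :=
    integrable_finsetSum _ fun t ht => (Iq t (mem_range.1 ht)).1
  have J3 : Integrable (fun ω => ∑ t ∈ range T, loss t ω (arm t ω) / p t ω (arm t ω)) P :=
    integrable_finsetSum _ fun t ht => (Iinv t (mem_range.1 ht)).1
  have J4 : Integrable (fun ω => ∑ t ∈ range T, st t (arm t ω) ω) P :=
    integrable_finsetSum _ fun t ht => (Ist t (mem_range.1 ht)).1
  have J5 : Integrable (fun ω => ∑ t ∈ range T, ∑ i, p t ω i * st t i ω) P :=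
    integrable_finsetSum _ fun t ht => (Ist t (mem_range.1 ht)).2.1
  have J6 : Integrable (fun ω => ∑ t ∈ range T, loss t ω iStar) P :=
    integrable_finsetSum _ fun t ht => integrable_loss hB (mem_range.1 ht) iStar
  have hint := integral_mono J1 ((((J2.add (J3.const_mul (T * K : ℝ)⁻¹)).add
    (integrable_const (3 * K * (C * Real.log T + θ)))).add (J4.sub J5)).add
    (IZ.const_mul (30 * Real.log T))) hpoint
  have hsplit : ∫ ω, ((((fun ω => ∑ t ∈ range T,
      loss t ω (arm t ω) / p t ω (arm t ω) * q t ω (arm t ω)) + fun ω => (T * K : ℝ)⁻¹ *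
        ∑ t ∈ range T, loss t ω (arm t ω) / p t ω (arm t ω)) +
      fun _ => 3 * K * (C * Real.log T + θ)) + ((fun ω => ∑ t ∈ range T, st t (arm t ω) ω)
        - fun ω => ∑ t ∈ range T, ∑ i, p t ω i * st t i ω) +
      fun ω => 30 * Real.log T * regretScale S T (fun t => p t ω) : Ω → ℝ) ω ∂P
      = ∫ ω, ∑ t ∈ range T, loss t ω (arm t ω) / p t ω (arm t ω) * q t ω (arm t ω) ∂P
        + (T * K : ℝ)⁻¹ * ∫ ω, ∑ t ∈ range T, loss t ω (arm t ω) / p t ω (arm t ω) ∂P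
        + 3 * K * (C * Real.log T + θ)
        + (∫ ω, ∑ t ∈ range T, st t (arm t ω) ω ∂P
          - ∫ ω, ∑ t ∈ range T, ∑ i, p t ω i * st t i ω ∂P)
        + 30 * Real.log T * ∫ ω, regretScale S T (fun t => p t ω) ∂P := by
    rw [integral_add' (((J2.add (J3.const_mul _)).add (integrable_const _)).add (J4.sub J5))
        (IZ.const_mul _),
      integral_add' ((J2.add (J3.const_mul _)).add (integrable_const _)) (J4.sub J5),
      integral_add' (J2.add (J3.const_mul _)) (integrable_const _),
      integral_add' J2 (J3.const_mul _), integral_sub' J4 J5, integral_const,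
      integral_const_mul, integral_const_mul]
    simp
  have hint2 := hint.trans hsplit.le
  -- Unbiasedness of importance weighting; the sum shrinks to `S` because the comparator vanishes
  -- outside.
  have E2 : ∫ ω, ∑ t ∈ range T, loss t ω (arm t ω) / p t ω (arm t ω) * q t ω (arm t ω) ∂P
      = ∑ t ∈ range T, ∫ ω, ∑ i ∈ S, q t ω i * loss t ω i ∂P := by
    rw [integral_finsetSum _ fun t ht => (Iq t (mem_range.1 ht)).1]
    refine sum_congr rfl fun t ht => ?_
    have ht := mem_range.1 ht
    rw [(Iq t ht).2.2]
    congr 1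
    funext ω
    rw [← sum_subset (subset_univ S)]
    · refine sum_congr rfl fun i _ => ?_
      rw [← mul_assoc, mul_div_cancel₀ _ (hp0 t ht ω i).ne', mul_comm]
    · intro i _ hi
      have : q t ω i = 0 := ftrlSolution_of_notMem hi
      rw [this, mul_zero, mul_zero]
  have E3 : (T * K : ℝ)⁻¹ * ∫ ω, ∑ t ∈ range T, loss t ω (arm t ω) / p t ω (arm t ω) ∂P ≤ 1 := by
    rw [integral_finsetSum _ fun t ht => (Iinv t (mem_range.1 ht)).1]
    have : ∑ t ∈ range T, ∫ ω, loss t ω (arm t ω) / p t ω (arm t ω) ∂P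
        ≤ ∑ t ∈ range T, (K : ℝ) := by
      refine sum_le_sum fun t ht => ?_
      have ht := mem_range.1 ht
      rw [(Iinv t ht).2.2]
      calc _ ≤ ∫ _ω, (K : ℝ) ∂P := by
            refine integral_mono (Iinv t ht).2.1 (integrable_const _) fun ω => ?_
            calc _ ≤ ∑ _i : Fin K, (1 : ℝ) := sum_le_sum fun i _ => by
                  rw [mul_div_cancel₀ _ (hp0 t ht ω i).ne']; exact (hl t ht ω i).2
              _ = K := by simp
        _ = K := by simp
    rw [sum_const, card_range, nsmul_eq_mul] at this
    have hTK : (0 : ℝ) < T * K := by positivity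
    rw [inv_mul_le_iff₀ hTK]
    linarith
  -- Hence the bracket in `hpoint`, drawn stability terms minus their averages under `p`, has mean
  -- zero.
  have E4 : ∫ ω, ∑ t ∈ range T, st t (arm t ω) ω ∂P
      = ∫ ω, ∑ t ∈ range T, ∑ i, p t ω i * st t i ω ∂P := by
    rw [integral_finsetSum _ fun t ht => (Ist t (mem_range.1 ht)).1,
      integral_finsetSum _ fun t ht => (Ist t (mem_range.1 ht)).2.1]
    exact sum_congr rfl fun t ht => (Ist t (mem_range.1 ht)).2.2
  have hdrift := integral_comparator_sub_le (iStar := iStar) hB hS hqm (fun t _ => hq0 t)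
    (fun t _ => hqS t)
  rw [sum_sub_distrib] at hdrift
  unfold regret
  rw [integral_sub J1 J6, integral_finsetSum (range T)
    (f := fun t ω => loss t ω iStar) fun t ht => integrable_loss hB (mem_range.1 ht) iStar]
  have hθK : 3 * (K : ℝ) * (C * Real.log T + θ) ≤ 3 * K * (C * Real.log T + 2) := by gcongr
  rw [E2, E4, sub_self] at hint2
  linarith

end Core

/-! ### From the regret scale to the instance complexity -/

section Complexity

variable {K : ℕ} {Δ P : Fin K → ℝ}

lemma sqrt_one_add_le {x : ℝ} (hx : 0 ≤ x) : √(1 + x) ≤ 1 + √x := by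
  apply Real.sqrt_le_iff.2 ⟨by positivity, ?_⟩
  nlinarith [Real.sq_sqrt hx, Real.sqrt_nonneg x]

lemma instanceComplexity_nonneg (hΔ : ∀ i, 0 ≤ Δ i) : 0 ≤ instanceComplexity Δ := by
  unfold instanceComplexity
  split_ifs with h
  · obtain ⟨i, hi, he⟩ := exists_mem_eq_inf' h Δ
    rw [he]
    have := hΔ i
    have : 0 ≤ ∑ i ∈ posGapArms Δ, 1 / Δ i := sum_nonneg fun i _ => by
      have := hΔ i; positivity
    positivity
  · exact le_rfl

lemma sum_one_div_le_instanceComplexity (hΔ : ∀ i, 0 ≤ Δ i) :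
    ∑ i ∈ posGapArms Δ, 1 / Δ i ≤ instanceComplexity Δ := by
  unfold instanceComplexity
  split_ifs with h
  · obtain ⟨i, hi, he⟩ := exists_mem_eq_inf' h Δ
    rw [he]
    have := hΔ i
    have : (0 : ℝ) ≤ #(zeroGapArms Δ) / Δ i := by positivity
    linarith
  · rw [not_nonempty_iff_eq_empty.1 h, sum_empty]

lemma pos_of_mem_posGapArms (hΔ : ∀ i, 0 ≤ Δ i) {i : Fin K} (hi : i ∈ posGapArms Δ) : 0 < Δ i :=
  lt_of_le_of_ne (hΔ i) (Ne.symm (mem_filter.1 hi).2)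

lemma compl_zeroGapArms : (zeroGapArms Δ)ᶜ = posGapArms Δ := by
  ext i; simp [zeroGapArms, posGapArms]

lemma sum_posGapArms_mul_le (hΔ : ∀ i, 0 ≤ Δ i) (hP : ∀ i, 0 ≤ P i) :
    ∑ i ∈ posGapArms Δ, P i * Δ i ≤ ∑ i, P i * Δ i :=
  sum_le_sum_of_subset_of_nonneg (subset_univ _) fun i _ _ => mul_nonneg (hP i) (hΔ i)

/-- Cauchy–Schwarz with the factors `1 / Δ i` and `P i * Δ i`. -/
lemma sum_sqrt_le_sqrt_instanceComplexity (hΔ : ∀ i, 0 ≤ Δ i) (hP : ∀ i, 0 ≤ P i) :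
    ∑ i ∈ posGapArms Δ, √(P i) ≤ √(instanceComplexity Δ * ∑ i, P i * Δ i) := by
  have h := Real.sum_mul_le_sqrt_mul_sqrt (posGapArms Δ) (fun i => √(1 / Δ i))
    (fun i => √(P i * Δ i))
  have e1 : ∀ i ∈ posGapArms Δ, √(1 / Δ i) * √(P i * Δ i) = √(P i) := fun i hi => by
    have := pos_of_mem_posGapArms hΔ hi
    rw [← Real.sqrt_mul (by positivity)]
    congr 1
    field_simp
  have e2 : ∀ i ∈ posGapArms Δ, √(1 / Δ i) ^ 2 = 1 / Δ i := fun i _ =>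
    Real.sq_sqrt (one_div_nonneg.2 (hΔ i))
  have e3 : ∀ i ∈ posGapArms Δ, √(P i * Δ i) ^ 2 = P i * Δ i := fun i _ =>
    Real.sq_sqrt (mul_nonneg (hP i) (hΔ i))
  rw [sum_congr rfl e1, sum_congr rfl e2, sum_congr rfl e3] at h
  refine h.trans ?_
  rw [Real.sqrt_mul (instanceComplexity_nonneg hΔ)]
  exact mul_le_mul (Real.sqrt_le_sqrt (sum_one_div_le_instanceComplexity hΔ))
    (Real.sqrt_le_sqrt (sum_posGapArms_mul_le hΔ hP)) (Real.sqrt_nonneg _) (Real.sqrt_nonneg _)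

lemma card_mul_sum_le_instanceComplexity (hΔ : ∀ i, 0 ≤ Δ i) (hP : ∀ i, 0 ≤ P i) :
    #(zeroGapArms Δ) * ∑ i ∈ posGapArms Δ, P i ≤ instanceComplexity Δ * ∑ i, P i * Δ i := by
  by_cases h : (posGapArms Δ).Nonempty
  · have hmin : 0 < (posGapArms Δ).inf' h Δ := by
      obtain ⟨i, hi, he⟩ := exists_mem_eq_inf' h Δ
      rw [he]
      exact pos_of_mem_posGapArms hΔ hi
    have h1 : (#(zeroGapArms Δ) : ℝ) / (posGapArms Δ).inf' h Δ ≤ instanceComplexity Δ := by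
      unfold instanceComplexity
      rw [dif_pos h]
      exact le_add_of_nonneg_right (sum_nonneg fun i _ => one_div_nonneg.2 (hΔ i))
    have h2 : (posGapArms Δ).inf' h Δ * ∑ i ∈ posGapArms Δ, P i ≤ ∑ i, P i * Δ i := by
      refine le_trans ?_ (sum_posGapArms_mul_le hΔ hP)
      rw [mul_sum]
      refine sum_le_sum fun i hi => ?_
      rw [mul_comm]
      exact mul_le_mul_of_nonneg_left (inf'_le Δ hi) (hP i)
    have h3 : 0 ≤ ∑ i ∈ posGapArms Δ, P i := sum_nonneg fun i _ => hP i
    calc #(zeroGapArms Δ) * ∑ i ∈ posGapArms Δ, P i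
        = (#(zeroGapArms Δ) : ℝ) / (posGapArms Δ).inf' h Δ
          * ((posGapArms Δ).inf' h Δ * ∑ i ∈ posGapArms Δ, P i) := by field_simp
      _ ≤ _ := mul_le_mul h1 h2 (by positivity) (instanceComplexity_nonneg hΔ)
  · rw [not_nonempty_iff_eq_empty.1 h, sum_empty, mul_zero]
    exact mul_nonneg (instanceComplexity_nonneg hΔ)
      (sum_nonneg fun i _ => mul_nonneg (hP i) (hΔ i))

/-- Serves the case without zero-gap arms, where the comparison set is one arm and the complexity
has no `|U| / Δ_min` term: each `1 / Δ i` is at most the complexity. -/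
lemma sum_le_instanceComplexity_mul (hΔ : ∀ i, 0 ≤ Δ i) (hP : ∀ i, 0 ≤ P i) :
    ∑ i ∈ posGapArms Δ, P i ≤ instanceComplexity Δ * ∑ i, P i * Δ i := by
  refine le_trans ?_ (mul_le_mul_of_nonneg_left (sum_posGapArms_mul_le hΔ hP)
    (instanceComplexity_nonneg hΔ))
  rw [mul_sum]
  refine sum_le_sum fun i hi => ?_
  have hi0 := pos_of_mem_posGapArms hΔ hi
  have h1 : 1 / Δ i ≤ instanceComplexity Δ :=
    (single_le_sum (f := fun i => 1 / Δ i) (fun j _ => one_div_nonneg.2 (hΔ j)) hi).trans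
      (sum_one_div_le_instanceComplexity hΔ)
  have := mul_le_mul_of_nonneg_right h1 (mul_nonneg (hP i) (hΔ i))
  refine le_trans (le_of_eq ?_) this
  field_simp

lemma regretScale_le {T : ℕ} {p : ℕ → Fin K → ℝ} (hp : ∀ t < T, ∀ i, 0 ≤ p t i)
    (S : Finset (Fin K)) :
    regretScale S T p ≤ K + ∑ i ∈ Sᶜ, √(∑ t ∈ range T, p t i)
      + √(#S * ∑ i ∈ Sᶜ, ∑ t ∈ range T, p t i) := by
  have hP : ∀ i, 0 ≤ ∑ t ∈ range T, p t i := fun i =>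
    sum_nonneg fun t ht => hp t (mem_range.1 ht) i
  unfold regretScale
  have h1 : ∑ i ∈ Sᶜ, √(1 + ∑ t ∈ range T, p t i)
      ≤ #Sᶜ + ∑ i ∈ Sᶜ, √(∑ t ∈ range T, p t i) := by
    refine (sum_le_sum fun i _ => sqrt_one_add_le (hP i)).trans (le_of_eq ?_)
    rw [sum_add_distrib, sum_const, nsmul_eq_mul, mul_one]
  have h2 : √(#S * (1 + ∑ i ∈ Sᶜ, ∑ t ∈ range T, p t i))
      ≤ #S + √(#S * ∑ i ∈ Sᶜ, ∑ t ∈ range T, p t i) := by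
    have h3 : √(#S : ℝ) ≤ #S := by
      apply Real.sqrt_le_iff.2 ⟨by positivity, ?_⟩
      have : #S ≤ #S ^ 2 := Nat.le_self_pow (by norm_num) _
      exact_mod_cast this
    rw [Real.sqrt_mul (Nat.cast_nonneg _), Real.sqrt_mul (Nat.cast_nonneg _)]
    have := mul_le_mul_of_nonneg_left (sqrt_one_add_le (sum_nonneg fun i (_ : i ∈ Sᶜ) => hP i))
      (Real.sqrt_nonneg (#S : ℝ))
    linarith
  have h3 : (#S : ℝ) + #Sᶜ = K := by
    have := card_add_card_compl S
    rw [Fintype.card_fin] at this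
    exact_mod_cast this
  linarith

/-- The set of arms to which the algorithm is compared: the zero-gap arms, or `iStar` if there are
none. -/
def comparisonArms (Δ : Fin K → ℝ) (iStar : Fin K) : Finset (Fin K) :=
  if (zeroGapArms Δ).Nonempty then zeroGapArms Δ else {iStar}

lemma comparisonArms_nonempty (iStar : Fin K) : (comparisonArms Δ iStar).Nonempty := by
  unfold comparisonArms
  split_ifs with h
  exacts [h, singleton_nonempty _]

lemma regretScale_comparisonArms_le {T : ℕ} {p : ℕ → Fin K → ℝ} (hΔ : ∀ i, 0 ≤ Δ i)
    (hp : ∀ t < T, ∀ i, 0 ≤ p t i) (iStar : Fin K) :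
    regretScale (comparisonArms Δ iStar) T p
      ≤ K + 2 * √(instanceComplexity Δ * ∑ t ∈ range T, ∑ i, p t i * Δ i) := by
  have hP : ∀ i, 0 ≤ ∑ t ∈ range T, p t i := fun i =>
    sum_nonneg fun t ht => hp t (mem_range.1 ht) i
  have e : ∑ t ∈ range T, ∑ i, p t i * Δ i = ∑ i, (∑ t ∈ range T, p t i) * Δ i := by
    rw [sum_comm]; simp only [sum_mul]
  rw [e]
  refine (regretScale_le hp _).trans ?_
  have h1 := sum_sqrt_le_sqrt_instanceComplexity hΔ hP
  have hsub : (comparisonArms Δ iStar)ᶜ ⊆ posGapArms Δ := by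
    unfold comparisonArms
    split_ifs with h
    · rw [compl_zeroGapArms]
    · rw [← compl_zeroGapArms, not_nonempty_iff_eq_empty.1 h, compl_empty]
      exact subset_univ _
  have h2 : ∑ i ∈ (comparisonArms Δ iStar)ᶜ, √(∑ t ∈ range T, p t i)
      ≤ ∑ i ∈ posGapArms Δ, √(∑ t ∈ range T, p t i) :=
    sum_le_sum_of_subset_of_nonneg hsub fun i _ _ => Real.sqrt_nonneg _
  have h3 : #(comparisonArms Δ iStar) * ∑ i ∈ (comparisonArms Δ iStar)ᶜ, ∑ t ∈ range T, p t i
      ≤ instanceComplexity Δ * ∑ i, (∑ t ∈ range T, p t i) * Δ i := by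
    by_cases h : (zeroGapArms Δ).Nonempty
    · rw [comparisonArms, if_pos h, compl_zeroGapArms]
      exact card_mul_sum_le_instanceComplexity hΔ hP
    · have hc : #(comparisonArms Δ iStar) = 1 := by rw [comparisonArms, if_neg h, card_singleton]
      rw [hc, Nat.cast_one, one_mul]
      exact (sum_le_sum_of_subset_of_nonneg hsub fun i _ _ => hP i).trans
        (sum_le_instanceComplexity_mul hΔ hP)
  have h4 := Real.sqrt_le_sqrt h3
  linarith

/-- For a single comparison arm the scale of the regret is at most of order `√(K T)`. -/
lemma regretScale_singleton_le {T : ℕ} {p : ℕ → Fin K → ℝ} (hK : 2 ≤ K) (hKT : K ≤ T)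
    (hp : ∀ t < T, p t ∈ posSimplex K) (iStar : Fin K) :
    regretScale {iStar} T p ≤ 4 * √((K : ℝ) * T) := by
  have hKr : (2 : ℝ) ≤ K := by exact_mod_cast hK
  have hKTr : (K : ℝ) ≤ T := by exact_mod_cast hKT
  have hP : ∀ i, 0 ≤ ∑ t ∈ range T, p t i := fun i =>
    sum_nonneg fun t ht => ((hp t (mem_range.1 ht)).1 i).le
  have hsum : ∑ i, ∑ t ∈ range T, p t i = T := by
    rw [sum_comm, sum_congr rfl fun t ht => (hp t (mem_range.1 ht)).2]
    simp
  have hle : ∑ i ∈ {iStar}ᶜ, ∑ t ∈ range T, p t i ≤ T := by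
    rw [← hsum]
    exact sum_le_sum_of_subset_of_nonneg (subset_univ _) fun i _ _ => hP i
  have h1 : ∑ i ∈ {iStar}ᶜ, √(∑ t ∈ range T, p t i) ≤ √((K : ℝ) * T) := by
    refine (sum_le_sum_of_subset_of_nonneg (subset_univ _)
      fun i _ _ => Real.sqrt_nonneg _).trans ?_
    have h := Real.sum_mul_le_sqrt_mul_sqrt univ (fun _ : Fin K => (1 : ℝ))
      (fun i => √(∑ t ∈ range T, p t i))
    simp only [one_mul, one_pow, Real.sq_sqrt (hP _), hsum, sum_const, card_univ,
      Fintype.card_fin, nsmul_eq_mul, mul_one] at h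
    rwa [← Real.sqrt_mul (Nat.cast_nonneg _)] at h
  have h2 : √(#({iStar} : Finset (Fin K)) * ∑ i ∈ {iStar}ᶜ, ∑ t ∈ range T, p t i)
      ≤ √((K : ℝ) * T) := by
    apply Real.sqrt_le_sqrt
    rw [card_singleton, Nat.cast_one, one_mul]
    nlinarith
  have h3 : (K : ℝ) ≤ √((K : ℝ) * T) := by
    apply Real.le_sqrt_of_sq_le
    nlinarith
  have := regretScale_le (fun t ht i => ((hp t ht).1 i).le) {iStar}
  have := Real.sqrt_nonneg ((K : ℝ) * T)
  linarith

end Complexity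

/-! ### Drift, trivial bounds and Jensen's inequality -/

section Regret

variable {Ω : Type*} [mΩ : MeasurableSpace Ω] {P : Measure Ω}
  {F : Filtration ℕ mΩ} {K T : ℕ} {loss : ℕ → Ω → Fin K → ℝ} {arm : ℕ → Ω → Fin K}
  {p : ℕ → Ω → Fin K → ℝ} {iStar : Fin K} {Δ : Fin K → ℝ}

lemma benchmarkDrift_singleton : benchmarkDrift P F T loss iStar {iStar} = 0 := by
  unfold benchmarkDrift
  simp only [dif_pos (singleton_nonempty iStar), sup'_singleton, sub_self]
  have h0 : ∀ t, P[fun _ : Ω => (0 : ℝ) | F t] = 0 := fun t => condExp_zero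
  simp [h0]

lemma benchmarkDrift_comparisonArms :
    benchmarkDrift P F T loss iStar (comparisonArms Δ iStar)
      = benchmarkDrift P F T loss iStar (zeroGapArms Δ) := by
  unfold comparisonArms
  split_ifs with h
  · rfl
  · rw [benchmarkDrift_singleton, not_nonempty_iff_eq_empty.1 h]
    simp [benchmarkDrift]

lemma regret_eq_zero_of_subsingleton [Subsingleton (Fin K)] : regret P T loss arm iStar = 0 := by
  have : ∀ t ω, arm t ω = iStar := fun t ω => Subsingleton.elim _ _
  simp [regret, this]

variable [IsProbabilityMeasure P]

/-- Always playing one fixed arm of `S` is a predictable distribution, and by optimality of `iStar`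
it is no better than `iStar`. -/
lemma benchmarkDrift_nonneg (hB : IsBanditInteraction P F T loss arm p)
    (hbest : IsBestArm P T loss iStar) (S : Finset (Fin K)) :
    0 ≤ benchmarkDrift P F T loss iStar S := by
  by_cases hS : S.Nonempty
  · obtain ⟨i, hi⟩ := hS
    refine le_trans ?_ (integral_comparator_sub_le (iStar := iStar) hB ⟨i, hi⟩
      (q := fun _ _ j => if j = i then 1 else 0) (fun _ _ _ => measurable_const)
      (fun _ _ _ j => by positivity) (fun _ _ _ => by simp [hi]))
    have h := hbest i
    rw [integral_finsetSum (range T) (f := fun t ω => loss t ω iStar) fun t ht =>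
        integrable_loss hB (mem_range.1 ht) iStar,
      integral_finsetSum (range T) (f := fun t ω => loss t ω i) fun t ht =>
        integrable_loss hB (mem_range.1 ht) i] at h
    simp only [ite_mul, one_mul, zero_mul, sum_ite_eq', hi, if_true, sum_sub_distrib]
    linarith
  · simp [benchmarkDrift, hS]

lemma regret_le_card (hB : IsBanditInteraction P F T loss arm p) :
    regret P T loss arm iStar ≤ T := by
  unfold regret
  by_cases hint : Integrable (fun ω => ∑ t ∈ range T, loss t ω (arm t ω)
      - ∑ t ∈ range T, loss t ω iStar) P
  · calc _ ≤ ∫ _ω, (T : ℝ) ∂P := by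
          refine integral_mono hint (integrable_const _) fun ω => ?_
          have h1 : ∑ t ∈ range T, loss t ω (arm t ω) ≤ ∑ t ∈ range T, (1 : ℝ) :=
            sum_le_sum fun t ht => (hB.loss_mem t (mem_range.1 ht) ω _).2
          have h2 : 0 ≤ ∑ t ∈ range T, loss t ω iStar :=
            sum_nonneg fun t ht => (hB.loss_mem t (mem_range.1 ht) ω _).1
          simp only [sum_const, card_range, nsmul_eq_mul, mul_one] at h1
          linarith
      _ = T := by simp
  -- Without integrability the integral has the default value `0`, so the bound still holds.
  · rw [integral_undef hint]
    exact Nat.cast_nonneg T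

lemma integrable_sqrt {f : Ω → ℝ} (hf : Integrable f P) (hf0 : ∀ ω, 0 ≤ f ω) :
    Integrable (fun ω => √(f ω)) P := by
  refine (hf.add (integrable_const 1)).mono' (Real.continuous_sqrt.comp_aestronglyMeasurable hf.1)
    (Filter.Eventually.of_forall fun ω => ?_)
  rw [Real.norm_of_nonneg (Real.sqrt_nonneg _)]
  apply Real.sqrt_le_iff.2 ⟨by have := hf0 ω; simp only [Pi.add_apply]; positivity, ?_⟩
  simp only [Pi.add_apply]
  nlinarith [hf0 ω]

lemma integral_sqrt_le {f : Ω → ℝ} (hf : Integrable f P) (hf0 : ∀ ω, 0 ≤ f ω) :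
    ∫ ω, √(f ω) ∂P ≤ √(∫ ω, f ω ∂P) :=
  Real.strictConcaveOn_sqrt.concaveOn.le_map_integral Real.continuous_sqrt.continuousOn
    isClosed_Ici (Filter.Eventually.of_forall hf0) hf (integrable_sqrt hf hf0)

end Regret

/-! ### The two regret bounds -/

section Main

variable {Ω : Type*} [mΩ : MeasurableSpace Ω] {P : Measure Ω} [IsProbabilityMeasure P]
  {F : Filtration ℕ mΩ} {K T : ℕ} {loss : ℕ → Ω → Fin K → ℝ} {arm : ℕ → Ω → Fin K}
  {p : ℕ → Ω → Fin K → ℝ} {iStar : Fin K} {Δ : Fin K → ℝ} {C : ℝ}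

lemma le_log_of_two_le {n : ℕ} (hn : 2 ≤ n) : 0.69 ≤ Real.log n := by
  have h := Real.log_le_log (by norm_num) (show (2 : ℝ) ≤ n by exact_mod_cast hn)
  linarith [Real.log_two_gt_d9]

lemma overhead_le (hK : 2 ≤ K) (hT : 2 ≤ T) :
    1 + 3 * K * (162 * Real.log K * Real.log T + 2) ≤ 510 * (K * Real.log K * Real.log T) := by
  have hKr : (2 : ℝ) ≤ K := by exact_mod_cast hK
  have hk := le_log_of_two_le hK
  have hℓ := le_log_of_two_le hT
  have h1 : 0.47 ≤ Real.log K * Real.log T := by nlinarith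
  have h2 : (K : ℝ) * 0.47 ≤ K * (Real.log K * Real.log T) := by gcongr
  nlinarith

/-- The worst-case regret bound. -/
lemma regret_le_sqrt (hB : IsBanditInteraction P F T loss arm p)
    (hF : ∀ ω, IsShannonFTRL (162 * Real.log K) 1 (√(1 / Real.log T)) T
      (fun t => p t ω) (fun t => arm t ω) (fun t => loss t ω))
    (hK : 2 ≤ K) (hT : 2 ≤ T) (hKT : K ≤ T) :
    regret P T loss arm iStar ≤ 630 * (√((K : ℝ) * T) * Real.log T) := by
  have hKr : (2 : ℝ) ≤ K := by exact_mod_cast hK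
  have hTr : (2 : ℝ) ≤ T := by exact_mod_cast hT
  have hk := le_log_of_two_le hK
  have hℓ := le_log_of_two_le hT
  have hp : ∀ ω, ∀ t < T, p t ω ∈ posSimplex K := fun ω t ht => (hF ω t ht).1
  set s := √((K : ℝ) * T) with hs
  have hs0 : 0 ≤ s := Real.sqrt_nonneg _
  -- If `K log K ≤ √(K T)`, the barrier overhead is absorbed and `510 + 30 · 4 = 630`. Otherwise
  -- `√(K T) ≤ K log T`, hence `T ≤ √(K T) log T`, and the trivial bound `T` suffices.
  rcases le_or_gt (K * Real.log K) s with h | h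
  · have h1 := regret_le_regretScale (iStar := iStar) hB (singleton_nonempty iStar) hF hT hKT
      (by linarith)
    rw [benchmarkDrift_singleton] at h1
    have h2 : ∫ ω, regretScale {iStar} T (fun t => p t ω) ∂P ≤ ∫ _ω, 4 * s ∂P :=
      integral_mono (integrable_regretScale hB hp _) (integrable_const _)
        fun ω => regretScale_singleton_le hK hKT (hp ω) iStar
    simp only [integral_const, probReal_univ, smul_eq_mul, one_mul] at h2
    have h3 := overhead_le hK hT
    have h4 := mul_le_mul_of_nonneg_right h (show 0 ≤ Real.log T by linarith)
    have h5 := mul_le_mul_of_nonneg_left h2 (show 0 ≤ 30 * Real.log T by linarith)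
    linarith
  · refine (regret_le_card hB).trans ?_
    have hlog : Real.log K ≤ Real.log T :=
      Real.log_le_log (by linarith) (by exact_mod_cast hKT)
    have h1 : s ≤ K * Real.log T := h.le.trans (by gcongr)
    have hss : s * s = K * T := Real.mul_self_sqrt (by positivity)
    have h2 : (T : ℝ) ≤ s * Real.log T := by
      have : s * s ≤ s * (K * Real.log T) := by gcongr
      have h3 : (K : ℝ) * T ≤ K * (s * Real.log T) := by linarith
      exact le_of_mul_le_mul_left h3 (by linarith)
    nlinarith

lemma log_le_rpow_three_halves (hT : 2 ≤ T) :
    Real.log T ≤ 1.25 * Real.log T ^ (3 / 2 : ℝ) := by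
  have hℓ := le_log_of_two_le hT
  have h0 : 0 < Real.log T := by linarith
  have e : Real.log T ^ (3 / 2 : ℝ) = Real.log T * √(Real.log T) := by
    rw [Real.sqrt_eq_rpow, ← Real.rpow_one_add' h0.le (by norm_num)]
    norm_num
  have h1 : 0.8 ≤ √(Real.log T) := Real.le_sqrt_of_sq_le (by norm_num; linarith)
  rw [e]
  nlinarith

lemma overhead_le_rpow (hK : 2 ≤ K) (hT : 2 ≤ T) :
    510 * (K * Real.log K * Real.log T) + 30 * Real.log T * K
      ≤ 700 * ((K : ℝ) ^ 2 * Real.log T ^ (3 / 2 : ℝ)) := by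
  have hKr : (2 : ℝ) ≤ K := by exact_mod_cast hK
  have hℓ := le_log_of_two_le hT
  have h1 : Real.log K ≤ K := (Real.log_le_sub_one_of_pos (by linarith)).trans (by linarith)
  have h2 := log_le_rpow_three_halves hT
  have h3 : (K : ℝ) * Real.log K * Real.log T ≤ K * K * Real.log T := by gcongr
  have h4 : Real.log T * K ≤ K * K * Real.log T := by
    nlinarith [mul_nonneg (mul_nonneg (show (0 : ℝ) ≤ K by linarith)
      (show 0 ≤ Real.log T by linarith)) (show (0 : ℝ) ≤ K - 1 by linarith)]
  have h5 := mul_le_mul_of_nonneg_left h2 (sq_nonneg (K : ℝ))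
  nlinarith

/-- Solution of the self-bounding inequality. -/
lemma le_of_le_add_sqrt_mul_add {r a H c : ℝ} (ha : 0 ≤ a) (hH : 0 ≤ H) (hc : 0 ≤ c)
    (h : r ≤ a + 60 * √(H * (r + c))) : r ≤ 2 * a + 3600 * H + 120 * √(c * H) := by
  have hn := Real.sqrt_nonneg (c * H)
  rcases le_or_gt r 0 with hr | hr
  · linarith
  · have h1 : √(H * (r + c)) ≤ √(H * r) + √(c * H) := by
      apply Real.sqrt_le_iff.2 ⟨by positivity, ?_⟩
      have e1 := Real.sq_sqrt (show 0 ≤ H * r by positivity)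
      have e2 := Real.sq_sqrt (show 0 ≤ c * H by positivity)
      nlinarith [mul_nonneg (Real.sqrt_nonneg (H * r)) hn]
    have h2 : 60 * √(H * r) ≤ r / 2 + 1800 * H := by
      rw [Real.sqrt_mul hH]
      nlinarith [Real.sq_sqrt hH, Real.sq_sqrt hr.le, sq_nonneg (√r - 60 * √H)]
    linarith

/-- The regret bound under the self-bounding condition. -/
lemma regret_le_of_selfBounding (hB : IsBanditInteraction P F T loss arm p)
    (hF : ∀ ω, IsShannonFTRL (162 * Real.log K) 1 (√(1 / Real.log T)) T
      (fun t => p t ω) (fun t => arm t ω) (fun t => loss t ω))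
    (hbest : IsBestArm P T loss iStar)
    (hK : 2 ≤ K) (hT : 2 ≤ T) (hKT : K ≤ T) (hSB : SelfBounding P T loss arm p iStar Δ C) :
    regret P T loss arm iStar ≤ 3600 * (instanceComplexity Δ * Real.log T ^ 2
      + √(C * (instanceComplexity Δ * Real.log T ^ 2)) + (K : ℝ) ^ 2 * Real.log T ^ (3 / 2 : ℝ)
      + benchmarkDrift P F T loss iStar (zeroGapArms Δ)) := by
  obtain ⟨hΔ, hC, hself⟩ := hSB
  have hΔ0 : ∀ i, 0 ≤ Δ i := fun i => (hΔ i).1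
  have hk := le_log_of_two_le hK
  have hℓ := le_log_of_two_le hT
  have hℓ0 : 0 ≤ Real.log T := by linarith
  have hp : ∀ ω, ∀ t < T, p t ω ∈ posSimplex K := fun ω t ht => (hF ω t ht).1
  have hG := instanceComplexity_nonneg hΔ0
  have hD := benchmarkDrift_nonneg hB hbest (zeroGapArms Δ)
  have h1 := regret_le_regretScale (iStar := iStar) hB (comparisonArms_nonempty (Δ := Δ) iStar)
    hF hT hKT (by linarith)
  rw [benchmarkDrift_comparisonArms] at h1
  have hpint : ∀ t ∈ range T, ∀ i, Integrable (fun ω => p t ω i) P := fun t ht i => by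
    have ht := mem_range.1 ht
    refine Integrable.of_bound
      ((measurable_prob hB ht i).mono (F.le t) le_rfl).aestronglyMeasurable 1
      (Filter.Eventually.of_forall fun ω => ?_)
    rw [Real.norm_of_nonneg ((hp ω t ht).1 i).le, ← (hp ω t ht).2]
    exact single_le_sum (f := p t ω) (fun j _ => ((hp ω t ht).1 j).le) (mem_univ i)
  set X : Ω → ℝ := fun ω => ∑ t ∈ range T, ∑ i, p t ω i * Δ i with hX
  have hXint : Integrable X P := integrable_finsetSum _ fun t ht =>
    integrable_finsetSum _ fun i _ => (hpint t ht i).mul_const _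
  have hX0 : ∀ ω, 0 ≤ X ω := fun ω => sum_nonneg fun t ht => sum_nonneg fun i _ =>
    mul_nonneg ((hp ω t (mem_range.1 ht)).1 i).le (hΔ0 i)
  -- Jensen for the square root, so that only the expectation bounded by the self-bounding condition
  -- appears.
  have hsqrt := integral_sqrt_le (hXint.const_mul (instanceComplexity Δ))
    fun ω => mul_nonneg hG (hX0 ω)
  have hsqrtint : Integrable (fun ω => √(instanceComplexity Δ * X ω)) P :=
    integrable_sqrt (hXint.const_mul (instanceComplexity Δ)) fun ω => mul_nonneg hG (hX0 ω)
  have h2 : ∫ ω, regretScale (comparisonArms Δ iStar) T (fun t => p t ω) ∂P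
      ≤ K + 2 * √(instanceComplexity Δ * ∫ ω, X ω ∂P) := by
    rw [integral_const_mul] at hsqrt
    calc _ ≤ ∫ ω, (K + 2 * √(instanceComplexity Δ * X ω)) ∂P :=
          integral_mono (integrable_regretScale hB hp _)
            ((integrable_const _).add (hsqrtint.const_mul 2))
            fun ω => regretScale_comparisonArms_le hΔ0
              (fun t ht i => ((hp ω t ht).1 i).le) iStar
      _ = K + 2 * ∫ ω, √(instanceComplexity Δ * X ω) ∂P := by
          rw [integral_add (integrable_const _) (hsqrtint.const_mul 2), integral_const_mul]
          simp
      _ ≤ _ := by linarith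
  have h3 := overhead_le hK hT
  have h4 := overhead_le_rpow hK hT
  set r := regret P T loss arm iStar with hr
  have hXr : ∫ ω, X ω ∂P ≤ r + C := by linarith
  set H := instanceComplexity Δ * Real.log T ^ 2 with hH
  have hH0 : 0 ≤ H := by positivity
  have h5 : Real.log T * √(instanceComplexity Δ * ∫ ω, X ω ∂P) ≤ √(H * (r + C)) := by
    have e : Real.log T * √(instanceComplexity Δ * ∫ ω, X ω ∂P)
        = √(H * ∫ ω, X ω ∂P) := by
      rw [hH, mul_right_comm, Real.sqrt_mul' _ (sq_nonneg _), Real.sqrt_sq hℓ0, mul_comm]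
    rw [e]
    exact Real.sqrt_le_sqrt (mul_le_mul_of_nonneg_left hXr hH0)
  have h6 := mul_le_mul_of_nonneg_left h2 (show 0 ≤ 30 * Real.log T by linarith)
  have hpow : 0 ≤ (K : ℝ) ^ 2 * Real.log T ^ (3 / 2 : ℝ) := by positivity
  -- The coefficient `60` is `30 log T` times the factor `2` of the regret scale, with `log T` moved
  -- under the root into `H`. Nonnegativity of the drift gives `a ≥ 0` and lets `2 a` be absorbed
  -- into `3600`.
  have h7 := le_of_le_add_sqrt_mul_add (r := r) (H := H) (c := C)
    (a := 700 * ((K : ℝ) ^ 2 * Real.log T ^ (3 / 2 : ℝ))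
      + benchmarkDrift P F T loss iStar (zeroGapArms Δ)) (by positivity) hH0 hC (by linarith)
  have := Real.sqrt_nonneg (C * H)
  linarith

end Main

end

theorem theorem2 :
    ∃ κ : ℝ, 0 < κ ∧
      ∀ (K T : ℕ), 2 ≤ T → K ≤ T →
      ∀ {Ω : Type*} [mΩ : MeasurableSpace Ω] (P : Measure Ω) [IsProbabilityMeasure P]
        (F : Filtration ℕ mΩ) (loss : ℕ → Ω → Fin K → ℝ) (arm : ℕ → Ω → Fin K)
        (p : ℕ → Ω → Fin K → ℝ) (iStar : Fin K),
        IsBanditInteraction P F T loss arm p →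
        (∀ ω, IsShannonFTRL (162 * Real.log K) 1 (√(1 / Real.log T)) T
          (fun t => p t ω) (fun t => arm t ω) (fun t => loss t ω)) →
        IsBestArm P T loss iStar →
        regret P T loss arm iStar ≤ κ * (√((K : ℝ) * T) * Real.log T) ∧
        ∀ (Δ : Fin K → ℝ) (C D : ℝ),
          SelfBounding P T loss arm p iStar Δ C →
          benchmarkDrift P F T loss iStar (zeroGapArms Δ) ≤ D →
          regret P T loss arm iStar ≤
            κ * (instanceComplexity Δ * Real.log T ^ 2
              + √(C * (instanceComplexity Δ * Real.log T ^ 2))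
              + (K : ℝ) ^ 2 * Real.log T ^ (3 / 2 : ℝ) + D) := by
  refine ⟨3600, by norm_num, ?_⟩
  intro K T hT hKT Ω mΩ P _ F loss arm p iStar hB hF hbest
  have hℓ0 : 0 ≤ Real.log T := by linarith [le_log_of_two_le hT]
  -- With a single arm `162 log K = 0`, so there is no barrier and the analysis does not apply; the
  -- regret is then zero.
  rcases Nat.lt_or_ge K 2 with hK | hK
  · have : Subsingleton (Fin K) := Fin.subsingleton_iff_le_one.2 (by omega)
    rw [regret_eq_zero_of_subsingleton]
    refine ⟨by positivity, fun Δ C D hSB hD => ?_⟩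
    have hG := instanceComplexity_nonneg fun i => (hSB.1 i).1
    have hD0 := (benchmarkDrift_nonneg hB hbest (zeroGapArms Δ)).trans hD
    positivity
  · refine ⟨(regret_le_sqrt hB hF hK hT hKT).trans ?_, fun Δ C D hSB hD => ?_⟩
    · have : 0 ≤ √((K : ℝ) * T) * Real.log T := by positivity
      linarith
    · refine (regret_le_of_selfBounding hB hF hbest hK hT hKT hSB).trans ?_
      gcongr
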